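/- Let $n\ge 2$, $1<p<\infty$, and let $H:\mathbb R^n\to[0,\infty)$ be a convex function of class $C^1(\mathbb R^n\setminus\{0\})$ such that $H(t\xi)=|t|H(\xi)$ for all $t\in\mathbb R$, $\xi\in\mathbb R^n$, such that $\alpha|\xi|\le H(\xi)\le\beta|\xi|$ for all $\xi$ with some constants $0<\alpha\le\beta$, and such that $H^p$ is strictly convex. For a nonempty bounded open convex set $\Omega\subset\mathbb R^n$, let $\lambda_p(\Omega)$ be the first (that is, the smallest) Dirichlet eigenvalue of $-\mathcal Q_p$, where $\mathcal Q_p u=\operatorname{div}\big(H(Du)^{p-1}\nabla H(Du)\big)$: the smallest $\lambda$ for which there is a weak solution $u\in W^{1,p}_0(\Omega)\setminus\{0\}$ of $-\mathcal Q_p u=\lambda|u|^{p-2}u$ in $\Omega$, i.e. $$\int_\Omega H(Du)^{p-1}\,\nabla H(Du)\cdot D\varphi\,dx=\lambda\int_\Omega|u|^{p-2}u\,\varphi\,dx\qquad\text{for all }\varphi\in C_c^\infty(\Omega).$$ Let $$P_H(\Omega)=\int_{\partial\Omega}H(\nu_\Omega)\,d\mathcal H^{n-1}$$ be the anisotropic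 perimeter, $\nu_\Omega$ being the outer unit normal, let $|\Omega|$ be the Lebesgue measure of $\Omega$, and let $$\pi_p=2\int_0^{(p-1)^{1/p}}\frac{dt}{\big(1-\frac{t^p}{p-1}\big)^{1/p}}.$$ Then $$\lambda_p(\Omega)\le\Big(\frac{\pi_p}{2}\Big)^p\Big(\frac{P_H(\Omega)}{|\Omega|}\Big)^p .$$ -/

import Mathlib

open MeasureTheory Filter Topology Set
open scoped ENNReal NNReal ContDiff

noncomputable section

namespace Anisotropic

/-- `φ` is a test function on `Ω`: smooth with compact support contained in `Ω`. -/
def IsTestFunction {n : ℕ} (Ω : Set (EuclideanSpace ℝ (Fin n)))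
    (φ : EuclideanSpace ℝ (Fin n) → ℝ) : Prop :=
  ContDiff ℝ ∞ φ ∧ HasCompactSupport φ ∧ tsupport φ ⊆ Ω

/-- `G` is the weak gradient of `u` on `Ω`:
`∫_Ω u ∂_v φ = - ∫_Ω (G · v) φ` for all test functions `φ` and all directions `v`
(for locally integrable `u` and `G`). -/
def IsWeakGradient {n : ℕ} (Ω : Set (EuclideanSpace ℝ (Fin n)))
    (u : EuclideanSpace ℝ (Fin n) → ℝ)
    (G : EuclideanSpace ℝ (Fin n) → EuclideanSpace ℝ (Fin n)) : Prop :=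
  ∀ φ, IsTestFunction Ω φ → ∀ v : EuclideanSpace ℝ (Fin n),
    ∫ x in Ω, u x * inner ℝ (gradient φ x) v = - ∫ x in Ω, inner ℝ (G x) v * φ x

/-- `u` belongs to the Sobolev space `W^{1,p}(Ω)` and `G` is its weak gradient. -/
def MemW1p {n : ℕ} (p : ℝ) (Ω : Set (EuclideanSpace ℝ (Fin n)))
    (u : EuclideanSpace ℝ (Fin n) → ℝ)
    (G : EuclideanSpace ℝ (Fin n) → EuclideanSpace ℝ (Fin n)) : Prop :=
  MemLp u (ENNReal.ofReal p) (volume.restrict Ω) ∧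
  MemLp G (ENNReal.ofReal p) (volume.restrict Ω) ∧
  IsWeakGradient Ω u G

/-- `u` belongs to `W_0^{1,p}(Ω)`, the closure of the test functions in `W^{1,p}(Ω)`,
and `G` is its weak gradient. -/
def MemW01p {n : ℕ} (p : ℝ) (Ω : Set (EuclideanSpace ℝ (Fin n)))
    (u : EuclideanSpace ℝ (Fin n) → ℝ)
    (G : EuclideanSpace ℝ (Fin n) → EuclideanSpace ℝ (Fin n)) : Prop :=
  MemW1p p Ω u G ∧
  ∃ φ : ℕ → EuclideanSpace ℝ (Fin n) → ℝ, (∀ k, IsTestFunction Ω (φ k)) ∧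
    Tendsto (fun k => eLpNorm (fun x => φ k x - u x) (ENNReal.ofReal p) (volume.restrict Ω))
      atTop (𝓝 0) ∧
    Tendsto (fun k => eLpNorm (fun x => gradient (φ k) x - G x) (ENNReal.ofReal p)
      (volume.restrict Ω)) atTop (𝓝 0)

/-- `u ∈ W_0^{1,p}(Ω)` is a weak solution of `-𝒬_p u = lam |u|^{p-2} u` in `Ω`, `u = 0` on
`∂Ω`, where `𝒬_p u = div (H(Du)^{p-1} ∇H(Du))`. As `p > 1` and `H 0 = 0`, the vector field
`ξ ↦ H(ξ)^{p-1} ∇H(ξ)` is zero at `ξ = 0`, in agreement with its continuous extension. -/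
def IsWeakEigenfunction {n : ℕ} (H : EuclideanSpace ℝ (Fin n) → ℝ) (p : ℝ)
    (Ω : Set (EuclideanSpace ℝ (Fin n))) (lam : ℝ)
    (u : EuclideanSpace ℝ (Fin n) → ℝ) : Prop :=
  ∃ G : EuclideanSpace ℝ (Fin n) → EuclideanSpace ℝ (Fin n), MemW01p p Ω u G ∧
    ∀ φ, IsTestFunction Ω φ →
      ∫ x in Ω, H (G x) ^ (p - 1) * inner ℝ (gradient H (G x)) (gradient φ x) =
        lam * ∫ x in Ω, |u x| ^ (p - 2) * u x * φ x

/-- `lam` is a Dirichlet eigenvalue of `-𝒬_p` on `Ω`: there is a weak solution of the eigenvalue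
problem which is not almost everywhere zero in `Ω`. -/
def IsDirichletEigenvalue {n : ℕ} (H : EuclideanSpace ℝ (Fin n) → ℝ) (p : ℝ)
    (Ω : Set (EuclideanSpace ℝ (Fin n))) (lam : ℝ) : Prop :=
  ∃ u : EuclideanSpace ℝ (Fin n) → ℝ, IsWeakEigenfunction H p Ω lam u ∧
    ¬ (∀ᵐ x ∂(volume.restrict Ω), u x = 0)

/-- The first Dirichlet eigenvalue of `-𝒬_p` on `Ω`, the smallest one, as an extended
nonnegative number (it would be `∞` if there were no eigenvalue). -/
def firstEigenvalue {n : ℕ} (H : EuclideanSpace ℝ (Fin n) → ℝ) (p : ℝ)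
    (Ω : Set (EuclideanSpace ℝ (Fin n))) : ℝ≥0∞ :=
  sInf (ENNReal.ofReal '' {lam : ℝ | IsDirichletEigenvalue H p Ω lam})

/-- The unit vector `v` is the outer normal to `K` at `x`: up to first order at `x`, the set `K`
is the half-space `{y | ⟪y - x, v⟫ < 0}`. There is at most one such `v`, and for an open set with
Lipschitz boundary there is one at almost every boundary point. -/
def IsOuterNormal {n : ℕ} (K : Set (EuclideanSpace ℝ (Fin n)))
    (x v : EuclideanSpace ℝ (Fin n)) : Prop :=
  ‖v‖ = 1 ∧ ∀ ε > 0, ∃ δ > 0, ∀ y, ‖y - x‖ < δ →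
    (y ∈ K → inner ℝ (y - x) v ≤ ε * ‖y - x‖) ∧
    (y ∉ K → -(ε * ‖y - x‖) ≤ inner ℝ (y - x) v)

theorem IsOuterNormal.unique {n : ℕ} {K : Set (EuclideanSpace ℝ (Fin n))}
    {x v w : EuclideanSpace ℝ (Fin n)} (hv : IsOuterNormal K x v) (hw : IsOuterNormal K x w) :
    v = w := by
  by_contra hne
  have hlt : inner ℝ v w < 1 := (inner_lt_one_iff_real_of_norm_eq_one hv.1 hw.1).2 hne
  have hd : 0 < ‖v - w‖ := norm_pos_iff.2 (sub_ne_zero.2 hne)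
  set c : ℝ := 1 - inner ℝ v w with hc
  have hc0 : 0 < c := by linarith
  have h1 : inner ℝ (v - w) v = c := by
    rw [inner_sub_left, real_inner_self_eq_norm_sq, hv.1, real_inner_comm, hc]; norm_num
  have h2 : inner ℝ (v - w) w = -c := by
    rw [inner_sub_left, real_inner_self_eq_norm_sq, hw.1, hc]; norm_num
  have hε : 0 < c / (2 * ‖v - w‖) := by positivity
  obtain ⟨δ₁, hδ₁, hv'⟩ := hv.2 _ hε
  obtain ⟨δ₂, hδ₂, hw'⟩ := hw.2 _ hε
  set s : ℝ := min δ₁ δ₂ / (2 * ‖v - w‖) with hs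
  have hm : 0 < min δ₁ δ₂ := lt_min hδ₁ hδ₂
  have hs0 : 0 < s := by positivity
  have hnorm : ‖x + s • (v - w) - x‖ = s * ‖v - w‖ := by
    rw [add_sub_cancel_left, norm_smul, Real.norm_of_nonneg hs0.le]
  have hsm : s * ‖v - w‖ = min δ₁ δ₂ / 2 := by rw [hs]; field_simp
  have hmul : c / (2 * ‖v - w‖) * (s * ‖v - w‖) = s * (c / 2) := by field_simp
  have key : 0 < s * c := mul_pos hs0 hc0
  by_cases hK : x + s • (v - w) ∈ K
  · have := (hv' (x + s • (v - w)) (by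
      rw [hnorm, hsm]; linarith [min_le_left δ₁ δ₂])).1 hK
    rw [hnorm, hmul, add_sub_cancel_left, real_inner_smul_left, h1] at this
    linarith
  · have := (hw' (x + s • (v - w)) (by
      rw [hnorm, hsm]; linarith [min_le_right δ₁ δ₂])).2 hK
    rw [hnorm, hmul, add_sub_cancel_left, real_inner_smul_left, h2] at this
    linarith

open Classical in
/-- The outer unit normal to `K` at `x` where it exists, and `0` elsewhere. -/
def outerNormal {n : ℕ} (K : Set (EuclideanSpace ℝ (Fin n)))
    (x : EuclideanSpace ℝ (Fin n)) : EuclideanSpace ℝ (Fin n) :=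
  if h : ∃ v, IsOuterNormal K x v then h.choose else 0

/-- The anisotropic perimeter `∫_{∂K} H(ν_K) dℋ^{n-1}`, where `ℋ^{n-1}` is the Hausdorff measure
with the Euclidean normalization. -/
def anisotropicPerimeter {n : ℕ} (H : EuclideanSpace ℝ (Fin n) → ℝ)
    (K : Set (EuclideanSpace ℝ (Fin n))) : ℝ≥0∞ :=
  ∫⁻ x in frontier K, ENNReal.ofReal (H (outerNormal K x)) ∂μHE[n - 1]

/-- The number `π_p = 2 ∫_0^{(p-1)^{1/p}} (1 - t^p/(p-1))^{-1/p} dt`. -/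
def piP (p : ℝ) : ℝ :=
  2 * ∫ t in (0 : ℝ)..((p - 1) ^ (1 / p)), 1 / (1 - t ^ p / (p - 1)) ^ (1 / p)

end Anisotropic

end

/-! The Rayleigh quotient `∫ H(Dφ)^p / ∫ |φ|^p` is tested with a function of the distance to the
boundary. Put `L = |Ω|`, `P = P_H(Ω)`, `Q = π_p/2`, `κ = PQ/L`. Let `g` be the generalized sine,
inverse to `arcsinP` on `[0, Q]`, so that `g'^p + g^p/(p-1) = 1`, and let `u = g(κ d)`.
Heuristically `H(Dd) = 1`, so `H(Du)^p = κ^p (1 - u^p/(p-1))`, and with `I = ∫ u^p` the energy is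
`κ^p (L - I/(p-1))`. This is at most `κ^p I` exactly when `I ≥ L(p-1)/p`, and then the quotient is
at most `κ^p`, the desired bound.

The lower bound on `I` comes from `|{d ≤ t}| ≤ tP`: by the layer-cake formula, `I` is then at least
what it would be if `κ d` were uniformly distributed on `[0, Q]`, and the mean of `g^p` there is
`(p-1)/p` (`integral_rpow_mul_one_sub_arcsinP`, `le_lintegral_generalized_sine`).

The volume inequality (`volume_polyDist_le`) is proved for a polyhedral distance. Finitely many
vectors `w i` are chosen with `max ⟪w i, ξ⟫` between `H ξ/(1+ε)²` and `H ξ`, and `d` is the least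
exit time from `Ω` along the `w i`. Almost every point with `d ≤ t` runs along a minimizing `w i` to
a boundary point with normal `ν` at which `w i` maximizes `⟪w j, ν⟫`. The points using `w i` lie in
a tube of volume at most `t ∫ ⟪w i, ν⟫ ≤ t ∫ H(ν)` over a piece of the boundary. A generic rescaling
of the `w i` makes the pieces disjoint up to null sets, so the sum is at most `tP`. Mollification
turns `u` into test functions (`rayleigh_le_of_directional_bound`), and `ε → 0` concludes.

It remains to see that the infimum of the Rayleigh quotients is an eigenvalue
(`exists_isDirichletEigenvalue`). This is the direct method: compactness in `L^p`, strong
convergence of gradients from the strict convexity of `H^p`, and vanishing of the first variation.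
As `firstEigenvalue` is an infimum over eigenvalues, one eigenvalue satisfying the Rayleigh
inequality suffices. -/

noncomputable section

/-! ### Volumes of cylinders over subsets of a hyperplane. -/

namespace Anisotropic

variable {E : Type*} [NormedAddCommGroup E] [InnerProductSpace ℝ E] [FiniteDimensional ℝ E]
  [MeasurableSpace E] [BorelSpace E]

/-- The splitting of `E` into the line of `v` and its orthogonal complement preserves measure and
carries the cylinder into a product set. -/
theorem volume_orthogonal_cylinder {v : E} (hv : ‖v‖ = 1) {A : Set E}
    (hA : A ⊆ ((ℝ ∙ v)ᗮ : Submodule ℝ E)) (I : Set ℝ) :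
    volume (image2 (fun a (σ : ℝ) => a + σ • v) A I) ≤
      μHE[Module.finrank ℝ E - 1] A * volume I := by
  set s : Submodule ℝ E := ℝ ∙ v
  have hv0 : v ≠ 0 := by rintro rfl; simp at hv
  have hmp := s.measurePreserving_measurableEquivProd (0 : E)
  rw [InnerProductSpace.euclideanHausdorffMeasure_eq_volume] at hmp
  let e := LinearIsometryEquiv.toSpanUnitSingleton (𝕜 := ℝ) v hv
  have hvs : v ∈ s := Submodule.mem_span_singleton_self v
  have hsub : image2 (fun a (σ : ℝ) => a + σ • v) A I ⊆
      s.measurableEquivProd (0 : E) ⁻¹' ((e '' I) ×ˢ ((↑) ⁻¹' A : Set sᗮ)) := by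
    rintro _ ⟨a, ha, σ, hσ, rfl⟩
    have ha' : a ∈ sᗮ := hA ha
    have h1 : s.orthogonalProjectionOnto a = 0 :=
      s.orthogonalProjectionOnto_eq_zero_iff.2 ha'
    have h2 : s.orthogonalProjectionOnto v = ⟨v, hvs⟩ :=
      Submodule.orthogonalProjectionOnto_mem_subspace_eq_self (⟨v, hvs⟩ : s)
    have h3 : sᗮ.orthogonalProjectionOnto a = ⟨a, ha'⟩ :=
      Submodule.orthogonalProjectionOnto_mem_subspace_eq_self (⟨a, ha'⟩ : sᗮ)
    have h4 : sᗮ.orthogonalProjectionOnto v = 0 :=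
      Submodule.orthogonalProjectionOnto_orthogonal_apply_eq_zero hvs
    simp only [mem_preimage, Submodule.measurableEquivProd_apply, vsub_eq_sub, sub_zero, map_add,
      map_smul, h1, h2, h3, h4, zero_add, smul_zero, add_zero, mem_prod]
    exact ⟨⟨σ, hσ, Subtype.ext rfl⟩, ha⟩
  refine (measure_mono hsub).trans ?_
  rw [MeasurePreserving.measure_preimage_equiv hmp, Measure.volume_eq_prod, Measure.prod_prod]
  have h1 : volume (e '' I) = volume I := by
    have := e.symm.measurePreserving.measure_preimage_equiv (f := e.symm.toMeasurableEquiv) I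
    rw [← this]
    congr 1
    exact e.toEquiv.image_eq_preimage_symm I
  have hr : Module.finrank ℝ sᗮ = Module.finrank ℝ E - 1 := by
    have := s.finrank_add_finrank_orthogonal
    have h1 : Module.finrank ℝ s = 1 := finrank_span_singleton hv0
    omega
  have h2 : volume ((↑) ⁻¹' A : Set sᗮ) = μHE[Module.finrank ℝ E - 1] A := by
    rw [← InnerProductSpace.euclideanHausdorffMeasure_eq_volume, hr,
      ← isometry_subtype_coe.euclideanHausdorffMeasure_image]
    congr 1
    exact (Subtype.image_preimage_coe (sᗮ : Set E) A).trans (inter_eq_right.2 hA)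
  rw [h1, h2, mul_comm]

/-- The shear `x ↦ x + ⟪v, x⟫ (w - v)` fixes the hyperplane, sends `v` to `w` and has determinant
`⟪v, w⟫`, which reduces to the orthogonal case. -/
theorem volume_oblique_cylinder {v w : E} (hv : ‖v‖ = 1) (hw : 0 < inner ℝ v w) {A : Set E}
    (hA : A ⊆ ((ℝ ∙ v)ᗮ : Submodule ℝ E)) (I : Set ℝ) :
    volume (image2 (fun a (σ : ℝ) => a + σ • w) A I) ≤
      ENNReal.ofReal (inner ℝ v w) * (μHE[Module.finrank ℝ E - 1] A * volume I) := by
  let f : E →ₗ[ℝ] E := LinearMap.transvection (innerₗ E v) (w - v)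
  have hdet : f.det = inner ℝ v w := by
    simp [f, LinearMap.transvection.det, inner_sub_right, hv]
  have himg : image2 (fun a (σ : ℝ) => a + σ • w) A I =
      f '' image2 (fun a (σ : ℝ) => a + σ • v) A I := by
    rw [image_image2]
    refine image2_congr fun a ha σ _ => ?_
    have h0 : inner ℝ v a = 0 := Submodule.mem_orthogonal_singleton_iff_inner_right.1 (hA ha)
    simp only [f, LinearMap.transvection.apply, innerₗ_apply_apply, inner_add_right,
      inner_smul_right, h0, real_inner_self_eq_norm_sq, hv]
    simp only [smul_sub]
    module
  rw [himg, Measure.addHaar_image_linearMap, hdet, abs_of_pos hw]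
  gcongr
  exact volume_orthogonal_cylinder hv hA I

end Anisotropic
end


/-! ### Volumes of one-sided tubes over pieces of a convex boundary. -/

noncomputable section

namespace Anisotropic

variable {E : Type*} [NormedAddCommGroup E] [InnerProductSpace ℝ E] [FiniteDimensional ℝ E]
  [MeasurableSpace E] [BorelSpace E]

theorem _root_.LipschitzOnWith.euclideanHausdorffMeasure_image_le {X Y : Type*} [MetricSpace X]
    [MeasurableSpace X] [BorelSpace X] [MetricSpace Y] [MeasurableSpace Y] [BorelSpace Y]
    {f : X → Y} {K : ℝ≥0} {s : Set X} (h : LipschitzOnWith K f s) (d : ℕ) :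
    μHE[d] (f '' s) ≤ (K : ℝ≥0∞) ^ d * μHE[d] s := by
  simp only [Measure.euclideanHausdorffMeasure_def, Measure.smul_apply, ENNReal.smul_def,
    smul_eq_mul]
  have := h.hausdorffMeasure_image_le (d := d) (by positivity)
  rw [ENNReal.rpow_natCast] at this
  calc _ ≤ _ := mul_le_mul_right this _
    _ = _ := by ring

/-- Projecting `B` along `w` onto the hyperplane orthogonal to `v` is almost 1-Lipschitz because `B`
is almost flat. Since `B` lies in a slab, the tube sits in an oblique cylinder over the projection,
of height only slightly more than `t`. -/
theorem volume_tube_le_of_flat {v w : E} {k ε h c t : ℝ} (hv : ‖v‖ = 1) (hk : 0 < k)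
    (hw : k ≤ inner ℝ v w) (hε : 0 ≤ ε) (hh : 0 ≤ h) {B : Set E}
    (hflat : ∀ y ∈ B, ∀ y' ∈ B, |inner ℝ v (y - y')| ≤ ε * ‖y - y'‖)
    (hslab : ∀ y ∈ B, |inner ℝ v y - c| ≤ h) :
    volume (image2 (fun y (τ : ℝ) => y - τ • w) B (Icc 0 t)) ≤
      ENNReal.ofReal (inner ℝ v w) *
        (ENNReal.ofReal ((1 + ε * ‖w‖ / k) ^ (Module.finrank ℝ E - 1) * (t + 2 * h / k)) *
          μHE[Module.finrank ℝ E - 1] B) := by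
  set κ : ℝ := inner ℝ v w with hκ
  have hκ0 : 0 < κ := hk.trans_le hw
  let q : E → E := fun y => y - (inner ℝ v y / κ) • w
  have hL : LipschitzOnWith (Real.toNNReal (1 + ε * ‖w‖ / k)) q B := by
    refine LipschitzOnWith.of_dist_le_mul fun y hy y' hy' => ?_
    rw [dist_eq_norm, dist_eq_norm, Real.coe_toNNReal _ (by positivity)]
    have h1 : q y - q y' = (y - y') - (inner ℝ v (y - y') / κ) • w := by
      simp only [q, inner_sub_right, sub_div]; module
    rw [h1]
    refine (norm_sub_le _ _).trans ?_
    rw [norm_smul, Real.norm_eq_abs, abs_div, abs_of_pos hκ0]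
    have h2 : |inner ℝ v (y - y')| / κ ≤ ε * ‖y - y'‖ / k := by
      gcongr
      exact hflat y hy y' hy'
    calc _ ≤ ‖y - y'‖ + ε * ‖y - y'‖ / k * ‖w‖ := by gcongr
      _ = _ := by ring
  have hq : q '' B ⊆ ((ℝ ∙ v)ᗮ : Submodule ℝ E) := by
    rintro _ ⟨y, -, rfl⟩
    rw [SetLike.mem_coe, Submodule.mem_orthogonal_singleton_iff_inner_right]
    simp only [q, inner_sub_right, inner_smul_right, ← hκ]
    field_simp
    ring
  have hsub : image2 (fun y (τ : ℝ) => y - τ • w) B (Icc 0 t) ⊆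
      image2 (fun a (σ : ℝ) => a + σ • w) (q '' B) (Icc ((c - h) / κ - t) ((c + h) / κ)) := by
    rintro _ ⟨y, hy, τ, hτ, rfl⟩
    refine ⟨q y, mem_image_of_mem q hy, inner ℝ v y / κ - τ, ⟨?_, ?_⟩, ?_⟩
    · have := (abs_le.1 (hslab y hy)).1
      have : (c - h) / κ ≤ inner ℝ v y / κ := by gcongr; linarith
      linarith [hτ.2]
    · have := (abs_le.1 (hslab y hy)).2
      have : inner ℝ v y / κ ≤ (c + h) / κ := by gcongr; linarith
      linarith [hτ.1]
    · simp only [q]; module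
  refine (measure_mono hsub).trans ((volume_oblique_cylinder hv hκ0 hq _).trans ?_)
  refine mul_le_mul_right ?_ _
  have h1 : (c + h) / κ - ((c - h) / κ - t) = t + 2 * h / κ := by ring
  have h2 : μHE[Module.finrank ℝ E - 1] (q '' B) ≤ _ := hL.euclideanHausdorffMeasure_image_le _
  rw [Real.volume_Icc, h1, ENNReal.ofReal_mul (by positivity), ENNReal.ofReal_pow (by positivity)]
  calc _ ≤ _ := mul_le_mul' h2 (ENNReal.ofReal_le_ofReal (q := t + 2 * h / k) (by gcongr))
    _ = _ := by simp only [ENNReal.ofReal]; ring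

/-- `B` is cut into countably many small pieces on which the normal `N` is almost constant. The
supporting half-space inequalities make each piece almost flat, so `volume_tube_le_of_flat` applies;
the errors vanish as the pieces shrink. -/
theorem volume_tube_le {w : E} {k t : ℝ} (hk : 0 < k) (ht : 0 < t) {B : Set E}
    (hB : MeasurableSet B) {N : E → E} (hN : Measurable N) (hN1 : ∀ y ∈ B, ‖N y‖ = 1)
    (hsupp : ∀ y ∈ B, ∀ y' ∈ B, inner ℝ (N y) (y' - y) ≤ 0)
    (hw : ∀ y ∈ B, k ≤ inner ℝ (N y) w) :
    volume (image2 (fun y (τ : ℝ) => y - τ • w) B (Icc 0 t)) ≤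
      ENNReal.ofReal t *
        ∫⁻ y in B, ENNReal.ofReal (inner ℝ (N y) w) ∂μHE[Module.finrank ℝ E - 1] := by
  set m := Module.finrank ℝ E - 1
  set J := ∫⁻ y in B, ENNReal.ofReal (inner ℝ (N y) w) ∂μHE[m]
  have key : ∀ ε > 0, volume (image2 (fun y (τ : ℝ) => y - τ • w) B (Icc 0 t)) ≤
      ENNReal.ofReal ((1 + ε * ‖w‖ / k) ^ (m + 1) * (t + 2 * ε / k)) * J := by
    intro ε hε
    -- Partition of the pairs (point, normal) into sets of diameter at most `ε`, so that position
    -- and normal are controlled together.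
    let D : ℕ → Set (E × E) :=
      disjointed fun l => Metric.ball (TopologicalSpace.denseSeq (E × E) l) (ε / 2)
    let P : ℕ → Set E := fun l => B ∩ (fun y => (y, N y)) ⁻¹' D l
    have hDm : ∀ l, MeasurableSet (D l) :=
      fun l => MeasurableSet.disjointed (fun _ => Metric.isOpen_ball.measurableSet) l
    have hPm : ∀ l, MeasurableSet (P l) :=
      fun l => hB.inter ((measurable_id.prodMk hN) (hDm l))
    have hPd : Pairwise (Function.onFun Disjoint P) := fun i j hij =>
      ((disjoint_disjointed _ hij).preimage _).mono inter_subset_right inter_subset_right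
    have hPU : ⋃ l, P l = B := by
      rw [← inter_iUnion, ← preimage_iUnion, iUnion_disjointed]
      refine inter_eq_left.2 fun y _ => ?_
      obtain ⟨l, hl⟩ := (TopologicalSpace.denseRange_denseSeq (E × E)).exists_dist_lt
        (y, N y) (half_pos hε)
      exact mem_iUnion.2 ⟨l, hl⟩
    have hdist : ∀ l, ∀ y ∈ P l, ∀ y' ∈ P l, ‖y - y'‖ ≤ ε ∧ ‖N y - N y'‖ ≤ ε := by
      intro l y hy y' hy'
      have h1 := disjointed_subset _ l (mem_preimage.1 hy.2)
      have h2 := disjointed_subset _ l (mem_preimage.1 hy'.2)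
      have : dist (y, N y) (y', N y') ≤ ε := by
        refine (dist_triangle_right _ _ (TopologicalSpace.denseSeq (E × E) l)).trans ?_
        rw [Metric.mem_ball] at h1 h2
        linarith
      rw [Prod.dist_eq, max_le_iff, dist_eq_norm, dist_eq_norm] at this
      exact this
    have hpiece : ∀ l, volume (image2 (fun y (τ : ℝ) => y - τ • w) (P l) (Icc 0 t)) ≤
        ENNReal.ofReal ((1 + ε * ‖w‖ / k) ^ (m + 1) * (t + 2 * ε / k)) *
          ∫⁻ y in P l, ENNReal.ofReal (inner ℝ (N y) w) ∂μHE[m] := by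
      intro l
      rcases (P l).eq_empty_or_nonempty with he | ⟨y₀, hy₀⟩
      · simp [he]
      have hv := hN1 y₀ hy₀.1
      have hflat : ∀ y ∈ P l, ∀ y' ∈ P l, |inner ℝ (N y₀) (y - y')| ≤ ε * ‖y - y'‖ := by
        -- The support inequality at `y'`, with `N y'` replaced by `N y₀` at a cost of `ε ‖y - y'‖`.
        -- Exchanging `y` and `y'` then gives flatness.
        have aux : ∀ y ∈ P l, ∀ y' ∈ P l, inner ℝ (N y₀) (y - y') ≤ ε * ‖y - y'‖ := by
          intro y hy y' hy'
          have h1 := hsupp y' hy'.1 y hy.1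
          have h2 : inner ℝ (N y₀ - N y') (y - y') ≤ ε * ‖y - y'‖ :=
            (real_inner_le_norm _ _).trans (by gcongr; exact (hdist l y₀ hy₀ y' hy').2)
          rw [inner_sub_left] at h2
          linarith
        intro y hy y' hy'
        refine abs_le.2 ⟨?_, aux y hy y' hy'⟩
        have := aux y' hy' y hy
        rw [← neg_sub y y', inner_neg_right, norm_neg] at this
        linarith
      have hslab : ∀ y ∈ P l, |inner ℝ (N y₀) y - inner ℝ (N y₀) y₀| ≤ ε := by
        intro y hy
        rw [← inner_sub_right]
        refine (abs_real_inner_le_norm _ _).trans ?_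
        rw [hv, one_mul]
        exact (hdist l y hy y₀ hy₀).1
      refine (volume_tube_le_of_flat hv hk (hw y₀ hy₀.1) hε.le hε.le hflat hslab).trans ?_
      -- Unfreezing the normal costs one more factor `1 + ε‖w‖/k`, hence the exponent `m + 1`.
      have h1 : ENNReal.ofReal (inner ℝ (N y₀) w) * μHE[m] (P l) ≤
          ENNReal.ofReal (1 + ε * ‖w‖ / k) *
            ∫⁻ y in P l, ENNReal.ofReal (inner ℝ (N y) w) ∂μHE[m] := by
        rw [← setLIntegral_const, ← lintegral_const_mul _ (by fun_prop)]
        refine setLIntegral_mono (by fun_prop) fun y hy => ?_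
        rw [← ENNReal.ofReal_mul (by positivity)]
        refine ENNReal.ofReal_le_ofReal ?_
        have h2 : inner ℝ (N y₀ - N y) w ≤ ε * ‖w‖ :=
          (real_inner_le_norm _ _).trans (by gcongr; exact (hdist l y₀ hy₀ y hy).2)
        rw [inner_sub_left] at h2
        have h3 : ε * ‖w‖ ≤ ε * ‖w‖ / k * inner ℝ (N y) w := by
          rw [div_mul_eq_mul_div, le_div_iff₀ hk]
          gcongr
          exact hw y hy.1
        linarith
      calc _ = ENNReal.ofReal ((1 + ε * ‖w‖ / k) ^ m * (t + 2 * ε / k)) *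
            (ENNReal.ofReal (inner ℝ (N y₀) w) * μHE[m] (P l)) := by ring
        _ ≤ ENNReal.ofReal ((1 + ε * ‖w‖ / k) ^ m * (t + 2 * ε / k)) * _ := mul_le_mul_right h1 _
        _ = _ := by
          rw [← mul_assoc, ← ENNReal.ofReal_mul (by positivity)]
          congr 2
          ring
    calc _ = volume (⋃ l, image2 (fun y (τ : ℝ) => y - τ • w) (P l) (Icc 0 t)) := by
          rw [← image2_iUnion_left, hPU]
      _ ≤ ∑' l, volume (image2 (fun y (τ : ℝ) => y - τ • w) (P l) (Icc 0 t)) :=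
          measure_iUnion_le _
      _ ≤ ∑' l, ENNReal.ofReal ((1 + ε * ‖w‖ / k) ^ (m + 1) * (t + 2 * ε / k)) *
          ∫⁻ y in P l, ENNReal.ofReal (inner ℝ (N y) w) ∂μHE[m] := ENNReal.tsum_le_tsum hpiece
      _ = _ := by
          rw [ENNReal.tsum_mul_left, ← lintegral_iUnion hPm hPd, hPU]
  have hcont : Tendsto (fun ε : ℝ =>
      ENNReal.ofReal ((1 + ε * ‖w‖ / k) ^ (m + 1) * (t + 2 * ε / k)) * J)
      (𝓝[>] 0) (𝓝 (ENNReal.ofReal t * J)) := by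
    -- `J` may be infinite; multiplication by it is still continuous at the limit because `t` is not
    -- zero.
    refine ENNReal.Tendsto.mul_const ?_ (Or.inl (by simpa using ht))
    refine ENNReal.tendsto_ofReal ?_
    have : Continuous fun ε : ℝ => (1 + ε * ‖w‖ / k) ^ (m + 1) * (t + 2 * ε / k) := by fun_prop
    have := this.tendsto 0
    simp only [zero_mul, zero_div, add_zero, one_pow, one_mul, mul_zero] at this
    exact this.mono_left nhdsWithin_le_nhds
  exact ge_of_tendsto hcont (by filter_upwards [self_mem_nhdsWithin] with ε hε using key ε hε)

end Anisotropic
end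


/-! ### Normals of convex sets and measurability of the normal field. -/

noncomputable section

namespace Anisotropic

variable {n : ℕ} {Ω : Set (EuclideanSpace ℝ (Fin n))}

theorem exists_unit_normal_of_notMem (hΩo : IsOpen Ω) (hΩc : Convex ℝ Ω) (hΩne : Ω.Nonempty)
    {z : EuclideanSpace ℝ (Fin n)} (hz : z ∉ Ω) :
    ∃ v : EuclideanSpace ℝ (Fin n), ‖v‖ = 1 ∧ ∀ a ∈ Ω, inner ℝ (a - z) v < 0 := by
  obtain ⟨f, hf⟩ := geometric_hahn_banach_open_point hΩc hΩo hz
  set u := (InnerProductSpace.toDual ℝ _).symm f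
  have hu : ∀ x, inner ℝ u x = f x := fun x => InnerProductSpace.toDual_symm_apply
  have hu0 : u ≠ 0 := by
    intro h
    obtain ⟨a, ha⟩ := hΩne
    have := hf a ha
    rw [← hu, ← hu, h] at this
    simp at this
  have hn : 0 < ‖u‖ := norm_pos_iff.2 hu0
  refine ⟨‖u‖⁻¹ • u, by rw [norm_smul, norm_inv, norm_norm, inv_mul_cancel₀ hn.ne'], ?_⟩
  intro a ha
  rw [inner_smul_right, real_inner_comm, inner_sub_right, hu, hu]
  exact mul_neg_of_pos_of_neg (inv_pos.2 hn) (sub_neg.2 (hf a ha))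

/-- The unit vectors of the normal cone to `Ω` at `y`. -/
def unitNormals (Ω : Set (EuclideanSpace ℝ (Fin n))) (y : EuclideanSpace ℝ (Fin n)) :
    Set (EuclideanSpace ℝ (Fin n)) :=
  {v | ‖v‖ = 1 ∧ ∀ z ∈ Ω, inner ℝ (z - y) v ≤ 0}

theorem inner_sub_nonpos_of_mem_closure {y v z : EuclideanSpace ℝ (Fin n)}
    (hv : v ∈ unitNormals Ω y) (hz : z ∈ closure Ω) : inner ℝ (z - y) v ≤ 0 := by
  have hcl : IsClosed {z : EuclideanSpace ℝ (Fin n) | inner ℝ (z - y) v ≤ 0} :=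
    isClosed_le (by fun_prop) continuous_const
  exact closure_minimal hv.2 hcl hz

/-- By convexity the segment from `y` to `z` stays in `Ω`. The first-order inequality at its points
near `y`, divided by the scale `s`, gives the global one up to an arbitrary `η`. -/
theorem IsOuterNormal.mem_unitNormals (hΩo : IsOpen Ω) (hΩc : Convex ℝ Ω)
    {y v : EuclideanSpace ℝ (Fin n)} (hy : y ∈ closure Ω) (h : IsOuterNormal Ω y v) :
    v ∈ unitNormals Ω y := by
  refine ⟨h.1, fun z hz => le_of_forall_pos_le_add fun η hη => ?_⟩
  rw [zero_add]
  set r := ‖z - y‖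
  obtain ⟨δ, hδ, hd⟩ := h.2 (η / (r + 1)) (by positivity)
  set s := min 1 (δ / (2 * (r + 1)))
  have hs0 : 0 < s := by positivity
  have hmem : y + s • (z - y) ∈ Ω := by
    have := hΩc.add_smul_sub_mem_interior' hy (by rwa [hΩo.interior_eq])
      (t := s) ⟨hs0, min_le_left _ _⟩
    rwa [hΩo.interior_eq] at this
  have hnorm : ‖y + s • (z - y) - y‖ = s * r := by
    rw [add_sub_cancel_left, norm_smul, Real.norm_of_nonneg hs0.le]
  have hlt : s * r < δ := by
    calc s * r ≤ δ / (2 * (r + 1)) * r := by gcongr; exact min_le_right _ _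
      _ < δ := by
        rw [div_mul_eq_mul_div, div_lt_iff₀ (by positivity)]
        nlinarith [norm_nonneg (z - y)]
  have := (hd _ (by rwa [hnorm])).1 hmem
  rw [hnorm, add_sub_cancel_left, real_inner_smul_left] at this
  have h2 : inner ℝ (z - y) v ≤ η / (r + 1) * r := by
    refine le_of_mul_le_mul_left ?_ hs0
    linarith
  refine h2.trans ?_
  rw [div_mul_eq_mul_div, div_le_iff₀ (by positivity)]
  nlinarith [norm_nonneg (z - y)]

/-- If `v' ≠ v`, a small step from `y` along `v' - v` has negative product with `v`, which forces it
into `Ω`, and positive product with `v'`, which excludes it. -/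
theorem IsOuterNormal.eq_of_mem_unitNormals {y v v' : EuclideanSpace ℝ (Fin n)}
    (h : IsOuterNormal Ω y v) (hv' : v' ∈ unitNormals Ω y) : v' = v := by
  by_contra hne
  have hlt : inner ℝ v' v < 1 := (inner_lt_one_iff_real_of_norm_eq_one hv'.1 h.1).2 hne
  have hd : 0 < ‖v' - v‖ := norm_pos_iff.2 (sub_ne_zero.2 hne)
  set c : ℝ := 1 - inner ℝ v' v with hc
  have hc0 : 0 < c := by linarith
  have h1 : inner ℝ (v' - v) v = -c := by
    rw [inner_sub_left, real_inner_self_eq_norm_sq, h.1, hc]; ring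
  have h2 : inner ℝ (v' - v) v' = c := by
    rw [inner_sub_left, real_inner_self_eq_norm_sq, hv'.1, real_inner_comm, hc]; ring
  obtain ⟨δ, hδ, hd'⟩ := h.2 (c / (2 * ‖v' - v‖)) (by positivity)
  set s : ℝ := δ / (2 * ‖v' - v‖) with hs
  have hs0 : 0 < s := by positivity
  have hnorm : ‖y + s • (v' - v) - y‖ = s * ‖v' - v‖ := by
    rw [add_sub_cancel_left, norm_smul, Real.norm_of_nonneg hs0.le]
  have hsd : s * ‖v' - v‖ = δ / 2 := by rw [hs]; field_simp
  have hmul : c / (2 * ‖v' - v‖) * (s * ‖v' - v‖) = s * (c / 2) := by field_simp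
  have hpos : 0 < s * c := mul_pos hs0 hc0
  have hmem : y + s • (v' - v) ∈ Ω := by
    by_contra hK
    have := (hd' _ (by rw [hnorm, hsd]; linarith)).2 hK
    rw [hnorm, hmul, add_sub_cancel_left, real_inner_smul_left, h1] at this
    linarith
  have := hv'.2 _ hmem
  rw [add_sub_cancel_left, real_inner_smul_left, h2] at this
  linarith

/-- Compactness. If the expansion fails, there are `z k ∉ Ω` tending to `y` whose directions from
`y` have product at most `-ε` with `v`. Normals `w k` separating `z k` from `Ω` have nonnegative
product with these directions and accumulate at a unit normal at `y`, which must be `v`. -/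
theorem isOuterNormal_of_unitNormals_subsingleton (hΩo : IsOpen Ω) (hΩc : Convex ℝ Ω)
    (hΩne : Ω.Nonempty) {y v : EuclideanSpace ℝ (Fin n)} (hy : y ∈ closure Ω)
    (hv : v ∈ unitNormals Ω y) (hs : (unitNormals Ω y).Subsingleton) : IsOuterNormal Ω y v := by
  refine ⟨hv.1, fun ε hε => ?_⟩
  by_contra! hcon
  have hbad : ∀ k : ℕ, ∃ z ∉ Ω, ‖z - y‖ < 1 / ((k : ℝ) + 1) ∧
      inner ℝ (z - y) v < -(ε * ‖z - y‖) := by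
    intro k
    obtain ⟨z, hz1, hz2⟩ := hcon (1 / ((k : ℝ) + 1)) (by positivity)
    by_cases hz : z ∈ Ω
    · have h1 := hv.2 z hz
      have h3 : inner ℝ (z - y) v ≤ ε * ‖z - y‖ := h1.trans (by positivity)
      exact absurd hz (hz2 fun _ => h3).1
    · exact ⟨z, hz, hz1, (hz2 fun h => absurd h hz).2⟩
  choose z hzΩ hzn hzv using hbad
  have hz0 : ∀ k, 0 < ‖z k - y‖ := by
    intro k
    refine norm_pos_iff.2 fun h0 => ?_
    have := hzv k
    rw [h0] at this
    simp at this
  choose w hw1 hw2 using fun k => exists_unit_normal_of_notMem hΩo hΩc hΩne (hzΩ k)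
  have hcl : ∀ k, 0 ≤ inner ℝ (z k - y) (w k) := by
    intro k
    have hc : IsClosed {a : EuclideanSpace ℝ (Fin n) | inner ℝ (a - z k) (w k) ≤ 0} :=
      isClosed_le (by fun_prop) continuous_const
    have : inner ℝ (y - z k) (w k) ≤ 0 := closure_minimal (fun a ha => (hw2 k a ha).le) hc hy
    rw [← neg_sub, inner_neg_left]
    linarith
  let u : ℕ → EuclideanSpace ℝ (Fin n) := fun k => ‖z k - y‖⁻¹ • (z k - y)
  have hu : ∀ k, u k ∈ Metric.sphere (0 : EuclideanSpace ℝ (Fin n)) 1 := by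
    intro k
    rw [mem_sphere_zero_iff_norm, norm_smul, norm_inv, norm_norm, inv_mul_cancel₀ (hz0 k).ne']
  have hcomp : IsCompact (Metric.sphere (0 : EuclideanSpace ℝ (Fin n)) 1 ×ˢ
      Metric.sphere (0 : EuclideanSpace ℝ (Fin n)) 1) :=
    (isCompact_sphere _ _).prod (isCompact_sphere _ _)
  obtain ⟨⟨w', u'⟩, hwu, σ, hσ, hlim⟩ := hcomp.tendsto_subseq (x := fun k => (w k, u k))
    fun k => ⟨mem_sphere_zero_iff_norm.2 (hw1 k), hu k⟩
  have hwl : Tendsto (w ∘ σ) atTop (𝓝 w') := (Prod.tendsto_iff _ _).1 hlim |>.1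
  have hul : Tendsto (u ∘ σ) atTop (𝓝 u') := (Prod.tendsto_iff _ _).1 hlim |>.2
  have hzl : Tendsto (fun k => z (σ k)) atTop (𝓝 y) := by
    rw [tendsto_iff_norm_sub_tendsto_zero]
    exact squeeze_zero (fun _ => norm_nonneg _) (fun k => (hzn (σ k)).le)
      (tendsto_one_div_add_atTop_nhds_zero_nat.comp hσ.tendsto_atTop)
  have hw'mem : w' ∈ unitNormals Ω y := by
    refine ⟨mem_sphere_zero_iff_norm.1 hwu.1, fun a ha => ?_⟩
    have : Tendsto (fun k => inner ℝ (a - z (σ k)) (w (σ k))) atTop (𝓝 (inner ℝ (a - y) w')) :=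
      (tendsto_const_nhds.sub hzl).inner hwl
    exact le_of_tendsto' this fun k => (hw2 _ a ha).le
  have hw'v : w' = v := hs hw'mem hv
  have h1 : 0 ≤ inner ℝ u' w' := by
    refine ge_of_tendsto' (hul.inner hwl) fun k => ?_
    simp only [Function.comp, u, real_inner_smul_left]
    exact mul_nonneg (by positivity) (hcl _)
  have h2 : inner ℝ u' v ≤ -ε := by
    refine le_of_tendsto' (hul.inner tendsto_const_nhds) fun k => ?_
    simp only [Function.comp, u, real_inner_smul_left]
    rw [inv_mul_le_iff₀ (hz0 _)]
    linarith [hzv (σ k)]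
  rw [hw'v] at h1
  linarith

theorem outerNormal_eq {K : Set (EuclideanSpace ℝ (Fin n))} {x v : EuclideanSpace ℝ (Fin n)}
    (h : IsOuterNormal K x v) : outerNormal K x = v := by
  have hex : ∃ v, IsOuterNormal K x v := ⟨v, h⟩
  rw [outerNormal, dif_pos hex]
  exact hex.choose_spec.unique h

/-- The boundary points at which the outer unit normal exists. -/
def regularBoundary (Ω : Set (EuclideanSpace ℝ (Fin n))) : Set (EuclideanSpace ℝ (Fin n)) :=
  {y ∈ frontier Ω | ∃ v, IsOuterNormal Ω y v}

theorem isOuterNormal_outerNormal {y : EuclideanSpace ℝ (Fin n)} (hy : y ∈ regularBoundary Ω) :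
    IsOuterNormal Ω y (outerNormal Ω y) := by
  obtain ⟨v, hv⟩ := hy.2
  rwa [outerNormal_eq hv]

theorem isClosed_graph_unitNormals :
    IsClosed {q : EuclideanSpace ℝ (Fin n) × EuclideanSpace ℝ (Fin n) | q.2 ∈ unitNormals Ω q.1} := by
  have : {q : EuclideanSpace ℝ (Fin n) × EuclideanSpace ℝ (Fin n) | q.2 ∈ unitNormals Ω q.1} =
      {q | ‖q.2‖ = 1} ∩ ⋂ z ∈ Ω, {q | inner ℝ (z - q.1) q.2 ≤ 0} := by
    ext q; simp [unitNormals]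
  rw [this]
  refine (isClosed_eq (by fun_prop) continuous_const).inter ?_
  exact isClosed_biInter fun z _ => isClosed_le (by fun_prop) continuous_const

theorem isCompact_frontier_of_isBounded (hΩb : Bornology.IsBounded Ω) : IsCompact (frontier Ω) :=
  Metric.isCompact_of_isClosed_isBounded isClosed_frontier
    (hΩb.closure.subset frontier_subset_closure)

/-- The set is the projection of a compact part of the closed graph of the normal cone. On the
regular boundary it is the preimage of `V` under the normal field. -/
theorem isClosed_frontier_with_normal_mem (hΩb : Bornology.IsBounded Ω)
    {V : Set (EuclideanSpace ℝ (Fin n))} (hV : IsClosed V) :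
    IsClosed {y ∈ frontier Ω | ∃ v ∈ V, v ∈ unitNormals Ω y} := by
  have hc : IsCompact ((frontier Ω ×ˢ Metric.sphere (0 : EuclideanSpace ℝ (Fin n)) 1) ∩
      ({q | q.2 ∈ unitNormals Ω q.1} ∩ Prod.snd ⁻¹' V)) :=
    ((isCompact_frontier_of_isBounded hΩb).prod (isCompact_sphere _ _)).inter_right
      (isClosed_graph_unitNormals.inter (hV.preimage continuous_snd))
  convert (hc.image continuous_fst).isClosed using 1
  ext y
  constructor
  · rintro ⟨hy, v, hvV, hv⟩
    exact ⟨(y, v), ⟨⟨hy, mem_sphere_zero_iff_norm.2 hv.1⟩, hv, hvV⟩, rfl⟩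
  · rintro ⟨⟨y, v⟩, ⟨⟨hy, -⟩, hv, hvV⟩, rfl⟩
    exact ⟨hy, v, hvV, hv⟩

theorem isClosed_frontier_with_distant_normals (hΩb : Bornology.IsBounded Ω) (c : ℝ) :
    IsClosed {y ∈ frontier Ω | ∃ v ∈ unitNormals Ω y, ∃ w ∈ unitNormals Ω y, c ≤ ‖v - w‖} := by
  let G : Set (EuclideanSpace ℝ (Fin n) × EuclideanSpace ℝ (Fin n) × EuclideanSpace ℝ (Fin n)) :=
    (fun q => (q.1, q.2.1)) ⁻¹' {q | q.2 ∈ unitNormals Ω q.1} ∩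
      ((fun q => (q.1, q.2.2)) ⁻¹' {q | q.2 ∈ unitNormals Ω q.1} ∩ {q | c ≤ ‖q.2.1 - q.2.2‖})
  have hG : IsClosed G :=
    (isClosed_graph_unitNormals.preimage (by fun_prop)).inter
      ((isClosed_graph_unitNormals.preimage (by fun_prop)).inter
        (isClosed_le continuous_const (by fun_prop)))
  have hc : IsCompact ((frontier Ω ×ˢ Metric.sphere (0 : EuclideanSpace ℝ (Fin n)) 1 ×ˢ
      Metric.sphere (0 : EuclideanSpace ℝ (Fin n)) 1) ∩ G) :=
    ((isCompact_frontier_of_isBounded hΩb).prod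
      ((isCompact_sphere _ _).prod (isCompact_sphere _ _))).inter_right hG
  convert (hc.image continuous_fst).isClosed using 1
  ext y
  constructor
  · rintro ⟨hy, v, hv, w, hw, hvw⟩
    exact ⟨(y, v, w), ⟨⟨hy, mem_sphere_zero_iff_norm.2 hv.1, mem_sphere_zero_iff_norm.2 hw.1⟩,
      hv, hw, hvw⟩, rfl⟩
  · rintro ⟨⟨y, v, w⟩, ⟨⟨hy, -⟩, hv, hw, hvw⟩, rfl⟩
    exact ⟨hy, v, hv, w, hw, hvw⟩

theorem exists_mem_unitNormals (hΩo : IsOpen Ω) (hΩc : Convex ℝ Ω) (hΩne : Ω.Nonempty)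
    {y : EuclideanSpace ℝ (Fin n)} (hy : y ∈ frontier Ω) : ∃ v, v ∈ unitNormals Ω y := by
  have : y ∉ Ω := fun h => by
    rw [hΩo.frontier_eq] at hy
    exact hy.2 h
  obtain ⟨v, hv, hv'⟩ := exists_unit_normal_of_notMem hΩo hΩc hΩne this
  exact ⟨v, hv, fun a ha => (hv' a ha).le⟩

/-- The outer normal exists exactly where the unit normal is unique. The other boundary points have
two normals at distance at least `1/(k+1)` for some `k`, a closed condition. -/
theorem measurableSet_regularBoundary (hΩo : IsOpen Ω) (hΩc : Convex ℝ Ω) (hΩne : Ω.Nonempty)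
    (hΩb : Bornology.IsBounded Ω) : MeasurableSet (regularBoundary Ω) := by
  have h : regularBoundary Ω = frontier Ω \ ⋃ k : ℕ, {y ∈ frontier Ω |
      ∃ v ∈ unitNormals Ω y, ∃ w ∈ unitNormals Ω y, 1 / ((k : ℝ) + 1) ≤ ‖v - w‖} := by
    ext y
    constructor
    · rintro ⟨hy, v, hv⟩
      refine ⟨hy, fun hcon => ?_⟩
      obtain ⟨k, -, u, hu, w, hw, huw⟩ := mem_iUnion.1 hcon
      rw [hv.eq_of_mem_unitNormals hu, hv.eq_of_mem_unitNormals hw, sub_self, norm_zero] at huw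
      exact absurd huw (not_le.2 (by positivity))
    · rintro ⟨hy, hcon⟩
      obtain ⟨v, hv⟩ := exists_mem_unitNormals hΩo hΩc hΩne hy
      refine ⟨hy, v, isOuterNormal_of_unitNormals_subsingleton hΩo hΩc hΩne
        (frontier_subset_closure hy) hv fun u hu w hw => ?_⟩
      by_contra hne
      obtain ⟨k, hk⟩ := exists_nat_one_div_lt (norm_pos_iff.2 (sub_ne_zero.2 hne))
      exact hcon (mem_iUnion.2 ⟨k, hy, u, hu, w, hw, hk.le⟩)
  rw [h]
  exact isClosed_frontier.measurableSet.diff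
    (MeasurableSet.iUnion fun k => (isClosed_frontier_with_distant_normals hΩb _).measurableSet)

theorem measurable_indicator_outerNormal (hΩo : IsOpen Ω) (hΩc : Convex ℝ Ω) (hΩne : Ω.Nonempty)
    (hΩb : Bornology.IsBounded Ω) :
    Measurable ((regularBoundary Ω).indicator (outerNormal Ω)) := by
  have hR := measurableSet_regularBoundary hΩo hΩc hΩne hΩb
  refine measurable_of_isClosed fun V hV => ?_
  have h : (regularBoundary Ω).indicator (outerNormal Ω) ⁻¹' V =
      (regularBoundary Ω ∩ {y ∈ frontier Ω | ∃ v ∈ V, v ∈ unitNormals Ω y}) ∪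
        ((regularBoundary Ω)ᶜ ∩ {_y | (0 : EuclideanSpace ℝ (Fin n)) ∈ V}) := by
    ext y
    by_cases hy : y ∈ regularBoundary Ω
    · have hN := isOuterNormal_outerNormal hy
      simp only [mem_preimage, indicator_of_mem hy, mem_union, mem_inter_iff, hy, true_and,
        mem_compl_iff, not_true, false_and, or_false, mem_ofPred_eq, hy.1]
      constructor
      · exact fun h => ⟨_, h, hN.mem_unitNormals hΩo hΩc (frontier_subset_closure hy.1)⟩
      · rintro ⟨v, hvV, hv⟩
        rwa [← hN.eq_of_mem_unitNormals hv]
    · simp [hy]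
  rw [h]
  exact (hR.inter (isClosed_frontier_with_normal_mem hΩb hV).measurableSet).union
    (hR.compl.inter (MeasurableSet.const _))

end Anisotropic
end


/-! ### Exit times from a convex set. -/

noncomputable section

namespace Anisotropic

variable {n : ℕ} {Ω : Set (EuclideanSpace ℝ (Fin n))}

/-- The time at which the ray from `x` in direction `w` leaves the convex set `Ω`; it is `0` for
`x` outside `Ω`. -/
def exitTime (Ω : Set (EuclideanSpace ℝ (Fin n))) (w x : EuclideanSpace ℝ (Fin n)) : ℝ :=
  sSup {t : ℝ | 0 ≤ t ∧ x ∈ Ω ∧ x + t • w ∈ Ω}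

theorem exitTime_nonneg (w x : EuclideanSpace ℝ (Fin n)) : 0 ≤ exitTime Ω w x :=
  Real.sSup_nonneg fun _ ht => ht.1

theorem exitTime_of_notMem (w : EuclideanSpace ℝ (Fin n)) {x : EuclideanSpace ℝ (Fin n)}
    (hx : x ∉ Ω) : exitTime Ω w x = 0 := by
  have : {t : ℝ | 0 ≤ t ∧ x ∈ Ω ∧ x + t • w ∈ Ω} = ∅ := by ext t; simp [hx]
  rw [exitTime, this, Real.sSup_empty]

/-- Convexity makes the set of admissible times an interval starting at `0`, openness of `Ω`
excludes its right end point, and boundedness makes the supremum finite. -/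
theorem lt_exitTime_iff (hΩo : IsOpen Ω) (hΩc : Convex ℝ Ω) (hΩb : Bornology.IsBounded Ω)
    {w x : EuclideanSpace ℝ (Fin n)} (hw : w ≠ 0) {t : ℝ} (ht : 0 ≤ t) :
    t < exitTime Ω w x ↔ x ∈ Ω ∧ x + t • w ∈ Ω := by
  constructor
  · intro h
    have hne : {t : ℝ | 0 ≤ t ∧ x ∈ Ω ∧ x + t • w ∈ Ω}.Nonempty := by
      by_contra hcon
      rw [not_nonempty_iff_eq_empty] at hcon
      rw [exitTime, hcon, Real.sSup_empty] at h
      linarith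
    obtain ⟨s, ⟨hs0, hx, hs⟩, hts⟩ := exists_lt_of_lt_csSup hne h
    refine ⟨hx, ?_⟩
    have hs0' : 0 < s := ht.trans_lt hts
    have := hΩc.add_smul_mem hx hs (t := t / s) ⟨by positivity, by rw [div_le_one hs0']; exact hts.le⟩
    rwa [smul_smul, div_mul_cancel₀ _ hs0'.ne'] at this
  · rintro ⟨hx, hxt⟩
    obtain ⟨R, hR⟩ := hΩb.exists_norm_le
    have hbdd : BddAbove {t : ℝ | 0 ≤ t ∧ x ∈ Ω ∧ x + t • w ∈ Ω} := by
      refine ⟨2 * R / ‖w‖, fun s hs => ?_⟩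
      rw [le_div_iff₀ (norm_pos_iff.2 hw)]
      have h1 : ‖s • w‖ ≤ ‖x + s • w‖ + ‖x‖ := by
        simpa using norm_sub_le (x + s • w) x
      rw [norm_smul, Real.norm_of_nonneg hs.1] at h1
      linarith [hR _ hs.2.2, hR _ hx]
    have hc : Tendsto (fun s : ℝ => x + s • w) (𝓝[>] t) (𝓝 (x + t • w)) := by
      have : Continuous fun s : ℝ => x + s • w := by fun_prop
      exact (this.tendsto t).mono_left nhdsWithin_le_nhds
    obtain ⟨s, hs, hts⟩ := ((hc.eventually (hΩo.mem_nhds hxt)).and self_mem_nhdsWithin).exists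
    exact lt_of_lt_of_le hts (le_csSup hbdd ⟨ht.trans (le_of_lt hts), hx, hs⟩)

theorem exitTime_pos (hΩo : IsOpen Ω) (hΩc : Convex ℝ Ω) (hΩb : Bornology.IsBounded Ω)
    {w x : EuclideanSpace ℝ (Fin n)} (hw : w ≠ 0) (hx : x ∈ Ω) : 0 < exitTime Ω w x :=
  (lt_exitTime_iff hΩo hΩc hΩb hw le_rfl).2 ⟨hx, by simpa⟩

theorem add_exitTime_smul_mem_closure (hΩo : IsOpen Ω) (hΩc : Convex ℝ Ω)
    (hΩb : Bornology.IsBounded Ω) {w x : EuclideanSpace ℝ (Fin n)} (hw : w ≠ 0) (hx : x ∈ Ω) {t : ℝ}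
    (ht0 : 0 ≤ t) (ht : t ≤ exitTime Ω w x) : x + t • w ∈ closure Ω := by
  rcases ht.lt_or_eq with h | h
  · exact subset_closure ((lt_exitTime_iff hΩo hΩc hΩb hw ht0).1 h).2
  · have hpos : 0 < t := h ▸ exitTime_pos hΩo hΩc hΩb hw hx
    have hc : Tendsto (fun s : ℝ => x + s • w) (𝓝[<] t) (𝓝 (x + t • w)) := by
      have : Continuous fun s : ℝ => x + s • w := by fun_prop
      exact (this.tendsto t).mono_left nhdsWithin_le_nhds
    refine mem_closure_of_tendsto hc ?_
    filter_upwards [Ioo_mem_nhdsLT hpos] with s hs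
    exact ((lt_exitTime_iff hΩo hΩc hΩb hw hs.1.le).1 (hs.2.trans_le h.le)).2

theorem le_exitTime (hΩo : IsOpen Ω) (hΩc : Convex ℝ Ω) (hΩb : Bornology.IsBounded Ω)
    {w x : EuclideanSpace ℝ (Fin n)} (hw : w ≠ 0) (hx : x ∈ Ω) {t : ℝ}
    (h : x + t • w ∈ closure Ω) : t ≤ exitTime Ω w x := by
  rcases le_or_gt t 0 with ht0 | ht0
  · exact ht0.trans (exitTime_nonneg w x)
  refine le_of_forall_lt fun s hs => ?_
  rcases lt_or_ge s 0 with hs0 | hs0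
  · exact hs0.trans_le (exitTime_nonneg w x)
  refine (lt_exitTime_iff hΩo hΩc hΩb hw hs0).2 ⟨hx, ?_⟩
  have := hΩc.add_smul_sub_mem_interior' h (by rwa [hΩo.interior_eq]) (t := (t - s) / t)
    ⟨div_pos (by linarith) ht0, by rw [div_le_one ht0]; linarith⟩
  rw [hΩo.interior_eq] at this
  convert this using 1
  have h1 : x - (x + t • w) = (-t) • w := by module
  have h2 : (t - s) / t * -t = s - t := by field_simp; ring
  rw [h1, smul_smul, h2]
  module

theorem add_exitTime_smul_mem_frontier (hΩo : IsOpen Ω) (hΩc : Convex ℝ Ω)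
    (hΩb : Bornology.IsBounded Ω) {w x : EuclideanSpace ℝ (Fin n)} (hw : w ≠ 0) (hx : x ∈ Ω) :
    x + exitTime Ω w x • w ∈ frontier Ω := by
  rw [hΩo.frontier_eq]
  refine ⟨add_exitTime_smul_mem_closure hΩo hΩc hΩb hw hx (exitTime_nonneg w x) le_rfl, fun h => ?_⟩
  exact lt_irrefl _ ((lt_exitTime_iff hΩo hΩc hΩb hw (exitTime_nonneg w x)).2 ⟨hx, h⟩)

/-- Convex combinations of exit points lie in the closure of `Ω`, and `le_exitTime` accepts times at
which the ray is only in the closure. -/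
theorem concaveOn_exitTime (hΩo : IsOpen Ω) (hΩc : Convex ℝ Ω)
    (hΩb : Bornology.IsBounded Ω) {w : EuclideanSpace ℝ (Fin n)} (hw : w ≠ 0) :
    ConcaveOn ℝ Ω (exitTime Ω w) := by
  refine ⟨hΩc, fun x hx y hy a b ha hb hab => ?_⟩
  refine le_exitTime hΩo hΩc hΩb hw (hΩc hx hy ha hb hab) ?_
  have h1 := add_exitTime_smul_mem_closure hΩo hΩc hΩb hw hx (exitTime_nonneg w x) le_rfl
  have h2 := add_exitTime_smul_mem_closure hΩo hΩc hΩb hw hy (exitTime_nonneg w y) le_rfl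
  convert hΩc.closure h1 h2 ha hb hab using 1
  simp only [smul_eq_mul]
  module

/-- Concave functions are locally Lipschitz, so Rademacher's theorem applies locally. With
`exists_isOuterNormal_exit`, this makes the exit point regular for almost every starting point. -/
theorem ae_differentiableAt_exitTime (hΩo : IsOpen Ω) (hΩc : Convex ℝ Ω)
    (hΩb : Bornology.IsBounded Ω) {w : EuclideanSpace ℝ (Fin n)} (hw : w ≠ 0) :
    volume {x ∈ Ω | ¬ DifferentiableAt ℝ (exitTime Ω w) x} = 0 := by
  refine measure_null_of_locally_null _ fun x hx => ?_
  obtain ⟨K, t, ht, hL⟩ :=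
    (concaveOn_exitTime hΩo hΩc hΩb hw).locallyLipschitzOn hΩo hx.1
  rw [hΩo.nhdsWithin_eq hx.1] at ht
  obtain ⟨U, hUt, hUo, hxU⟩ := mem_nhds_iff.1 ht
  refine ⟨U ∩ {x ∈ Ω | ¬ DifferentiableAt ℝ (exitTime Ω w) x},
    inter_mem (mem_nhdsWithin_of_mem_nhds (hUo.mem_nhds hxU)) self_mem_nhdsWithin, ?_⟩
  have hae := (hL.mono hUt).ae_differentiableWithinAt_of_mem (μ := volume)
  refine measure_mono_null (fun y hy => ?_) (ae_iff.1 hae)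
  exact fun h => hy.2.2 ((h hy.1).differentiableAt (hUo.mem_nhds hy.1))

/-- Near the exit point, `z ∈ Ω` exactly when the exit time from `z - τ w` exceeds `τ`. So `Ω` is
locally a superlevel set of a function differentiable at `x`, and the normal is minus its normalized
gradient. -/
theorem exists_isOuterNormal_exit (hΩo : IsOpen Ω) (hΩc : Convex ℝ Ω)
    (hΩb : Bornology.IsBounded Ω) {w x : EuclideanSpace ℝ (Fin n)} (hw : w ≠ 0) (hx : x ∈ Ω)
    (hd : DifferentiableAt ℝ (exitTime Ω w) x) :
    ∃ v, IsOuterNormal Ω (x + exitTime Ω w x • w) v := by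
  set τ := exitTime Ω w x
  have hτ : 0 < τ := exitTime_pos hΩo hΩc hΩb hw hx
  set f := fderiv ℝ (exitTime Ω w) x
  set g := (InnerProductSpace.toDual ℝ (EuclideanSpace ℝ (Fin n))).symm f
  have hg : ∀ z, inner ℝ g z = f z := fun z => InnerProductSpace.toDual_symm_apply
  have hlo : ∀ ε > 0, ∃ δ > 0, ∀ z, ‖z - x‖ < δ →
      z ∈ Ω ∧ |exitTime Ω w z - τ - f (z - x)| ≤ ε * ‖z - x‖ := by
    intro ε hε
    have h1 := (hasFDerivAt_iff_isLittleO.1 hd.hasFDerivAt).def hε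
    obtain ⟨δ, hδ, h2⟩ := Metric.eventually_nhds_iff.1 (h1.and (hΩo.mem_nhds hx))
    refine ⟨δ, hδ, fun z hz => ?_⟩
    have := h2 (y := z) (by rwa [dist_eq_norm])
    exact ⟨this.2, by simpa [Real.norm_eq_abs] using this.1⟩
  -- Moving by `s w` shortens the exit time by at least `s`, which a vanishing gradient would not
  -- allow.
  have hg0 : g ≠ 0 := by
    intro h0
    have hwn : 0 < ‖w‖ := norm_pos_iff.2 hw
    obtain ⟨δ, hδ, hd'⟩ := hlo (1 / (2 * ‖w‖)) (by positivity)
    set s := min (τ / 2) (δ / (2 * ‖w‖))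
    have hs0 : 0 < s := by positivity
    have hsτ : s < τ := (min_le_left _ _).trans_lt (by linarith)
    have hnorm : ‖x + s • w - x‖ = s * ‖w‖ := by
      rw [add_sub_cancel_left, norm_smul, Real.norm_of_nonneg hs0.le]
    have h1 := hd' (x + s • w) (by
      rw [hnorm]
      calc s * ‖w‖ ≤ δ / (2 * ‖w‖) * ‖w‖ := by gcongr; exact min_le_right _ _
        _ = δ / 2 := by field_simp
        _ < δ := by linarith)
    rw [← hg, h0, inner_zero_left, sub_zero, hnorm] at h1
    have h2 : exitTime Ω w (x + s • w) ≤ τ - s := by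
      by_contra! hcon
      have := ((lt_exitTime_iff hΩo hΩc hΩb hw (by linarith)).1 hcon).2
      have h3 : x + s • w + (τ - s) • w = x + τ • w := by module
      rw [h3] at this
      exact lt_irrefl _ ((lt_exitTime_iff hΩo hΩc hΩb hw hτ.le).2 ⟨hx, this⟩)
    have h4 : 1 / (2 * ‖w‖) * (s * ‖w‖) = s / 2 := by field_simp
    rw [h4] at h1
    linarith [(abs_le.1 h1.2).1]
  have hgn : 0 < ‖g‖ := norm_pos_iff.2 hg0
  refine ⟨-(‖g‖⁻¹ • g), ?_, fun ε hε => ?_⟩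
  · rw [norm_neg, norm_smul, norm_inv, norm_norm, inv_mul_cancel₀ hgn.ne']
  obtain ⟨δ, hδ, hd'⟩ := hlo (ε * ‖g‖) (by positivity)
  refine ⟨δ, hδ, fun z hz => ?_⟩
  have hzx : z - τ • w - x = z - (x + τ • w) := by abel
  have h1 := hd' (z - τ • w) (by rwa [hzx])
  rw [hzx] at h1
  have hin : inner ℝ (z - (x + τ • w)) (-(‖g‖⁻¹ • g)) = -(f (z - (x + τ • w)) / ‖g‖) := by
    rw [inner_neg_right, inner_smul_right, real_inner_comm, hg]; ring
  have hiff := lt_exitTime_iff hΩo hΩc hΩb hw (x := z - τ • w) hτ.le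
  rw [sub_add_cancel] at hiff
  rw [hin]
  constructor
  · intro hzΩ
    have h2 := hiff.2 ⟨h1.1, hzΩ⟩
    rw [← neg_div, div_le_iff₀ hgn]
    linarith [(abs_le.1 h1.2).2]
  · intro hzΩ
    have h2 : exitTime Ω w (z - τ • w) ≤ τ := by
      by_contra! hcon
      exact hzΩ (hiff.1 hcon).2
    rw [neg_le_neg_iff, div_le_iff₀ hgn]
    linarith [(abs_le.1 h1.2).1]

end Anisotropic
end


/-! ### The polyhedral distance and the volume of its sublevel sets. -/

noncomputable section

namespace Anisotropic

variable {n : ℕ} {Ω : Set (EuclideanSpace ℝ (Fin n))} {ι : Type*}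

/-- The distance to the complement of `Ω` for the polyhedral gauge whose unit ball is the convex
hull of the vectors `w i`. -/
def polyDist (Ω : Set (EuclideanSpace ℝ (Fin n))) (w : ι → EuclideanSpace ℝ (Fin n))
    (x : EuclideanSpace ℝ (Fin n)) : ℝ :=
  ⨅ i, exitTime Ω (w i) x

theorem polyDist_nonneg (w : ι → EuclideanSpace ℝ (Fin n)) (x : EuclideanSpace ℝ (Fin n)) :
    0 ≤ polyDist Ω w x :=
  Real.iInf_nonneg fun _ => exitTime_nonneg _ _

theorem polyDist_le (w : ι → EuclideanSpace ℝ (Fin n)) (x : EuclideanSpace ℝ (Fin n)) (i : ι) :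
    polyDist Ω w x ≤ exitTime Ω (w i) x :=
  ciInf_le ⟨0, by rintro _ ⟨i, rfl⟩; exact exitTime_nonneg _ _⟩ i

theorem polyDist_of_notMem (w : ι → EuclideanSpace ℝ (Fin n)) {x : EuclideanSpace ℝ (Fin n)}
    (hx : x ∉ Ω) : polyDist Ω w x = 0 := by
  simp [polyDist, exitTime_of_notMem _ hx]

theorem exists_exitTime_eq_polyDist [Finite ι] [Nonempty ι] (w : ι → EuclideanSpace ℝ (Fin n))
    (x : EuclideanSpace ℝ (Fin n)) : ∃ i, exitTime Ω (w i) x = polyDist Ω w x :=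
  exists_eq_ciInf_of_finite

/-- A hyperplane through `y` bounds `Ω`, and some `w i` approaches it with speed at least `c`.
Consequently sets `{polyDist > δ}` keep a positive distance from the complement of `Ω`. -/
theorem polyDist_le_norm_sub (hΩo : IsOpen Ω) (hΩc : Convex ℝ Ω) (hΩb : Bornology.IsBounded Ω)
    {w : ι → EuclideanSpace ℝ (Fin n)} (hw : ∀ i, w i ≠ 0) {c : ℝ} (hc : 0 < c) (hwc : ∀ v, ∃ i, c * ‖v‖ ≤ inner ℝ (w i) v)
    (x : EuclideanSpace ℝ (Fin n)) {y : EuclideanSpace ℝ (Fin n)} (hy : y ∉ Ω) :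
    polyDist Ω w x ≤ ‖x - y‖ / c := by
  by_cases hx : x ∈ Ω
  swap
  · rw [polyDist_of_notMem w hx]; positivity
  obtain ⟨v, hv, hv'⟩ := exists_unit_normal_of_notMem hΩo hΩc ⟨x, hx⟩ hy
  obtain ⟨i, hi⟩ := hwc v
  refine (polyDist_le w x i).trans ?_
  rw [le_div_iff₀ hc]
  have hcl : IsClosed {a : EuclideanSpace ℝ (Fin n) | inner ℝ (a - y) v ≤ 0} :=
    isClosed_le (by fun_prop) continuous_const
  have h1 : inner ℝ (x + exitTime Ω (w i) x • w i - y) v ≤ 0 :=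
    closure_minimal (fun a ha => (hv' a ha).le) hcl
      (add_exitTime_smul_mem_closure hΩo hΩc hΩb (hw i) hx (exitTime_nonneg _ _) le_rfl)
  rw [add_sub_right_comm, inner_add_left, inner_smul_left] at h1
  have h2 : inner ℝ (y - x) v ≤ ‖x - y‖ := by
    refine (real_inner_le_norm _ _).trans ?_
    rw [hv, mul_one, norm_sub_rev]
  rw [← neg_sub, inner_neg_left] at h2
  rw [hv, mul_one] at hi
  have h3 : exitTime Ω (w i) x * c ≤ exitTime Ω (w i) x * inner ℝ (w i) v :=
    mul_le_mul_of_nonneg_left hi (exitTime_nonneg _ _)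
  simp only [conj_trivial] at h1
  linarith

variable [Finite ι] [Nonempty ι] {w : ι → EuclideanSpace ℝ (Fin n)}

theorem lt_polyDist_iff (hΩo : IsOpen Ω) (hΩc : Convex ℝ Ω) (hΩb : Bornology.IsBounded Ω)
    (hw : ∀ i, w i ≠ 0) {x : EuclideanSpace ℝ (Fin n)} {t : ℝ} (ht : 0 ≤ t) :
    t < polyDist Ω w x ↔ x ∈ Ω ∧ ∀ i, x + t • w i ∈ Ω := by
  constructor
  · intro h
    have h1 := fun i => (lt_exitTime_iff hΩo hΩc hΩb (hw i) ht).1 (h.trans_le (polyDist_le w x i))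
    exact ⟨(h1 (Classical.arbitrary ι)).1, fun i => (h1 i).2⟩
  · rintro ⟨hx, h⟩
    obtain ⟨i, hi⟩ := exists_exitTime_eq_polyDist (Ω := Ω) w x
    rw [← hi]
    exact (lt_exitTime_iff hΩo hΩc hΩb (hw i) ht).2 ⟨hx, h i⟩

theorem polyDist_pos (hΩo : IsOpen Ω) (hΩc : Convex ℝ Ω) (hΩb : Bornology.IsBounded Ω)
    (hw : ∀ i, w i ≠ 0) {x : EuclideanSpace ℝ (Fin n)} (hx : x ∈ Ω) : 0 < polyDist Ω w x :=
  (lt_polyDist_iff hΩo hΩc hΩb hw le_rfl).2 ⟨hx, by simpa⟩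

/-- With `z = x - s w i` and room `r > s` at `z`, the point `x + (r - s) w j` is the convex
combination of `z + r w i` and `z + r w j` with weights `s/r` and `1 - s/r`, so `x` has room `r -
s`. This one-sided form of the eikonal inequality holds on the whole space. -/
theorem polyDist_sub_smul_le (hΩo : IsOpen Ω) (hΩc : Convex ℝ Ω) (hΩb : Bornology.IsBounded Ω)
    (hw : ∀ i, w i ≠ 0) (x : EuclideanSpace ℝ (Fin n)) {s : ℝ} (hs : 0 ≤ s) (i : ι) :
    polyDist Ω w (x - s • w i) ≤ polyDist Ω w x + s := by
  refine le_of_forall_lt fun r hr => ?_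
  rcases lt_or_ge r s with hrs | hrs
  · exact hrs.trans_le (by linarith [polyDist_nonneg (Ω := Ω) w x])
  rcases hrs.eq_or_lt with rfl | hrs
  · have := ((lt_polyDist_iff hΩo hΩc hΩb hw hs).1 hr).2 i
    rw [sub_add_cancel] at this
    linarith [polyDist_pos hΩo hΩc hΩb hw this]
  have hr0 : 0 < r := hs.trans_lt hrs
  obtain ⟨h1, h2⟩ := (lt_polyDist_iff hΩo hΩc hΩb hw hr0.le).1 hr
  have hmem : ∀ a b : ℝ, 0 ≤ a → 0 ≤ b → a + b = 1 → ∀ j,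
      a • (x - s • w i + r • w i) + b • (x - s • w i + r • w j) ∈ Ω :=
    fun a b ha hb hab j => hΩc (h2 i) (h2 j) ha hb hab
  have hx : x ∈ Ω := by
    have := hΩc h1 (h2 i) (a := (r - s) / r) (b := s / r) (div_nonneg (by linarith) hr0.le)
      (by positivity) (by field_simp; ring)
    have h3 : (r - s) / r = 1 - s / r := by field_simp
    have h4 : s / r * r = s := by field_simp
    convert this using 1
    rw [h3, smul_add, smul_smul, h4]
    module
  have : r - s < polyDist Ω w x := by
    refine (lt_polyDist_iff hΩo hΩc hΩb hw (by linarith)).2 ⟨hx, fun j => ?_⟩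
    have h3 := hmem (s / r) (1 - s / r) (by positivity)
      (by rw [sub_nonneg, div_le_one hr0]; exact hrs.le) (by ring) j
    have h4 : s / r * r = s := by field_simp
    have h5 : (1 - s / r) * r = r - s := by field_simp
    convert h3 using 1
    rw [smul_add, smul_add, smul_smul, smul_smul, h4, h5]
    module
  linarith

theorem concaveOn_polyDist (hΩo : IsOpen Ω) (hΩc : Convex ℝ Ω) (hΩb : Bornology.IsBounded Ω)
    (hw : ∀ i, w i ≠ 0) : ConcaveOn ℝ Ω (polyDist Ω w) := by
  refine ⟨hΩc, fun x hx y hy a b ha hb hab => ?_⟩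
  obtain ⟨i, hi⟩ := exists_exitTime_eq_polyDist (Ω := Ω) w (a • x + b • y)
  rw [← hi]
  refine le_trans ?_ ((concaveOn_exitTime hΩo hΩc hΩb (hw i)).2 hx hy ha hb hab)
  simp only [smul_eq_mul]
  gcongr <;> exact polyDist_le w _ i

/-- The outer unit normal on the regular boundary, extended by zero. -/
def normalField (Ω : Set (EuclideanSpace ℝ (Fin n))) :
    EuclideanSpace ℝ (Fin n) → EuclideanSpace ℝ (Fin n) :=
  (regularBoundary Ω).indicator (outerNormal Ω)

/-- The measure with density `H (ν)` with respect to the surface measure of the regular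
boundary. -/
def boundaryMeasure (H : EuclideanSpace ℝ (Fin n) → ℝ) (Ω : Set (EuclideanSpace ℝ (Fin n))) :
    Measure (EuclideanSpace ℝ (Fin n)) :=
  (μHE[n - 1].restrict (regularBoundary Ω)).withDensity
    fun y => ENNReal.ofReal (H (outerNormal Ω y))

theorem boundaryMeasure_le (H : EuclideanSpace ℝ (Fin n) → ℝ)
    (s : Set (EuclideanSpace ℝ (Fin n))) :
    boundaryMeasure H Ω s ≤ anisotropicPerimeter H Ω := by
  refine (measure_mono (subset_univ s)).trans ?_
  rw [boundaryMeasure, withDensity_apply _ MeasurableSet.univ, Measure.restrict_univ]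
  exact lintegral_mono_set fun y hy => hy.1

/-- `B i` collects the regular boundary points whose normal is best matched by `w i`. Tubes of
length `t` over the `B i`, in direction `-w i`, cover the sublevel set up to null sets, and `⟪w i,
ν⟫ ≤ H ν` bounds their volumes by boundary measures. Ties are tested only where the product is
positive, since `normalField` vanishes off the regular boundary. -/
theorem volume_polyDist_le (hΩo : IsOpen Ω) (hΩc : Convex ℝ Ω)
    (hΩb : Bornology.IsBounded Ω) (hΩne : Ω.Nonempty) {H : EuclideanSpace ℝ (Fin n) → ℝ}
    (hwH : ∀ i ξ, inner ℝ (w i) ξ ≤ H ξ) {c : ℝ} (hc : 0 < c)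
    (hwc : ∀ v, ∃ i, c * ‖v‖ ≤ inner ℝ (w i) v)
    (hw : ∀ i, w i ≠ 0)
    (hties : ∀ i j, i ≠ j → boundaryMeasure H Ω {y | 0 < inner ℝ (w i) (normalField Ω y) ∧
      inner ℝ (w i) (normalField Ω y) = inner ℝ (w j) (normalField Ω y)} = 0)
    {t : ℝ} (ht : 0 < t) :
    volume {x ∈ Ω | polyDist Ω w x ≤ t} ≤ ENNReal.ofReal t * anisotropicPerimeter H Ω := by
  have := Fintype.ofFinite ι
  set N := normalField Ω with hNdef
  have hNm : Measurable N := measurable_indicator_outerNormal hΩo hΩc hΩne hΩb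
  have hRm := measurableSet_regularBoundary hΩo hΩc hΩne hΩb
  have hN : ∀ y ∈ regularBoundary Ω, N y = outerNormal Ω y := fun y hy => indicator_of_mem hy _
  have hNN : ∀ y ∈ regularBoundary Ω, N y ∈ unitNormals Ω y := fun y hy => by
    rw [hN y hy]
    exact (isOuterNormal_outerNormal hy).mem_unitNormals hΩo hΩc (frontier_subset_closure hy.1)
  let B : ι → Set (EuclideanSpace ℝ (Fin n)) := fun i =>
    regularBoundary Ω ∩ {y | ∀ j, inner ℝ (w j) (N y) ≤ inner ℝ (w i) (N y)}
  have hBm : ∀ i, MeasurableSet (B i) := fun i => by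
    refine hRm.inter ?_
    have : {y | ∀ j, inner ℝ (w j) (N y) ≤ inner ℝ (w i) (N y)} =
        ⋂ j, {y | inner ℝ (w j) (N y) ≤ inner ℝ (w i) (N y)} := by ext; simp
    rw [this]
    exact MeasurableSet.iInter fun j => measurableSet_le (by fun_prop) (by fun_prop)
  have hBc : ∀ i, ∀ y ∈ B i, c ≤ inner ℝ (w i) (N y) := fun i y hy => by
    obtain ⟨j, hj⟩ := hwc (N y)
    rw [(hNN y hy.1).1, mul_one] at hj
    exact hj.trans (hy.2 j)
  have hcover : {x ∈ Ω | polyDist Ω w x ≤ t} ⊆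
      ⋃ i, ({x ∈ Ω | ¬ DifferentiableAt ℝ (exitTime Ω (w i)) x} ∪
        image2 (fun y (τ : ℝ) => y - τ • w i) (B i) (Icc 0 t)) := by
    rintro x ⟨hx, hxt⟩
    obtain ⟨i, hi⟩ := exists_exitTime_eq_polyDist (Ω := Ω) w x
    refine mem_iUnion.2 ⟨i, ?_⟩
    by_cases hd : DifferentiableAt ℝ (exitTime Ω (w i)) x
    swap
    · exact Or.inl ⟨hx, hd⟩
    right
    set τ := exitTime Ω (w i) x
    have hτ : 0 < τ := exitTime_pos hΩo hΩc hΩb (hw i) hx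
    have hyR : x + τ • w i ∈ regularBoundary Ω :=
      ⟨add_exitTime_smul_mem_frontier hΩo hΩc hΩb (hw i) hx,
        exists_isOuterNormal_exit hΩo hΩc hΩb (hw i) hx hd⟩
    refine ⟨x + τ • w i, ⟨hyR, fun j => ?_⟩, τ, ⟨hτ.le, hi ▸ hxt⟩, by simp⟩
    -- As `τ` is the least exit time, `x + τ w j` is in the closure for every `j`; the half-space at
    -- the exit point then gives `⟪w j, ν⟫ ≤ ⟪w i, ν⟫`.
    have h1 : x + τ • w j ∈ closure Ω := add_exitTime_smul_mem_closure hΩo hΩc hΩb (hw j) hx hτ.le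
      (hi ▸ polyDist_le w x j)
    have h2 := inner_sub_nonpos_of_mem_closure (hNN _ hyR) h1
    rw [add_sub_add_left_eq_sub, ← smul_sub, real_inner_smul_left, inner_sub_left] at h2
    have := nonpos_of_mul_nonpos_right h2 hτ
    linarith
  have htube : ∀ i, volume (image2 (fun y (τ : ℝ) => y - τ • w i) (B i) (Icc 0 t)) ≤
      ENNReal.ofReal t * boundaryMeasure H Ω (B i) := by
    intro i
    have h1 := volume_tube_le (w := w i) hc ht (hBm i) hNm (fun y hy => (hNN y hy.1).1)
      (fun y hy y' hy' => by
        rw [real_inner_comm]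
        exact inner_sub_nonpos_of_mem_closure (hNN y hy.1) (frontier_subset_closure hy'.1.1))
      (fun y hy => by rw [real_inner_comm]; exact hBc i y hy)
    rw [finrank_euclideanSpace_fin] at h1
    refine h1.trans (mul_le_mul_right ?_ _)
    rw [boundaryMeasure, withDensity_apply _ (hBm i), Measure.restrict_restrict (hBm i),
      inter_eq_left.2 (inter_subset_left : B i ⊆ regularBoundary Ω)]
    refine setLIntegral_mono' (hBm i) fun y hy => ENNReal.ofReal_le_ofReal ?_
    rw [← hN y hy.1, real_inner_comm]
    exact hwH i _
  have hdisj : Pairwise (Function.onFun (AEDisjoint (boundaryMeasure H Ω)) B) := by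
    intro i j hij
    refine measure_mono_null ?_ (hties i j hij)
    rintro y ⟨hyi, hyj⟩
    exact ⟨hc.trans_le (hBc i y hyi), le_antisymm (hyj.2 i) (hyi.2 j)⟩
  calc _ ≤ volume (⋃ i, ({x ∈ Ω | ¬ DifferentiableAt ℝ (exitTime Ω (w i)) x} ∪
        image2 (fun y (τ : ℝ) => y - τ • w i) (B i) (Icc 0 t))) := measure_mono hcover
    _ ≤ ∑ i, volume ({x ∈ Ω | ¬ DifferentiableAt ℝ (exitTime Ω (w i)) x} ∪
        image2 (fun y (τ : ℝ) => y - τ • w i) (B i) (Icc 0 t)) := measure_iUnion_fintype_le _ _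
    _ ≤ ∑ i, ENNReal.ofReal t * boundaryMeasure H Ω (B i) := by
        refine Finset.sum_le_sum fun i _ => (measure_union_le _ _).trans ?_
        rw [ae_differentiableAt_exitTime hΩo hΩc hΩb (hw i), zero_add]
        exact htube i
    _ = ENNReal.ofReal t * boundaryMeasure H Ω (⋃ i, B i) := by
        rw [← Finset.mul_sum, measure_iUnion₀ hdisj fun i => (hBm i).nullMeasurableSet, tsum_fintype]
    _ ≤ _ := mul_le_mul_right (boundaryMeasure_le H _) _

end Anisotropic
end


/-! ### Smooth norms and their approximation by polyhedral ones. -/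

noncomputable section

namespace Anisotropic

variable {n : ℕ}

/-- A norm on `ℝⁿ` of class `C¹` away from the origin. -/
structure IsSmoothNorm (H : EuclideanSpace ℝ (Fin n) → ℝ) (α β : ℝ) : Prop where
  convex : ConvexOn ℝ Set.univ H
  contDiffOn : ContDiffOn ℝ 1 H {0}ᶜ
  smul : ∀ (t : ℝ) (ξ : EuclideanSpace ℝ (Fin n)), H (t • ξ) = |t| * H ξ
  pos : 0 < α
  le : α ≤ β
  lower : ∀ ξ, α * ‖ξ‖ ≤ H ξ
  upper : ∀ ξ, H ξ ≤ β * ‖ξ‖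

namespace IsSmoothNorm

variable {H : EuclideanSpace ℝ (Fin n) → ℝ} {α β : ℝ}

theorem nonneg (h : IsSmoothNorm H α β) (ξ : EuclideanSpace ℝ (Fin n)) : 0 ≤ H ξ :=
  (mul_nonneg h.pos.le (norm_nonneg ξ)).trans (h.lower ξ)

theorem apply_zero (h : IsSmoothNorm H α β) : H 0 = 0 := by
  simpa using h.smul 0 0

theorem apply_neg (h : IsSmoothNorm H α β) (ξ : EuclideanSpace ℝ (Fin n)) : H (-ξ) = H ξ := by
  simpa using h.smul (-1) ξ

theorem add_le (h : IsSmoothNorm H α β) (ξ η : EuclideanSpace ℝ (Fin n)) :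
    H (ξ + η) ≤ H ξ + H η := by
  have h1 := h.convex.2 (mem_univ ξ) (mem_univ η) (by norm_num : (0 : ℝ) ≤ 1 / 2)
    (by norm_num : (0 : ℝ) ≤ 1 / 2) (by norm_num)
  rw [← smul_add, h.smul, abs_of_pos (by norm_num : (0 : ℝ) < 1 / 2)] at h1
  simp only [smul_eq_mul] at h1
  linarith

theorem abs_sub_le (h : IsSmoothNorm H α β) (ξ η : EuclideanSpace ℝ (Fin n)) :
    |H ξ - H η| ≤ β * ‖ξ - η‖ := by
  have h1 := h.add_le (ξ - η) η
  have h2 := h.add_le (η - ξ) ξ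
  rw [sub_add_cancel] at h1 h2
  have h3 := h.upper (ξ - η)
  rw [← neg_sub, h.apply_neg] at h2
  exact abs_le.2 ⟨by linarith, by linarith⟩

theorem continuous (h : IsSmoothNorm H α β) : Continuous H := by
  refine (LipschitzWith.of_dist_le_mul (K := Real.toNNReal β) fun x y => ?_).continuous
  rw [Real.dist_eq, dist_eq_norm]
  exact (h.abs_sub_le x y).trans (by gcongr; exact Real.le_coe_toNNReal β)

theorem differentiableAt (h : IsSmoothNorm H α β) {v : EuclideanSpace ℝ (Fin n)} (hv : v ≠ 0) :
    DifferentiableAt ℝ H v :=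
  (h.contDiffOn.contDiffAt (isOpen_compl_singleton.mem_nhds hv)).differentiableAt one_ne_zero

/-- Subadditivity bounds the difference quotients of `H` along `ξ` by `H ξ`. Where `H` is not
differentiable the gradient is `0` by convention, so no case is excluded. -/
theorem inner_gradient_le (h : IsSmoothNorm H α β) (v ξ : EuclideanSpace ℝ (Fin n)) :
    inner ℝ (gradient H v) ξ ≤ H ξ := by
  by_cases hv : DifferentiableAt ℝ H v
  swap
  · rw [gradient_eq_zero_of_not_differentiableAt hv, inner_zero_left]
    exact h.nonneg ξ
  have hd : HasDerivAt (fun t : ℝ => H (v + t • ξ)) (inner ℝ (gradient H v) ξ) 0 := by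
    have h1 : HasFDerivAt H (InnerProductSpace.toDual ℝ _ (gradient H v)) (v + (0 : ℝ) • ξ) := by
      simpa using hv.hasGradientAt.hasFDerivAt
    have h2 : HasDerivAt (fun t : ℝ => v + t • ξ) ξ 0 := by
      simpa using ((hasDerivAt_id (0 : ℝ)).smul_const ξ).const_add v
    exact h1.comp_hasDerivAt 0 h2
  refine le_of_tendsto hd.tendsto_slope_zero_right ?_
  filter_upwards [self_mem_nhdsWithin] with t ht
  have ht' : 0 < t := ht
  have h3 := h.add_le v (t • ξ)
  rw [h.smul, abs_of_pos ht'] at h3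
  simp only [zero_add, zero_smul, add_zero, smul_eq_mul]
  rw [inv_mul_le_iff₀ ht']
  linarith

theorem inner_gradient_self (h : IsSmoothNorm H α β) {v : EuclideanSpace ℝ (Fin n)} (hv : v ≠ 0) :
    inner ℝ (gradient H v) v = H v := by
  refine le_antisymm (h.inner_gradient_le v v) ?_
  have hd : HasDerivAt (fun t : ℝ => H (v + t • v)) (inner ℝ (gradient H v) v) 0 := by
    have h1 : HasFDerivAt H (InnerProductSpace.toDual ℝ _ (gradient H v)) (v + (0 : ℝ) • v) := by
      simpa using (h.differentiableAt hv).hasGradientAt.hasFDerivAt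
    have h2 : HasDerivAt (fun t : ℝ => v + t • v) v 0 := by
      simpa using ((hasDerivAt_id (0 : ℝ)).smul_const v).const_add v
    exact h1.comp_hasDerivAt 0 h2
  refine ge_of_tendsto hd.tendsto_slope_zero_right ?_
  filter_upwards [self_mem_nhdsWithin] with t ht
  have ht' : 0 < t := ht
  have h3 : H (v + t • v) = (1 + t) * H v := by
    rw [← abs_of_pos (by linarith : 0 < 1 + t), ← h.smul, add_smul, one_smul]
  simp only [zero_add, zero_smul, add_zero, smul_eq_mul]
  rw [h3, le_inv_mul_iff₀ ht']
  linarith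

theorem norm_gradient_le (h : IsSmoothNorm H α β) (v : EuclideanSpace ℝ (Fin n)) :
    ‖gradient H v‖ ≤ β := by
  have h1 := (h.inner_gradient_le v (gradient H v)).trans (h.upper _)
  rw [real_inner_self_eq_norm_mul_norm] at h1
  rcases (norm_nonneg (gradient H v)).eq_or_lt with h0 | h0
  · exact h0 ▸ h.pos.le.trans h.le
  · exact le_of_mul_le_mul_right h1 h0

/-- Euler's identity makes the inequality strict at `ξ = v`, hence valid near `v`; finitely many
such neighbourhoods cover the unit sphere, and homogeneity does the rest. -/
theorem exists_finite_support (h : IsSmoothNorm H α β) {ε : ℝ} (hε : 0 < ε) :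
    ∃ t : Finset (EuclideanSpace ℝ (Fin n)), (∀ v ∈ t, v ≠ 0) ∧
      ∀ ξ ≠ 0, ∃ v ∈ t, H ξ ≤ (1 + ε) * inner ℝ (gradient H v) ξ := by
  obtain ⟨t, ht, hcov⟩ := (isCompact_sphere (0 : EuclideanSpace ℝ (Fin n)) 1).elim_nhds_subcover
    (fun v => {ξ | H ξ < (1 + ε) * inner ℝ (gradient H v) ξ}) fun v hv => by
      have hv0 : v ≠ 0 := fun h0 => by simp [h0] at hv
      have hop : IsOpen {ξ | H ξ < (1 + ε) * inner ℝ (gradient H v) ξ} :=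
        isOpen_lt h.continuous (by fun_prop)
      refine hop.mem_nhds ?_
      change H v < (1 + ε) * inner ℝ (gradient H v) v
      rw [h.inner_gradient_self hv0]
      have : 0 < H v := (mul_pos h.pos (norm_pos_iff.2 hv0)).trans_le (h.lower v)
      nlinarith
  refine ⟨t, fun v hv h0 => ?_, fun ξ hξ => ?_⟩
  · have := ht v hv
    simp [h0] at this
  · have hn : 0 < ‖ξ‖ := norm_pos_iff.2 hξ
    have hs : ‖ξ‖⁻¹ • ξ ∈ Metric.sphere (0 : EuclideanSpace ℝ (Fin n)) 1 := by
      rw [mem_sphere_zero_iff_norm, norm_smul, norm_inv, norm_norm, inv_mul_cancel₀ hn.ne']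
    obtain ⟨v, hv, hlt⟩ := mem_iUnion₂.1 (hcov hs)
    refine ⟨v, hv, ?_⟩
    have h1 : H (‖ξ‖⁻¹ • ξ) < (1 + ε) * inner ℝ (gradient H v) (‖ξ‖⁻¹ • ξ) := hlt
    rw [h.smul, inner_smul_right, abs_of_pos (inv_pos.2 hn), mul_left_comm] at h1
    exact (lt_of_mul_lt_mul_left h1 (inv_pos.2 hn).le).le

/-- The gradients from `exists_finite_support` are rescaled by `exp (-θ i)`. A tie between `i` and
`j` then places `y` on one level set of the ratio `q i j`, at a level depending injectively on `θ`.
Only countably many levels carry positive measure, so almost every small `θ` avoids them all. -/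
theorem exists_polyhedral_approx (h : IsSmoothNorm H α β) (hn : 1 ≤ n) {ε : ℝ} (hε : 0 < ε)
    (m : Measure (EuclideanSpace ℝ (Fin n))) [SFinite m]
    {N : EuclideanSpace ℝ (Fin n) → EuclideanSpace ℝ (Fin n)} (hN : Measurable N) :
    ∃ (k : ℕ) (w : Fin (k + 1) → EuclideanSpace ℝ (Fin n)), (∀ i, w i ≠ 0) ∧
      (∀ i ξ, inner ℝ (w i) ξ ≤ H ξ) ∧
      (∀ ξ, ∃ i, H ξ ≤ (1 + ε) ^ 2 * inner ℝ (w i) ξ) ∧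
      ∀ i j, i ≠ j → m {y | 0 < inner ℝ (w i) (N y) ∧
        inner ℝ (w i) (N y) = inner ℝ (w j) (N y)} = 0 := by
  obtain ⟨t, ht0, ht⟩ := h.exists_finite_support hε
  have hne : t.Nonempty := by
    have h0 : (EuclideanSpace.single ⟨0, hn⟩ 1 : EuclideanSpace ℝ (Fin n)) ≠ 0 := by simp
    obtain ⟨v, hv, -⟩ := ht _ h0
    exact ⟨v, hv⟩
  obtain ⟨k, hk⟩ : ∃ k, t.card = k + 1 := ⟨t.card - 1, by have := hne.card_pos; omega⟩
  let e : t ≃ Fin (k + 1) := t.equivFinOfCardEq hk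
  let g : Fin (k + 1) → EuclideanSpace ℝ (Fin n) := fun i => gradient H (e.symm i)
  let q : Fin (k + 1) → Fin (k + 1) → EuclideanSpace ℝ (Fin n) → ℝ := fun i j y =>
    inner ℝ (g i) (N y) / inner ℝ (g j) (N y)
  have hq : ∀ i j, Measurable (q i j) := fun i j => by fun_prop
  let f : Fin (k + 1) → Fin (k + 1) → ℝ → ℝ := fun i j θ => Real.exp (-(θ * ((j : ℝ) - i)))
  have hbad : (⋃ i, ⋃ j, ⋃ (_ : i ≠ j), f i j ⁻¹' {r | 0 < m {y | q i j y = r}}).Countable := by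
    refine countable_iUnion fun i => countable_iUnion fun j => countable_iUnion fun hij => ?_
    refine (Measure.countable_meas_level_set_pos (hq i j)).preimage_of_injOn ?_
    intro θ _ θ' _ hθ
    have hij' : (j : ℝ) - i ≠ 0 := sub_ne_zero.2 fun h => hij (Fin.ext (by exact_mod_cast h.symm))
    simpa [f, hij'] using hθ
  -- The upper bound on `θ` ensures `exp (-θ i) ≥ 1/(1+ε)` for every index, which accounts for the
  -- second factor `1 + ε` in the conclusion.
  obtain ⟨θ, hθbad, hθ0, hθ1⟩ : ∃ θ, θ ∉ (⋃ i, ⋃ j, ⋃ (_ : i ≠ j),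
      f i j ⁻¹' {r | 0 < m {y | q i j y = r}}) ∧ 0 < θ ∧ θ < Real.log (1 + ε) / (k + 1) := by
    have hlog : 0 < Real.log (1 + ε) := Real.log_pos (by linarith)
    obtain ⟨θ, hθ, hθ'⟩ := (hbad.dense_compl ℝ).exists_mem_open isOpen_Ioo
      (nonempty_Ioo.2 (div_pos hlog (by positivity : (0 : ℝ) < (k : ℝ) + 1)))
    exact ⟨θ, hθ, hθ'.1, hθ'.2⟩
  refine ⟨k, fun i => Real.exp (-(θ * i)) • g i, fun i => ?_, fun i ξ => ?_, fun ξ => ?_,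
    fun i j hij => ?_⟩
  · refine smul_ne_zero (Real.exp_ne_zero _) fun h0 => ?_
    have hv0 := ht0 _ (e.symm i).2
    have h1 := h.inner_gradient_self hv0
    have h2 : gradient H (e.symm i) = 0 := h0
    rw [h2, inner_zero_left] at h1
    have := (mul_pos h.pos (norm_pos_iff.2 hv0)).trans_le (h.lower _)
    linarith
  · rw [real_inner_smul_left]
    have h1 : Real.exp (-(θ * i)) ≤ 1 := Real.exp_le_one_iff.2 (by
      have : 0 ≤ θ * (i : ℝ) := by positivity
      linarith)
    calc Real.exp (-(θ * i)) * inner ℝ (g i) ξ ≤ Real.exp (-(θ * i)) * H ξ := by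
          gcongr; exact h.inner_gradient_le _ _
      _ ≤ 1 * H ξ := by gcongr; exact h.nonneg ξ
      _ = H ξ := one_mul _
  · rcases eq_or_ne ξ 0 with rfl | hξ
    · exact ⟨0, by simp [h.apply_zero]⟩
    obtain ⟨v, hv, hvξ⟩ := ht ξ hξ
    refine ⟨e ⟨v, hv⟩, ?_⟩
    set i := e ⟨v, hv⟩
    have hgi : g i = gradient H v := by simp [g, i]
    rw [real_inner_smul_left, hgi]
    have hpos : 0 ≤ inner ℝ (gradient H v) ξ := by
      have := (h.nonneg ξ).trans hvξ
      exact nonneg_of_mul_nonneg_right this (by linarith)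
    have h1 : 1 ≤ (1 + ε) * Real.exp (-(θ * i)) := by
      rw [← Real.exp_log (by linarith : 0 < 1 + ε), ← Real.exp_add]
      refine Real.one_le_exp ?_
      have h2 : θ * i ≤ θ * (k + 1) := by
        gcongr
        exact_mod_cast i.2.le
      rw [lt_div_iff₀ (by positivity)] at hθ1
      linarith
    calc H ξ ≤ (1 + ε) * inner ℝ (gradient H v) ξ := hvξ
      _ ≤ (1 + ε) * inner ℝ (gradient H v) ξ * ((1 + ε) * Real.exp (-(θ * i))) :=
        le_mul_of_one_le_right (mul_nonneg (by linarith) hpos) h1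
      _ = _ := by ring
  · have h1 : m {y | q i j y = f i j θ} = 0 := by
      by_contra hne
      exact hθbad (mem_iUnion.2 ⟨i, mem_iUnion.2 ⟨j, mem_iUnion.2 ⟨hij, pos_iff_ne_zero.2 hne⟩⟩⟩)
    refine measure_mono_null (fun y hy => ?_) h1
    obtain ⟨hy1, hy2⟩ := hy
    rw [real_inner_smul_left] at hy1 hy2
    rw [real_inner_smul_left] at hy2
    have hj : 0 < inner ℝ (g j) (N y) := by
      rw [hy2] at hy1
      exact pos_of_mul_pos_right hy1 (Real.exp_pos _).le
    change inner ℝ (g i) (N y) / inner ℝ (g j) (N y) = Real.exp (-(θ * ((j : ℝ) - i)))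
    rw [div_eq_iff hj.ne']
    have h3 : Real.exp (-(θ * ((j : ℝ) - i))) = Real.exp (-(θ * j)) * Real.exp (θ * i) := by
      rw [← Real.exp_add]; congr 1; ring
    have h4 : Real.exp (-(θ * i)) * Real.exp (θ * i) = 1 := by
      rw [← Real.exp_add]; simp
    rw [h3]
    linear_combination (-Real.exp (θ * i)) * hy2 * (-1) - inner ℝ (g i) (N y) * h4
      
end IsSmoothNorm

end Anisotropic
end


/-! ### The generalized arcsine and sine. -/

noncomputable section

namespace Anisotropic

variable {p : ℝ}

/-- The integrand `(1 - t^p/(p-1))^{-1/p}` of the generalized arcsine. -/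
def arcsinDensity (p t : ℝ) : ℝ := 1 / (1 - t ^ p / (p - 1)) ^ (1 / p)

/-- The generalized arcsine `∫_0^y (1 - t^p/(p-1))^{-1/p} dt`. -/
def arcsinP (p y : ℝ) : ℝ := ∫ t in (0 : ℝ)..y, arcsinDensity p t

/-- The right end point `(p-1)^{1/p}` of the domain of the generalized arcsine. -/
def sinPMax (p : ℝ) : ℝ := (p - 1) ^ (1 / p)

theorem arcsinP_sinPMax (p : ℝ) : arcsinP p (sinPMax p) = piP p / 2 := by
  rw [piP, mul_div_cancel_left₀ _ two_ne_zero]; rfl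

theorem sinPMax_pos (hp : 1 < p) : 0 < sinPMax p := Real.rpow_pos_of_pos (by linarith) _

theorem sinPMax_rpow (hp : 1 < p) : sinPMax p ^ p = p - 1 := by
  rw [sinPMax, ← Real.rpow_mul (by linarith), one_div, inv_mul_cancel₀ (by linarith),
    Real.rpow_one]

theorem rpow_div_le_one (hp : 1 < p) {t : ℝ} (ht : t ∈ Icc 0 (sinPMax p)) :
    t ^ p / (p - 1) ≤ 1 := by
  rw [div_le_one (by linarith), ← sinPMax_rpow hp]
  exact Real.rpow_le_rpow ht.1 ht.2 (by linarith)

theorem rpow_div_lt_one (hp : 1 < p) {t : ℝ} (ht : t ∈ Ico 0 (sinPMax p)) :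
    t ^ p / (p - 1) < 1 := by
  rw [div_lt_one (by linarith), ← sinPMax_rpow hp]
  exact Real.rpow_lt_rpow ht.1 ht.2 (by linarith)

theorem arcsinDensity_nonneg (hp : 1 < p) {t : ℝ} (ht : t ∈ Icc 0 (sinPMax p)) :
    0 ≤ arcsinDensity p t :=
  one_div_nonneg.2 (Real.rpow_nonneg (sub_nonneg.2 (rpow_div_le_one hp ht)) _)

theorem arcsinDensity_mono (hp : 1 < p) {s t : ℝ} (hs : 0 ≤ s) (hst : s ≤ t)
    (ht : t < sinPMax p) : arcsinDensity p s ≤ arcsinDensity p t := by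
  have h1 : 0 < 1 - t ^ p / (p - 1) :=
    sub_pos.2 (rpow_div_lt_one hp ⟨hs.trans hst, ht⟩)
  have hp1 : 0 < p - 1 := by linarith
  unfold arcsinDensity
  gcongr

theorem continuousOn_arcsinDensity (hp : 1 < p) :
    ContinuousOn (arcsinDensity p) (Ico 0 (sinPMax p)) := by
  have hc : Continuous fun t : ℝ => 1 - t ^ p / (p - 1) :=
    continuous_const.sub ((Real.continuous_rpow_const (by linarith)).div_const _)
  refine ContinuousOn.div continuousOn_const
    (hc.continuousOn.rpow_const fun t ht => Or.inl (sub_pos.2 (rpow_div_lt_one hp ht)).ne') ?_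
  exact fun t ht => (Real.rpow_pos_of_pos (sub_pos.2 (rpow_div_lt_one hp ht)) _).ne'

/-- With `M = sinPMax p`, `t^p/(p-1) = (t/M)^p ≤ t/M`, so the density is dominated by `(1 -
t/M)^(-1/p)`, integrable because `1/p < 1`. -/
theorem intervalIntegrable_arcsinDensity (hp : 1 < p) :
    IntervalIntegrable (arcsinDensity p) volume 0 (sinPMax p) := by
  set M := sinPMax p
  have hM : 0 < M := sinPMax_pos hp
  have hp1 : 0 < p - 1 := by linarith
  have h1 : IntervalIntegrable (fun x : ℝ => x ^ (-(1 / p))) volume 0 M := by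
    refine intervalIntegral.intervalIntegrable_rpow' ?_
    rw [neg_lt_neg_iff, div_lt_one (by linarith)]
    exact hp
  have h2 : IntervalIntegrable (fun x : ℝ => M ^ (1 / p) * (M - x) ^ (-(1 / p))) volume 0 M := by
    have := (h1.comp_sub_left M).symm
    simp only [sub_self, sub_zero] at this
    exact this.const_mul _
  rw [intervalIntegrable_iff_integrableOn_Ioo_of_le hM.le] at h2 ⊢
  refine h2.mono' ((continuousOn_arcsinDensity hp).mono Ioo_subset_Ico_self |>.aestronglyMeasurable
    measurableSet_Ioo) ?_
  refine (ae_restrict_iff' measurableSet_Ioo).2 (ae_of_all _ fun t ht => ?_)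
  rw [Real.norm_of_nonneg (arcsinDensity_nonneg hp ⟨ht.1.le, ht.2.le⟩)]
  have h3 : t ^ p / (p - 1) ≤ t / M := by
    rw [← sinPMax_rpow hp, ← Real.div_rpow ht.1.le hM.le]
    have h4 : t / M ≤ 1 := (div_le_one hM).2 ht.2.le
    calc (t / M) ^ p ≤ (t / M) ^ (1 : ℝ) :=
          Real.rpow_le_rpow_of_exponent_ge (div_pos ht.1 hM) h4 hp.le
      _ = t / M := Real.rpow_one _
  have h5 : 0 < 1 - t / M := sub_pos.2 ((div_lt_one hM).2 ht.2)
  have h6 : 0 < M - t := sub_pos.2 ht.2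
  calc arcsinDensity p t ≤ 1 / (1 - t / M) ^ (1 / p) := by unfold arcsinDensity; gcongr
    _ = M ^ (1 / p) * (M - t) ^ (-(1 / p)) := by
      have : 1 - t / M = (M - t) / M := by field_simp
      rw [this, Real.div_rpow h6.le hM.le, Real.rpow_neg h6.le]
      field_simp

theorem intervalIntegrable_arcsinDensity_of_mem (hp : 1 < p) {a b : ℝ} (ha : a ∈ Icc 0 (sinPMax p))
    (hb : b ∈ Icc 0 (sinPMax p)) : IntervalIntegrable (arcsinDensity p) volume a b := by
  refine (intervalIntegrable_arcsinDensity hp).mono_set ?_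
  rw [uIcc_of_le (sinPMax_pos hp).le]
  exact uIcc_subset_Icc ha hb

theorem continuousOn_arcsinP (hp : 1 < p) : ContinuousOn (arcsinP p) (Icc 0 (sinPMax p)) := by
  have := intervalIntegral.continuousOn_primitive_interval' (intervalIntegrable_arcsinDensity hp)
    (left_mem_uIcc)
  rwa [uIcc_of_le (sinPMax_pos hp).le] at this

theorem hasDerivAt_arcsinP (hp : 1 < p) {y : ℝ} (hy : y ∈ Ioo 0 (sinPMax p)) :
    HasDerivAt (arcsinP p) (arcsinDensity p y) y := by
  have hc : ContinuousOn (arcsinDensity p) (Ioo 0 (sinPMax p)) :=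
    (continuousOn_arcsinDensity hp).mono Ioo_subset_Ico_self
  refine intervalIntegral.integral_hasDerivAt_right
    (intervalIntegrable_arcsinDensity_of_mem hp ⟨le_rfl, (sinPMax_pos hp).le⟩ ⟨hy.1.le, hy.2.le⟩)
    (hc.stronglyMeasurableAtFilter isOpen_Ioo y hy) (hc.continuousAt (isOpen_Ioo.mem_nhds hy))

theorem arcsinP_zero (p : ℝ) : arcsinP p 0 = 0 := intervalIntegral.integral_same

theorem le_arcsinP_sub (hp : 1 < p) {y z : ℝ} (hy : 0 ≤ y) (hyz : y ≤ z) (hz : z ≤ sinPMax p) :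
    (z - y) * arcsinDensity p y ≤ arcsinP p z - arcsinP p y := by
  have hy' : y ∈ Icc 0 (sinPMax p) := ⟨hy, hyz.trans hz⟩
  have hz' : z ∈ Icc 0 (sinPMax p) := ⟨hy.trans hyz, hz⟩
  have h0 : (0 : ℝ) ∈ Icc 0 (sinPMax p) := ⟨le_rfl, (sinPMax_pos hp).le⟩
  rw [arcsinP, arcsinP, intervalIntegral.integral_interval_sub_left
    (intervalIntegrable_arcsinDensity_of_mem hp h0 hz')
    (intervalIntegrable_arcsinDensity_of_mem hp h0 hy')]
  rw [← smul_eq_mul, ← intervalIntegral.integral_const]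
  refine intervalIntegral.integral_mono_on_of_le_Ioo hyz intervalIntegrable_const
    (intervalIntegrable_arcsinDensity_of_mem hp hy' hz') fun t ht => ?_
  exact arcsinDensity_mono hp hy ht.1.le (ht.2.trans_le hz)

theorem strictMonoOn_arcsinP (hp : 1 < p) : StrictMonoOn (arcsinP p) (Icc 0 (sinPMax p)) := by
  intro y hy z hz hyz
  have h1 := le_arcsinP_sub hp hy.1 hyz.le hz.2
  have h2 : 0 < arcsinDensity p y := one_div_pos.2 (Real.rpow_pos_of_pos
    (sub_pos.2 (rpow_div_lt_one hp ⟨hy.1, hyz.trans_le hz.2⟩)) _)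
  nlinarith [mul_pos (sub_pos.2 hyz) h2]

theorem piP_pos (hp : 1 < p) : 0 < piP p := by
  have := strictMonoOn_arcsinP hp ⟨le_rfl, (sinPMax_pos hp).le⟩ ⟨(sinPMax_pos hp).le, le_rfl⟩
    (sinPMax_pos hp)
  rw [arcsinP_zero, arcsinP_sinPMax] at this
  linarith

/-- The generalized sine, extended by constants to a monotone function on the real line. -/
theorem exists_generalized_sine (hp : 1 < p) : ∃ g : ℝ → ℝ, (∀ a, g a ∈ Icc 0 (sinPMax p)) ∧
    Monotone g ∧ g 0 = 0 ∧
    (∀ a s, 0 ≤ a → 0 ≤ s → g (a + s) ≤ g a + s * (1 - g a ^ p / (p - 1)) ^ (1 / p)) ∧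
    ∀ y ∈ Icc 0 (sinPMax p), ∀ a, y < sinPMax p → arcsinP p y < a → y < g a := by
  set M := sinPMax p
  have hM : 0 < M := sinPMax_pos hp
  have h0M : (0 : ℝ) ∈ Icc 0 M := ⟨le_rfl, hM.le⟩
  have hMM : M ∈ Icc 0 M := ⟨hM.le, le_rfl⟩
  have hmono := strictMonoOn_arcsinP hp
  have hGM : 0 < arcsinP p M := by simpa [arcsinP_zero] using hmono h0M hMM hM
  -- `g a` is the inverse of `arcsinP` at `a` clamped to `[0, π_p/2]`.
  have hex : ∀ a : ℝ, ∃ y ∈ Icc 0 M, arcsinP p y = max 0 (min a (arcsinP p M)) := by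
    intro a
    have := intermediate_value_Icc hM.le (continuousOn_arcsinP hp)
    rw [arcsinP_zero] at this
    exact this ⟨le_max_left _ _, max_le hGM.le (min_le_right _ _)⟩
  choose g hgM hg using hex
  refine ⟨g, hgM, fun a b hab => ?_, ?_, fun a s ha hs => ?_, fun y hy a hyM hya => ?_⟩
  · rw [← hmono.le_iff_le (hgM a) (hgM b), hg, hg]
    gcongr
  · refine hmono.injOn (hgM 0) h0M ?_
    rw [hg, arcsinP_zero, min_eq_left hGM.le, max_self]
  · rcases le_or_gt (g (a + s)) (g a) with h | h
    · have : 0 ≤ (1 - g a ^ p / (p - 1)) ^ (1 / p) :=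
        Real.rpow_nonneg (sub_nonneg.2 (rpow_div_le_one hp (hgM a))) _
      nlinarith [mul_nonneg hs this]
    · have h1 := le_arcsinP_sub hp (hgM a).1 h.le (hgM (a + s)).2
      have h2 : arcsinP p (g (a + s)) - arcsinP p (g a) ≤ s := by
        rw [hg, hg, max_eq_right (le_min (by linarith) hGM.le), max_eq_right (le_min ha hGM.le)]
        have := min_add_add_right a (arcsinP p M) s
        have h3 : min (a + s) (arcsinP p M) ≤ min (a + s) (arcsinP p M + s) :=
          min_le_min_left _ (by linarith)
        linarith
      have h3 : 0 < (1 - g a ^ p / (p - 1)) ^ (1 / p) := Real.rpow_pos_of_pos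
        (sub_pos.2 (rpow_div_lt_one hp ⟨(hgM a).1, h.trans_le (hgM _).2⟩)) _
      rw [arcsinDensity, mul_one_div] at h1
      have := (div_le_iff₀ h3).1 (h1.trans h2)
      linarith
  · have hlt : arcsinP p y < arcsinP p M := hmono hy hMM hyM
    rw [← hmono.lt_iff_lt hy (hgM a), hg]
    exact (lt_min hya hlt).trans_le (le_max_right _ _)

/-- This is the mean of the `p`-th power of the generalized sine over `[0, π_p/2]`, written in
layer-cake form. -/
theorem integral_rpow_mul_one_sub_arcsinP (hp : 1 < p) :
    IntervalIntegrable (fun y => p * y ^ (p - 1) * (1 - arcsinP p y / (piP p / 2))) volume 0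
      (sinPMax p) ∧
    ∫ y in (0 : ℝ)..sinPMax p, p * y ^ (p - 1) * (1 - arcsinP p y / (piP p / 2)) =
      (p - 1) / p := by
  set M := sinPMax p
  set Q := piP p / 2 with hQ
  have hQ0 : 0 < Q := by have := piP_pos hp; positivity
  have hM : 0 < M := sinPMax_pos hp
  have hp0 : 0 < p := by linarith
  have hp1 : 0 < p - 1 := by linarith
  have hcont : ContinuousOn (fun y => p * y ^ (p - 1) * (1 - arcsinP p y / Q)) (Icc 0 M) :=
    ((continuous_const.mul (Real.continuous_rpow_const hp1.le)).continuousOn).mul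
      (continuousOn_const.sub ((continuousOn_arcsinP hp).div_const _))
  have hint : IntervalIntegrable (fun y => p * y ^ (p - 1) * (1 - arcsinP p y / Q)) volume 0 M :=
    hcont.intervalIntegrable_of_Icc hM.le
  refine ⟨hint, ?_⟩
  -- Explicit primitive: integration by parts leaves `y^p` times the density over `Q`, and the
  -- derivative of `y (1 - y^p/(p-1))^(1-1/p)` is the density times `1 - p y^p/(p-1)`.
  let Z : ℝ → ℝ := fun y => y ^ p * (1 - arcsinP p y / Q) +
    (p - 1) / (p * Q) * (arcsinP p y - y * (1 - y ^ p / (p - 1)) ^ (1 - 1 / p))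
  have hexp : 0 < 1 - 1 / p := by rw [sub_pos, div_lt_one hp0]; exact hp
  have hZc : ContinuousOn Z (Icc 0 M) := by
    have h1 : Continuous fun y : ℝ => y ^ p := Real.continuous_rpow_const hp0.le
    have h2 : Continuous fun y : ℝ => (1 - y ^ p / (p - 1)) ^ (1 - 1 / p) :=
      (Real.continuous_rpow_const hexp.le).comp (continuous_const.sub (h1.div_const _))
    exact (h1.continuousOn.mul (continuousOn_const.sub ((continuousOn_arcsinP hp).div_const _))).add
      (continuousOn_const.mul ((continuousOn_arcsinP hp).sub (continuous_id.mul h2).continuousOn))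
  have hZd : ∀ y ∈ Ioo 0 M, HasDerivAt Z (p * y ^ (p - 1) * (1 - arcsinP p y / Q)) y := by
    intro y hy
    have hG := hasDerivAt_arcsinP hp hy
    have hpow : HasDerivAt (fun y : ℝ => y ^ p) (p * y ^ (p - 1)) y :=
      Real.hasDerivAt_rpow_const (Or.inl hy.1.ne')
    set q := 1 - y ^ p / (p - 1) with hq
    have hq0 : 0 < q := sub_pos.2 (rpow_div_lt_one hp ⟨hy.1.le, hy.2⟩)
    have hqd : HasDerivAt (fun y : ℝ => 1 - y ^ p / (p - 1)) (-(p * y ^ (p - 1) / (p - 1))) y :=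
      (hpow.div_const _).const_sub 1
    have hqr := hqd.rpow_const (p := 1 - 1 / p) (Or.inl hq0.ne')
    have hZ := (hpow.mul ((hG.div_const Q).const_sub 1)).add
      ((hG.sub ((hasDerivAt_id y).mul hqr)).const_mul ((p - 1) / (p * Q)))
    refine hZ.congr_deriv ?_
    have hr : arcsinDensity p y = q ^ (-(1 / p)) := by
      rw [arcsinDensity, Real.rpow_neg hq0.le, one_div]
    have e1 : q ^ (1 - 1 / p - 1) = q ^ (-(1 / p)) := by congr 1; ring
    have e2 : q ^ (1 - 1 / p) = q * q ^ (-(1 / p)) := by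
      rw [sub_eq_add_neg, Real.rpow_add hq0, Real.rpow_one]
    have e3 : y * y ^ (p - 1) = y ^ p := by
      rw [← Real.rpow_one_add' hy.1.le (by linarith)]; congr 1; ring
    simp only [id, hr, ← hq, e1, e2]
    rw [hq]
    set R := (1 - y ^ p / (p - 1)) ^ (-(1 / p))
    rw [← e3]
    field_simp
    ring
  have := intervalIntegral.integral_eq_sub_of_hasDerivAt_of_le hM.le hZc hZd hint
  rw [this]
  have hZM : Z M = (p - 1) / p := by
    simp only [Z, M]
    rw [sinPMax_rpow hp, arcsinP_sinPMax, ← hQ, div_self hp1.ne', sub_self,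
      Real.zero_rpow hexp.ne', div_self hQ0.ne']
    field_simp
    ring
  have hZ0 : Z 0 = 0 := by
    simp only [Z]
    rw [arcsinP_zero, Real.zero_rpow hp0.ne']
    ring
  rw [hZM, hZ0, sub_zero]

/-- Where `D > arcsinP p y` one has `g (D x) > y`, and `hdist` says that this set has measure at
least the fraction `1 - arcsinP p y/(π_p/2)` of the total. The layer-cake formula then reduces to
`integral_rpow_mul_one_sub_arcsinP`. -/
theorem le_lintegral_generalized_sine {X : Type*} [MeasurableSpace X] (μ : Measure X)
    [IsFiniteMeasure μ] (hp : 1 < p) {g : ℝ → ℝ} (hg : ∀ a, g a ∈ Icc 0 (sinPMax p))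
    (hgmono : Monotone g)
    (hglt : ∀ y ∈ Icc 0 (sinPMax p), ∀ a, y < sinPMax p → arcsinP p y < a → y < g a)
    {D : X → ℝ} (hD : Measurable D)
    (hdist : ∀ a > 0, μ {x | D x ≤ a} ≤ ENNReal.ofReal (μ.real univ * (a / (piP p / 2)))) :
    ENNReal.ofReal (μ.real univ * ((p - 1) / p)) ≤ ∫⁻ x, ENNReal.ofReal (g (D x) ^ p) ∂μ := by
  set L := μ.real univ
  set Q := piP p / 2 with hQ
  have hQ0 : 0 < Q := by have := piP_pos hp; positivity
  have hp0 : 0 < p := by linarith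
  have hM := sinPMax_pos hp
  obtain ⟨hint, heq⟩ := integral_rpow_mul_one_sub_arcsinP hp
  rw [lintegral_rpow_eq_lintegral_meas_lt_mul μ (ae_of_all _ fun x => (hg _).1)
    (hgmono.measurable.comp hD).aemeasurable hp0]
  have hkey : ∀ y ∈ Ioo 0 (sinPMax p), ENNReal.ofReal (L * (y ^ (p - 1) * (1 - arcsinP p y / Q))) ≤
      μ {x | y < g (D x)} * ENNReal.ofReal (y ^ (p - 1)) := by
    intro y hy
    have hyI : y ∈ Icc 0 (sinPMax p) := ⟨hy.1.le, hy.2.le⟩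
    have hGy : 0 < arcsinP p y := by
      rw [← arcsinP_zero p]
      exact strictMonoOn_arcsinP hp ⟨le_rfl, hM.le⟩ hyI hy.1
    have h1 : ENNReal.ofReal (L * (1 - arcsinP p y / Q)) ≤ μ {x | y < g (D x)} := by
      have h2 : μ univ ≤ μ {x | D x ≤ arcsinP p y} + μ {x | y < g (D x)} := by
        refine (measure_mono fun x _ => ?_).trans (measure_union_le _ _)
        rcases le_or_gt (D x) (arcsinP p y) with h | h
        · exact Or.inl h
        · exact Or.inr (hglt y hyI _ hy.2 h)
      have h3 := h2.trans (add_le_add_left (hdist _ hGy) _)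
      rw [← ofReal_measureReal (μ := μ) (s := univ)] at h3
      rw [mul_sub, mul_one, ENNReal.ofReal_sub _ (by positivity)]
      exact tsub_le_iff_left.2 h3
    calc _ = ENNReal.ofReal (L * (1 - arcsinP p y / Q)) * ENNReal.ofReal (y ^ (p - 1)) := by
          rw [← ENNReal.ofReal_mul' (Real.rpow_nonneg hy.1.le _)]; congr 1; ring
      _ ≤ _ := by gcongr
  have hL0 : 0 ≤ L := measureReal_nonneg
  have hint' := (intervalIntegrable_iff_integrableOn_Ioo_of_le hM.le).1 hint
  calc ENNReal.ofReal (L * ((p - 1) / p)) =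
        ENNReal.ofReal (∫ y in Ioo 0 (sinPMax p), L * (p * y ^ (p - 1) * (1 - arcsinP p y / Q))) := by
        rw [integral_const_mul, ← integral_Ioc_eq_integral_Ioo,
          ← intervalIntegral.integral_of_le hM.le, heq]
    _ = ∫⁻ y in Ioo 0 (sinPMax p),
          ENNReal.ofReal (L * (p * y ^ (p - 1) * (1 - arcsinP p y / Q))) := by
        refine ofReal_integral_eq_lintegral_ofReal (hint'.const_mul L) ?_
        refine (ae_restrict_iff' measurableSet_Ioo).2 (ae_of_all _ fun y hy => ?_)
        have h1 : arcsinP p y ≤ Q := by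
          rw [hQ, ← arcsinP_sinPMax]
          exact (strictMonoOn_arcsinP hp).monotoneOn ⟨hy.1.le, hy.2.le⟩ ⟨hM.le, le_rfl⟩ hy.2.le
        have h2 : 0 ≤ 1 - arcsinP p y / Q := sub_nonneg.2 ((div_le_one hQ0).2 h1)
        have := Real.rpow_nonneg hy.1.le (p - 1)
        positivity
    _ = ENNReal.ofReal p * ∫⁻ y in Ioo 0 (sinPMax p),
          ENNReal.ofReal (L * (y ^ (p - 1) * (1 - arcsinP p y / Q))) := by
        rw [← lintegral_const_mul' _ _ ENNReal.ofReal_ne_top]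
        refine lintegral_congr fun y => ?_
        rw [← ENNReal.ofReal_mul hp0.le]; congr 1; ring
    _ ≤ ENNReal.ofReal p * ∫⁻ y in Ioo 0 (sinPMax p),
          μ {x | y < g (D x)} * ENNReal.ofReal (y ^ (p - 1)) :=
        mul_le_mul_right (setLIntegral_mono' measurableSet_Ioo hkey) _
    _ ≤ _ := mul_le_mul_right (lintegral_mono_set Ioo_subset_Ioi_self) _

end Anisotropic
end


/-! ### Mollification, and the Rayleigh inequality for one-sidedly Lipschitz functions. -/

noncomputable section

namespace Anisotropic

section Mollify

variable {E : Type*} [NormedAddCommGroup E] [InnerProductSpace ℝ E] [FiniteDimensional ℝ E]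
  [MeasurableSpace E] [BorelSpace E] {f : E → ℝ} {C : ℝ}

/-- The convolution of `f` with a normalized bump function. -/
def mollify (ψ : ContDiffBump (0 : E)) (f : E → ℝ) (x : E) : ℝ :=
  ∫ t, ψ.normed volume t * f (x - t)

theorem mollify_eq_convolution (ψ : ContDiffBump (0 : E)) (f : E → ℝ) :
    mollify ψ f = convolution (ψ.normed volume) f (ContinuousLinearMap.lsmul ℝ ℝ) volume := rfl

theorem integrable_mollify (ψ : ContDiffBump (0 : E)) (hf : Measurable f)
    (hfC : ∀ x, f x ∈ Icc 0 C) (x : E) :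
    Integrable (fun t => ψ.normed volume t * f (x - t)) := by
  refine (ψ.integrable_normed (μ := volume)).mul_bdd (c := C) ?_ (ae_of_all _ fun t => ?_)
  · exact (hf.comp (measurable_const.sub measurable_id)).aestronglyMeasurable
  · rw [Real.norm_of_nonneg (hfC _).1]; exact (hfC _).2

theorem mollify_mem_Icc (ψ : ContDiffBump (0 : E)) (hf : Measurable f) (hfC : ∀ x, f x ∈ Icc 0 C)
    (x : E) : mollify ψ f x ∈ Icc 0 C := by
  constructor
  · exact integral_nonneg fun t => mul_nonneg (ψ.nonneg_normed t) (hfC _).1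
  · calc mollify ψ f x ≤ ∫ t, ψ.normed volume t * C :=
          integral_mono (integrable_mollify ψ hf hfC x)
            ((ψ.integrable_normed (μ := volume)).mul_const C)
            fun t => mul_le_mul_of_nonneg_left (hfC _).2 (ψ.nonneg_normed t)
      _ = C := by rw [integral_mul_const, ψ.integral_normed, one_mul]

theorem locallyIntegrable_of_mem_Icc (hf : Measurable f) (hfC : ∀ x, f x ∈ Icc 0 C) :
    LocallyIntegrable f (volume : Measure E) := by
  have h : LocallyIntegrable (fun _ : E => C) volume := locallyIntegrable_const C
  refine h.mono hf.aestronglyMeasurable (ae_of_all _ fun x => ?_)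
  rw [Real.norm_of_nonneg (hfC x).1]
  exact (hfC x).2.trans (le_abs_self C)

theorem contDiff_mollify (ψ : ContDiffBump (0 : E)) (hf : Measurable f)
    (hfC : ∀ x, f x ∈ Icc 0 C) : ContDiff ℝ ∞ (mollify ψ f) := by
  rw [mollify_eq_convolution]
  exact ψ.hasCompactSupport_normed.contDiff_convolution_left _ ψ.contDiff_normed
    (locallyIntegrable_of_mem_Icc hf hfC)

theorem mollify_sub_smul_le (ψ : ContDiffBump (0 : E)) (hf : Measurable f)
    (hfC : ∀ x, f x ∈ Icc 0 C) {K : E → ℝ} {C' : ℝ} (hK : Measurable K)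
    (hKC : ∀ x, K x ∈ Icc 0 C') {w : E} {s : ℝ} (hs : ∀ x, f (x - s • w) ≤ f x + s * K x) (x : E) :
    mollify ψ f (x - s • w) ≤ mollify ψ f x + s * mollify ψ K x := by
  have h1 := integrable_mollify ψ hf hfC x
  have h2 := (integrable_mollify ψ hK hKC x).const_mul s
  unfold mollify
  rw [← integral_const_mul, ← integral_add h1 h2]
  refine integral_mono (integrable_mollify ψ hf hfC _) (h1.add h2) fun t => ?_
  have h3 := mul_le_mul_of_nonneg_left (hs (x - t)) (ψ.nonneg_normed (μ := volume) t)
  have h4 : x - s • w - t = x - t - s • w := by abel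
  simp only [h4]
  linarith

/-- The one-sided increment bound is linear and translation invariant, so it survives convolution;
dividing by `s → 0` gives the derivative. No differentiability of `f` enters. -/
theorem neg_inner_gradient_mollify_le (ψ : ContDiffBump (0 : E)) (hf : Measurable f)
    (hfC : ∀ x, f x ∈ Icc 0 C) {K : E → ℝ} {C' : ℝ} (hK : Measurable K)
    (hKC : ∀ x, K x ∈ Icc 0 C') {w : E} (hw : ∀ x s, 0 ≤ s → f (x - s • w) ≤ f x + s * K x)
    (x : E) : inner ℝ w (-gradient (mollify ψ f) x) ≤ mollify ψ K x := by
  have hdiff : DifferentiableAt ℝ (mollify ψ f) x :=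
    (contDiff_mollify ψ hf hfC).differentiable (by simp) x
  have hd : HasDerivAt (fun s : ℝ => mollify ψ f (x - s • w))
      (inner ℝ (gradient (mollify ψ f) x) (-w)) 0 := by
    have h1 : HasFDerivAt (mollify ψ f) (InnerProductSpace.toDual ℝ _ (gradient (mollify ψ f) x))
        (x - (0 : ℝ) • w) := by
      simpa using hdiff.hasGradientAt.hasFDerivAt
    have h2 : HasDerivAt (fun s : ℝ => x - s • w) (-w) 0 := by
      simpa using ((hasDerivAt_id (0 : ℝ)).smul_const w).const_sub x
    exact h1.comp_hasDerivAt 0 h2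
  rw [inner_neg_right, real_inner_comm, ← inner_neg_right]
  refine le_of_tendsto hd.tendsto_slope_zero_right ?_
  filter_upwards [self_mem_nhdsWithin] with s hs
  have hs' : 0 < s := hs
  have h3 := mollify_sub_smul_le ψ hf hfC hK hKC (fun x => hw x s hs'.le) x
  simp only [zero_add, zero_smul, sub_zero, smul_eq_mul]
  rw [inv_mul_le_iff₀ hs']
  linarith

theorem tendsto_mollify {ψ : ℕ → ContDiffBump (0 : E)}
    (hψ : Tendsto (fun k => (ψ k).rOut) atTop (𝓝 0)) (hf : Measurable f) {x : E}
    (hx : ContinuousAt f x) : Tendsto (fun k => mollify (ψ k) f x) atTop (𝓝 (f x)) :=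
  ContDiffBump.convolution_tendsto_right (g := fun _ => f) hψ
    (Eventually.of_forall fun _ => hf.aestronglyMeasurable)
    (hx.tendsto.comp tendsto_snd) tendsto_const_nhds

end Mollify

variable {n : ℕ} {Ω : Set (EuclideanSpace ℝ (Fin n))}

theorem isTestFunction_mollify (hΩb : Bornology.IsBounded Ω)
    {f : EuclideanSpace ℝ (Fin n) → ℝ} {C : ℝ} (hf : Measurable f) (hfC : ∀ x, f x ∈ Icc 0 C)
    {r : ℝ} (hfr : ∀ x, f x ≠ 0 → ∀ y ∉ Ω, r ≤ ‖x - y‖)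
    {ψ : ContDiffBump (0 : EuclideanSpace ℝ (Fin n))} (hψ : 2 * ψ.rOut ≤ r) :
    IsTestFunction Ω (mollify ψ f) := by
  have hcl : IsClosed {x | ∀ y ∉ Ω, ψ.rOut ≤ ‖x - y‖} := by
    have : {x | ∀ y ∉ Ω, ψ.rOut ≤ ‖x - y‖} = ⋂ y ∈ Ωᶜ, {x | ψ.rOut ≤ ‖x - y‖} := by ext; simp
    rw [this]
    exact isClosed_biInter fun y _ => isClosed_le continuous_const (by fun_prop)
  have hsub : tsupport (mollify ψ f) ⊆ {x | ∀ y ∉ Ω, ψ.rOut ≤ ‖x - y‖} := by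
    refine closure_minimal (fun x hx y hy => ?_) hcl
    rw [mollify_eq_convolution] at hx
    obtain ⟨a, ha, b, hb, rfl⟩ := support_convolution_subset _ hx
    rw [ψ.support_normed_eq, mem_ball_zero_iff] at ha
    have h1 := hfr b hb y hy
    have h2 : ‖b - y‖ ≤ ‖a + b - y‖ + ‖a‖ := by
      have : b - y = (a + b - y) - a := by abel
      rw [this]; exact norm_sub_le _ _
    change ψ.rOut ≤ ‖a + b - y‖
    linarith
  have hΩ : tsupport (mollify ψ f) ⊆ Ω := fun x hx => by
    by_contra hxΩ
    have := hsub hx x hxΩ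
    rw [sub_self, norm_zero] at this
    exact absurd ψ.rOut_pos (not_lt.2 this)
  exact ⟨contDiff_mollify ψ hf hfC,
    Metric.isCompact_of_isClosed_isBounded (isClosed_tsupport _) (hΩb.subset hΩ), hΩ⟩

/-- A Rayleigh type inequality for test functions extends to functions with one-sided directional
Lipschitz bounds. -/
theorem rayleigh_le_of_directional_bound (hΩo : IsOpen Ω) (hΩb : Bornology.IsBounded Ω)
    {H : EuclideanSpace ℝ (Fin n) → ℝ} {α β : ℝ} (hH : IsSmoothNorm H α β) {p : ℝ} (hp : 1 < p)
    {lam : ℝ} (hlam : ∀ φ, IsTestFunction Ω φ →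
      lam * ∫ x in Ω, |φ x| ^ p ≤ ∫ x in Ω, H (gradient φ x) ^ p)
    {ι : Type*} {w : ι → EuclideanSpace ℝ (Fin n)} {A : ℝ} (hA : 0 ≤ A)
    (hw : ∀ ξ, ∃ i, H ξ ≤ A * inner ℝ (w i) ξ)
    {f K : EuclideanSpace ℝ (Fin n) → ℝ} {C C' : ℝ} (hf : Measurable f)
    (hfC : ∀ x, f x ∈ Icc 0 C) (hK : Measurable K) (hKC : ∀ x, K x ∈ Icc 0 C')
    (hfc : ContinuousOn f Ω) (hKc : ContinuousOn K Ω)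
    {r : ℝ} (hr : 0 < r) (hfr : ∀ x, f x ≠ 0 → ∀ y ∉ Ω, r ≤ ‖x - y‖)
    (hfK : ∀ i x s, 0 ≤ s → f (x - s • w i) ≤ f x + s * K x) :
    lam * ∫ x in Ω, f x ^ p ≤ A ^ p * ∫ x in Ω, K x ^ p := by
  have hp0 : 0 < p := by linarith
  have hΩm := hΩo.measurableSet
  have : IsFiniteMeasure (volume.restrict Ω) :=
    ⟨by rw [Measure.restrict_apply_univ]; exact hΩb.measure_lt_top⟩
  let ψ : ℕ → ContDiffBump (0 : EuclideanSpace ℝ (Fin n)) := fun k =>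
    { rIn := r / 2 / (k + 1) / 2
      rOut := r / 2 / (k + 1)
      rIn_pos := by positivity
      rIn_lt_rOut := half_lt_self (by positivity) }
  have hψ : Tendsto (fun k => (ψ k).rOut) atTop (𝓝 0) := by
    have := (tendsto_one_div_add_atTop_nhds_zero_nat (𝕜 := ℝ)).const_mul (r / 2)
    simpa [ψ, div_eq_mul_inv] using this
  have hψr : ∀ k, 2 * (ψ k).rOut ≤ r := fun k => by
    have : r / 2 / ((k : ℝ) + 1) ≤ r / 2 := div_le_self (by positivity) (by simp)
    change 2 * (r / 2 / ((k : ℝ) + 1)) ≤ r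
    linarith
  have hC : 0 ≤ C := (hfC 0).1.trans (hfC 0).2
  have hC' : 0 ≤ C' := (hKC 0).1.trans (hKC 0).2
  have hlim : ∀ {g : EuclideanSpace ℝ (Fin n) → ℝ} {D : ℝ}, Measurable g → (∀ x, g x ∈ Icc 0 D) →
      ContinuousOn g Ω → Tendsto (fun k => ∫ x in Ω, mollify (ψ k) g x ^ p) atTop
        (𝓝 (∫ x in Ω, g x ^ p)) := by
    intro g D hg hgD hgc
    refine tendsto_integral_of_dominated_convergence (fun _ => D ^ p) (fun k => ?_)
      (integrable_const _) (fun k => ae_of_all _ fun x => ?_) ?_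
    · exact ((contDiff_mollify (ψ k) hg hgD).continuous.rpow_const
        fun _ => Or.inr hp0.le).aestronglyMeasurable
    · have h1 := mollify_mem_Icc (ψ k) hg hgD x
      rw [Real.norm_of_nonneg (Real.rpow_nonneg h1.1 _)]
      exact Real.rpow_le_rpow h1.1 h1.2 hp0.le
    · refine (ae_restrict_iff' hΩm).2 (ae_of_all _ fun x hx => ?_)
      exact (tendsto_mollify hψ hg (hgc.continuousAt (hΩo.mem_nhds hx))).rpow_const
        (Or.inr hp0.le)
  have hk : ∀ k, lam * ∫ x in Ω, mollify (ψ k) f x ^ p ≤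
      A ^ p * ∫ x in Ω, mollify (ψ k) K x ^ p := by
    intro k
    have h1 := hlam _ (isTestFunction_mollify hΩb hf hfC hfr (hψr k))
    have h2 : ∀ x, |mollify (ψ k) f x| = mollify (ψ k) f x :=
      fun x => abs_of_nonneg (mollify_mem_Icc (ψ k) hf hfC x).1
    simp only [h2] at h1
    refine h1.trans ?_
    rw [← integral_const_mul]
    refine integral_mono_of_nonneg (ae_of_all _ fun x => Real.rpow_nonneg (hH.nonneg _) _) ?_
      (ae_of_all _ fun x => ?_)
    · refine Integrable.const_mul ?_ _
      refine Integrable.of_bound (C := C' ^ p) ((contDiff_mollify (ψ k) hK hKC).continuous.rpow_const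
        fun _ => Or.inr hp0.le).aestronglyMeasurable (ae_of_all _ fun x => ?_)
      have h1 := mollify_mem_Icc (ψ k) hK hKC x
      rw [Real.norm_of_nonneg (Real.rpow_nonneg h1.1 _)]
      exact Real.rpow_le_rpow h1.1 h1.2 hp0.le
    · have hK0 := (mollify_mem_Icc (ψ k) hK hKC x).1
      simp only
      rw [← Real.mul_rpow hA hK0]
      refine Real.rpow_le_rpow (hH.nonneg _) ?_ hp0.le
      obtain ⟨i, hi⟩ := hw (-gradient (mollify (ψ k) f) x)
      -- `H` is even, so upper bounds on `⟪w i, -∇⟫` alone control `H` of the gradient.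
      rw [hH.apply_neg] at hi
      exact hi.trans (mul_le_mul_of_nonneg_left
        (neg_inner_gradient_mollify_le (ψ k) hf hfC hK hKC (hfK i) x) hA)
  exact le_of_tendsto_of_tendsto' ((hlim hf hfC hfc).const_mul _) ((hlim hK hKC hKc).const_mul _) hk

end Anisotropic
end


/-! ### The Rayleigh quotient of the sine of the distance. -/

noncomputable section

namespace Anisotropic

variable {n : ℕ} {Ω : Set (EuclideanSpace ℝ (Fin n))}

theorem measurable_polyDist {ι : Type*} [Finite ι] [Nonempty ι]
    {w : ι → EuclideanSpace ℝ (Fin n)} (hΩo : IsOpen Ω) (hΩc : Convex ℝ Ω)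
    (hΩb : Bornology.IsBounded Ω) (hw : ∀ i, w i ≠ 0) : Measurable (polyDist Ω w) := by
  refine measurable_of_Ioi fun t => ?_
  rcases lt_or_ge t 0 with ht | ht
  · have : polyDist Ω w ⁻¹' Ioi t = univ :=
      eq_univ_of_forall fun x => ht.trans_le (polyDist_nonneg w x)
    rw [this]; exact MeasurableSet.univ
  · have : polyDist Ω w ⁻¹' Ioi t = Ω ∩ ⋂ i, (fun x => x + t • w i) ⁻¹' Ω := by
      ext x
      simp only [mem_preimage, mem_Ioi, lt_polyDist_iff hΩo hΩc hΩb hw ht, mem_inter_iff,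
        mem_iInter]
    rw [this]
    exact (hΩo.inter (isOpen_iInter_of_finite fun i => hΩo.preimage (by fun_prop))).measurableSet

/-- The trial function is `u = g (κ d)`, with `K = κ (1 - u^p/(p-1))^(1/p)` in the role of the norm
of its gradient. The choice of `κ` turns `hvol` into the distribution bound required by
`le_lintegral_generalized_sine`. -/
theorem rayleigh_le_of_polyDist (hΩo : IsOpen Ω) (hΩc : Convex ℝ Ω) (hΩb : Bornology.IsBounded Ω)
    (hΩne : Ω.Nonempty) {H : EuclideanSpace ℝ (Fin n) → ℝ} {α β : ℝ} (hH : IsSmoothNorm H α β)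
    {p : ℝ} (hp : 1 < p) {lam : ℝ} (hlam : ∀ φ, IsTestFunction Ω φ →
      lam * ∫ x in Ω, |φ x| ^ p ≤ ∫ x in Ω, H (gradient φ x) ^ p)
    {ι : Type*} [Finite ι] [Nonempty ι] {w : ι → EuclideanSpace ℝ (Fin n)} {A : ℝ} (hA : 0 < A)
    (hw0 : ∀ i, w i ≠ 0) (hw : ∀ ξ, ∃ i, H ξ ≤ A * inner ℝ (w i) ξ) {P : ℝ} (hP : 0 < P)
    (hvol : ∀ t > 0, volume {x ∈ Ω | polyDist Ω w x ≤ t} ≤ ENNReal.ofReal (t * P)) :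
    lam ≤ (A * (P * (piP p / 2) / volume.real Ω)) ^ p := by
  have hp0 : 0 < p := by linarith
  have hp1 : 0 < p - 1 := by linarith
  have hΩm := hΩo.measurableSet
  have hΩfin : volume Ω < ⊤ := hΩb.measure_lt_top
  have : IsFiniteMeasure (volume.restrict Ω) := ⟨by rwa [Measure.restrict_apply_univ]⟩
  set L := volume.real Ω with hL
  have hL0 : 0 < L := ENNReal.toReal_pos (hΩo.measure_pos volume hΩne).ne' hΩfin.ne
  set Q := piP p / 2 with hQ
  have hQ0 : 0 < Q := by have := piP_pos hp; positivity
  set κ := P * Q / L with hκ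
  have hκ0 : 0 < κ := by positivity
  obtain ⟨g, hgM, hgmono, hg0, hgs, hglt⟩ := exists_generalized_sine hp
  have hq0 : ∀ a, 0 ≤ 1 - g a ^ p / (p - 1) := fun a => sub_nonneg.2 (rpow_div_le_one hp (hgM a))
  have hq1 : ∀ a, 1 - g a ^ p / (p - 1) ≤ 1 := fun a => by
    have := div_nonneg (Real.rpow_nonneg (hgM a).1 p) hp1.le
    linarith
  have hqp0 : ∀ a, 0 ≤ (1 - g a ^ p / (p - 1)) ^ (1 / p) := fun a => Real.rpow_nonneg (hq0 a) _
  have hqp1 : ∀ a, (1 - g a ^ p / (p - 1)) ^ (1 / p) ≤ 1 := fun a =>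
    Real.rpow_le_one (hq0 a) (hq1 a) (by positivity)
  have hgLip : ∀ a s, 0 ≤ a → 0 ≤ s → g (a + s) ≤ g a + s := fun a s ha hs =>
    (hgs a s ha hs).trans (by nlinarith [mul_le_of_le_one_right hs (hqp1 a)])
  have hgc : ContinuousOn g (Ici 0) := by
    refine (LipschitzOnWith.of_dist_le_mul (K := 1) fun a ha b hb => ?_).continuousOn
    rw [NNReal.coe_one, one_mul]
    have key : ∀ a b : ℝ, 0 ≤ a → a ≤ b → dist (g a) (g b) ≤ dist a b := by
      intro a b ha hab
      have h1 := hgLip a (b - a) ha (sub_nonneg.2 hab)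
      rw [add_sub_cancel] at h1
      rw [dist_comm, dist_comm a, Real.dist_eq, Real.dist_eq, abs_of_nonneg (sub_nonneg.2 hab),
        abs_of_nonneg (sub_nonneg.2 (hgmono hab))]
      linarith
    rcases le_total a b with h | h
    · exact key a b ha h
    · rw [dist_comm, dist_comm a]; exact key b a hb h
  set d := polyDist Ω w
  have hd0 : ∀ x, 0 ≤ d x := polyDist_nonneg w
  have hdm : Measurable d := measurable_polyDist hΩo hΩc hΩb hw0
  have hdc : ContinuousOn d Ω := (concaveOn_polyDist hΩo hΩc hΩb hw0).continuousOn hΩo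
  let u : EuclideanSpace ℝ (Fin n) → ℝ := fun x => g (κ * d x)
  have hu0 : ∀ x, 0 ≤ u x := fun x => (hgM _).1
  have hum : Measurable u := hgmono.measurable.comp (hdm.const_mul κ)
  have huc : ContinuousOn u Ω := hgc.comp (continuousOn_const.mul hdc)
    fun x _ => mul_nonneg hκ0.le (hd0 x)
  let K : EuclideanSpace ℝ (Fin n) → ℝ := fun x => κ * (1 - u x ^ p / (p - 1)) ^ (1 / p)
  have hKm : Measurable K := by fun_prop
  have hKc : ContinuousOn K Ω := by
    refine continuousOn_const.mul (ContinuousOn.rpow_const ?_ fun x _ => Or.inr (by positivity))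
    exact continuousOn_const.sub ((huc.rpow_const fun x _ => Or.inr hp0.le).div_const _)
  have hKC : ∀ x, K x ∈ Icc 0 κ := fun x =>
    ⟨mul_nonneg hκ0.le (hqp0 _), mul_le_of_le_one_right hκ0.le (hqp1 _)⟩
  have huK : ∀ i x s, 0 ≤ s → u (x - s • w i) ≤ u x + s * K x := by
    intro i x s hs
    have h1 : κ * d (x - s • w i) ≤ κ * d x + κ * s := by
      rw [← mul_add]
      exact mul_le_mul_of_nonneg_left (polyDist_sub_smul_le hΩo hΩc hΩb hw0 x hs i) hκ0.le
    refine (hgmono h1).trans ((hgs _ _ (mul_nonneg hκ0.le (hd0 x)) (by positivity)).trans ?_)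
    simp only [u, K]
    rw [mul_left_comm, ← mul_assoc]
  set c := α / A with hc
  have hc0 : 0 < c := div_pos hH.pos hA
  have hwc : ∀ v, ∃ i, c * ‖v‖ ≤ inner ℝ (w i) v := fun v => by
    obtain ⟨i, hi⟩ := hw v
    refine ⟨i, ?_⟩
    rw [hc, div_mul_eq_mul_div, div_le_iff₀ hA, mul_comm _ A]
    exact (hH.lower v).trans hi
  -- Truncation moves the support away from the complement of `Ω`, as mollification requires, and
  -- keeps the bound by `K`. Since `u ≤ κ d`, the set `{u > δ}` lies in `{d ≥ δ/κ}`.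
  have hδ : ∀ δ > 0, lam * ∫ x in Ω, max (u x - δ) 0 ^ p ≤ A ^ p * ∫ x in Ω, K x ^ p := by
    intro δ hδ
    refine rayleigh_le_of_directional_bound hΩo hΩb hH hp hlam hA.le hw (C := sinPMax p)
      (by fun_prop) (fun x => ⟨le_max_right _ _, max_le ?_ (sinPMax_pos hp).le⟩) hKm hKC
      ((huc.sub continuousOn_const).sup continuousOn_const) hKc (r := c * (δ / κ)) (by positivity)
      (fun x hx y hy => ?_) fun i x s hs => ?_
    · linarith [(hgM (κ * d x)).2]
    · have h1 : δ < u x := by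
        by_contra! hcon
        exact hx (max_eq_right (by linarith))
      have h2 : u x ≤ κ * d x := by
        have := hgLip 0 (κ * d x) le_rfl (mul_nonneg hκ0.le (hd0 x))
        rwa [zero_add, hg0, zero_add] at this
      have h3 := polyDist_le_norm_sub hΩo hΩc hΩb hw0 hc0 hwc x hy
      rw [le_div_iff₀ hc0] at h3
      have h4 : δ / κ ≤ d x := by rw [div_le_iff₀ hκ0]; linarith
      calc c * (δ / κ) ≤ c * d x := by gcongr
        _ ≤ _ := by rw [mul_comm]; exact h3
    · have h1 := huK i x s hs
      have h2 : 0 ≤ s * K x := mul_nonneg hs (hKC x).1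
      refine max_le ?_ (by linarith [le_max_right (u x - δ) 0])
      linarith [le_max_left (u x - δ) 0]
  have hmain : lam * ∫ x in Ω, u x ^ p ≤ A ^ p * ∫ x in Ω, K x ^ p := by
    have hlim : Tendsto (fun k : ℕ => ∫ x in Ω, max (u x - 1 / ((k : ℝ) + 1)) 0 ^ p) atTop
        (𝓝 (∫ x in Ω, u x ^ p)) := by
      refine tendsto_integral_of_dominated_convergence (fun _ => sinPMax p ^ p) (fun k => ?_)
        (integrable_const _) (fun k => ae_of_all _ fun x => ?_) (ae_of_all _ fun x => ?_)
      · exact Measurable.aestronglyMeasurable (by fun_prop)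
      · rw [Real.norm_of_nonneg (Real.rpow_nonneg (le_max_right _ _) _)]
        refine Real.rpow_le_rpow (le_max_right _ _) (max_le ?_ (sinPMax_pos hp).le) hp0.le
        have : 0 ≤ 1 / ((k : ℝ) + 1) := by positivity
        linarith [(hgM (κ * d x)).2]
      · have h1 : Tendsto (fun k : ℕ => max (u x - 1 / ((k : ℝ) + 1)) 0) atTop (𝓝 (u x)) := by
          have := (tendsto_const_nhds (x := u x)).sub
            (tendsto_one_div_add_atTop_nhds_zero_nat (𝕜 := ℝ))
          have := this.max (tendsto_const_nhds (x := (0 : ℝ)))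
          rwa [sub_zero, max_eq_left (hu0 x)] at this
        exact h1.rpow_const (Or.inr hp0.le)
    exact le_of_tendsto' (hlim.const_mul lam) fun k => hδ _ (by positivity)
  have huint : Integrable (fun x => u x ^ p) (volume.restrict Ω) := by
    refine Integrable.of_bound (C := sinPMax p ^ p) (Measurable.aestronglyMeasurable (by fun_prop))
      (ae_of_all _ fun x => ?_)
    rw [Real.norm_of_nonneg (Real.rpow_nonneg (hu0 x) _)]
    exact Real.rpow_le_rpow (hu0 x) (hgM _).2 hp0.le
  set I := ∫ x in Ω, u x ^ p with hI
  have hIle : L * ((p - 1) / p) ≤ I := by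
    have h1 := le_lintegral_generalized_sine (volume.restrict Ω) hp hgM hgmono hglt
      (hdm.const_mul κ) (fun a ha => by
        rw [Measure.restrict_apply (measurableSet_le (hdm.const_mul κ) measurable_const)]
        have h2 := hvol (a / κ) (by positivity)
        have h3 : {x | κ * d x ≤ a} ∩ Ω = {x ∈ Ω | d x ≤ a / κ} := by
          ext x
          simp only [mem_inter_iff, mem_ofPred_eq]
          rw [le_div_iff₀ hκ0, mul_comm, and_comm]
        rw [h3]
        refine h2.trans (ENNReal.ofReal_le_ofReal (le_of_eq ?_))
        rw [measureReal_restrict_apply_univ, hκ, ← hL, ← hQ]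
        field_simp)
    rw [measureReal_restrict_apply_univ, ← ofReal_integral_eq_lintegral_ofReal huint
      (ae_of_all _ fun x => Real.rpow_nonneg (hu0 x) _)] at h1
    have hI0 : 0 ≤ I := integral_nonneg fun x => Real.rpow_nonneg (hu0 x) _
    exact (ENNReal.ofReal_le_ofReal_iff hI0).1 h1
  have hI0 : 0 < I := lt_of_lt_of_le (by positivity) hIle
  -- The left side is `κ^p (L - I/(p-1))`, and `L ≤ I p/(p-1) = I + I/(p-1)` by `hIle`.
  have hKI : ∫ x in Ω, K x ^ p ≤ κ ^ p * I := by
    have h1 : ∀ x, K x ^ p = κ ^ p * (1 - u x ^ p / (p - 1)) := fun x => by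
      simp only [K]
      rw [Real.mul_rpow hκ0.le (hqp0 _), ← Real.rpow_mul (hq0 _), one_div,
        inv_mul_cancel₀ hp0.ne', Real.rpow_one]
    simp only [h1]
    rw [integral_const_mul, integral_sub (integrable_const _) (huint.div_const _),
      integral_div, integral_const, measureReal_restrict_apply_univ, smul_eq_mul, mul_one]
    refine mul_le_mul_of_nonneg_left ?_ (Real.rpow_nonneg hκ0.le _)
    rw [mul_div_assoc', div_le_iff₀ hp0] at hIle
    rw [sub_le_iff_le_add, ← hI, ← hL]
    have : I + I / (p - 1) = I * p / (p - 1) := by field_simp; ring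
    rw [this, le_div_iff₀ hp1]
    exact hIle
  rw [Real.mul_rpow hA.le hκ0.le]
  refine le_of_mul_le_mul_right (hmain.trans ?_) hI0
  rw [mul_assoc]
  exact mul_le_mul_of_nonneg_left hKI (Real.rpow_nonneg hA.le _)

/-- The polyhedral bounds with constant `(1+ε)^2` pass to the limit `ε → 0`. Finiteness of the
perimeter makes `boundaryMeasure` finite, so that ties can be avoided. -/
theorem rayleigh_le_perimeter (hn : 1 ≤ n) (hΩo : IsOpen Ω) (hΩc : Convex ℝ Ω)
    (hΩb : Bornology.IsBounded Ω) (hΩne : Ω.Nonempty) {H : EuclideanSpace ℝ (Fin n) → ℝ} {α β : ℝ}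
    (hH : IsSmoothNorm H α β) {p : ℝ} (hp : 1 < p) {lam : ℝ} (hlam : ∀ φ, IsTestFunction Ω φ →
      lam * ∫ x in Ω, |φ x| ^ p ≤ ∫ x in Ω, H (gradient φ x) ^ p)
    {P : ℝ} (hP : 0 < P) (hper : anisotropicPerimeter H Ω ≤ ENNReal.ofReal P) :
    lam ≤ (P * (piP p / 2) / volume.real Ω) ^ p := by
  have : IsFiniteMeasure (boundaryMeasure H Ω) :=
    ⟨(boundaryMeasure_le H univ).trans_lt (hper.trans_lt ENNReal.ofReal_lt_top)⟩
  have hε : ∀ ε > 0, lam ≤ ((1 + ε) ^ 2 * (P * (piP p / 2) / volume.real Ω)) ^ p := by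
    intro ε hε
    obtain ⟨k, w, hw0, hwH, hw, hties⟩ := hH.exists_polyhedral_approx hn hε (boundaryMeasure H Ω)
      (measurable_indicator_outerNormal hΩo hΩc hΩne hΩb)
    refine rayleigh_le_of_polyDist hΩo hΩc hΩb hΩne hH hp hlam (by positivity) hw0 hw hP
      fun t ht => ?_
    have hA : 0 < (1 + ε) ^ 2 := by positivity
    refine (volume_polyDist_le hΩo hΩc hΩb hΩne hwH (c := α / (1 + ε) ^ 2) (div_pos hH.pos hA)
      (fun v => ?_) hw0 hties ht).trans ?_
    · obtain ⟨i, hi⟩ := hw v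
      refine ⟨i, ?_⟩
      rw [div_mul_eq_mul_div, div_le_iff₀ hA, mul_comm _ ((1 + ε) ^ 2)]
      exact (hH.lower v).trans hi
    · rw [ENNReal.ofReal_mul ht.le]
      exact mul_le_mul_right hper _
  have hlim : Tendsto (fun ε : ℝ => ((1 + ε) ^ 2 * (P * (piP p / 2) / volume.real Ω)) ^ p) (𝓝[>] 0)
      (𝓝 ((P * (piP p / 2) / volume.real Ω) ^ p)) := by
    have hc : Continuous fun ε : ℝ => ((1 + ε) ^ 2 * (P * (piP p / 2) / volume.real Ω)) ^ p :=
      Continuous.rpow_const (by fun_prop) fun _ => Or.inr (by linarith)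
    have := hc.tendsto 0
    simp only [add_zero, one_pow, one_mul] at this
    exact this.mono_left nhdsWithin_le_nhds
  exact ge_of_tendsto hlim (by filter_upwards [self_mem_nhdsWithin] with ε h using hε ε h)

end Anisotropic
end


/-! ### Translation and averaging estimates in `L^p`. -/

noncomputable section

namespace Anisotropic

theorem enorm_integral_rpow_le {X : Type*} [MeasurableSpace X] {ν : Measure X}
    [IsProbabilityMeasure ν] {f : X → ℝ} (hf : AEStronglyMeasurable f ν) {p : ℝ} (hp : 1 ≤ p) :
    ‖∫ x, f x ∂ν‖ₑ ^ p ≤ ∫⁻ x, ‖f x‖ₑ ^ p ∂ν := by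
  have hp0 : 0 < p := by linarith
  have h1 := eLpNorm'_le_eLpNorm'_of_exponent_le (μ := ν) one_pos hp hf
  simp only [eLpNorm', ENNReal.rpow_one, div_one] at h1
  calc ‖∫ x, f x ∂ν‖ₑ ^ p ≤ ((∫⁻ x, ‖f x‖ₑ ^ p ∂ν) ^ (1 / p)) ^ p := by
        gcongr
        exact (enorm_integral_le_lintegral_enorm f).trans h1
    _ = _ := by rw [← ENNReal.rpow_mul, one_div, inv_mul_cancel₀ hp0.ne', ENNReal.rpow_one]

variable {E : Type*} [NormedAddCommGroup E] [InnerProductSpace ℝ E] [FiniteDimensional ℝ E]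
  [MeasurableSpace E] [BorelSpace E]

theorem continuous_gradient {E : Type*} [NormedAddCommGroup E] [InnerProductSpace ℝ E]
    [CompleteSpace E] {φ : E → ℝ} (hφ : ContDiff ℝ 1 φ) : Continuous (gradient φ) :=
  (LinearIsometryEquiv.continuous _).comp (hφ.continuous_fderiv one_ne_zero)

/-- The increment is the mean of the derivative along the segment; Jensen, Fubini and translation
invariance conclude. -/
theorem lintegral_translate_sub_rpow_le {φ : E → ℝ} (hφ : ContDiff ℝ 1 φ) {p : ℝ} (hp : 1 ≤ p)
    (z : E) : ∫⁻ x, ‖φ (x + z) - φ x‖ₑ ^ p ≤ ‖z‖ₑ ^ p * ∫⁻ x, ‖gradient φ x‖ₑ ^ p := by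
  have hp0 : 0 ≤ p := by linarith
  have hg := continuous_gradient hφ
  have : IsProbabilityMeasure (volume.restrict (Ioc (0 : ℝ) 1)) := ⟨by simp⟩
  have hpt : ∀ x, ‖φ (x + z) - φ x‖ₑ ^ p ≤
      ∫⁻ s in Ioc (0 : ℝ) 1, ‖z‖ₑ ^ p * ‖gradient φ (x + s • z)‖ₑ ^ p := by
    intro x
    have hd : ∀ s : ℝ, HasDerivAt (fun s : ℝ => φ (x + s • z))
        (inner ℝ (gradient φ (x + s • z)) z) s := by
      intro s
      have h1 := ((hφ.differentiable one_ne_zero) (x + s • z)).hasGradientAt.hasFDerivAt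
      have h2 : HasDerivAt (fun s : ℝ => x + s • z) z s := by
        simpa using ((hasDerivAt_id s).smul_const z).const_add x
      exact h1.comp_hasDerivAt s h2
    have hcont : Continuous fun s : ℝ => inner ℝ (gradient φ (x + s • z)) z := by fun_prop
    have hftc := intervalIntegral.integral_eq_sub_of_hasDerivAt (a := 0) (b := 1)
      (fun s _ => hd s) (hcont.intervalIntegrable 0 1)
    rw [one_smul, zero_smul, add_zero, intervalIntegral.integral_of_le zero_le_one] at hftc
    rw [← hftc]
    refine (enorm_integral_rpow_le hcont.aestronglyMeasurable hp).trans ?_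
    refine lintegral_mono fun s => ?_
    rw [← ENNReal.mul_rpow_of_nonneg _ _ hp0, mul_comm]
    gcongr
    rw [← ofReal_norm, ← ofReal_norm, ← ofReal_norm, ← ENNReal.ofReal_mul (norm_nonneg _)]
    exact ENNReal.ofReal_le_ofReal (norm_inner_le_norm _ _)
  calc ∫⁻ x, ‖φ (x + z) - φ x‖ₑ ^ p
      ≤ ∫⁻ x, ∫⁻ s in Ioc (0 : ℝ) 1, ‖z‖ₑ ^ p * ‖gradient φ (x + s • z)‖ₑ ^ p :=
        lintegral_mono hpt
    _ = ∫⁻ s in Ioc (0 : ℝ) 1, ∫⁻ x, ‖z‖ₑ ^ p * ‖gradient φ (x + s • z)‖ₑ ^ p := by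
        refine lintegral_lintegral_swap (Measurable.aemeasurable ?_)
        have : Continuous fun q : E × ℝ => gradient φ (q.1 + q.2 • z) := by fun_prop
        exact (this.measurable.enorm.pow_const p).const_mul _
    _ = ∫⁻ s in Ioc (0 : ℝ) 1, ‖z‖ₑ ^ p * ∫⁻ x, ‖gradient φ x‖ₑ ^ p := by
        refine lintegral_congr fun s => ?_
        rw [lintegral_const_mul _ (Continuous.measurable (by fun_prop) |>.enorm.pow_const p),
          lintegral_add_right_eq_self (fun x => ‖gradient φ x‖ₑ ^ p) (s • z)]
    _ = _ := by simp

/-- The centre may depend on `x`: the ball about `c x` is contained in that of radius `2r` about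
`x`, and the power of `2` is the ratio of their volumes. Letting `c` take finitely many values makes
the averages finitely many numbers. -/
theorem lintegral_sub_average_rpow_le {φ : E → ℝ} (hφ : ContDiff ℝ 1 φ) {p : ℝ} (hp : 1 ≤ p)
    {r : ℝ} (hr : 0 < r) {s : Set E} {c : E → E} (hc : ∀ x ∈ s, x ∈ Metric.ball (c x) r)
    (hs : MeasurableSet s) :
    ∫⁻ x in s, ‖φ x - ⨍ y in Metric.ball (c x) r, φ y‖ₑ ^ p ≤
      2 ^ Module.finrank ℝ E * (ENNReal.ofReal (2 * r) ^ p * ∫⁻ x, ‖gradient φ x‖ₑ ^ p) := by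
  have hp0 : 0 ≤ p := by linarith
  set V : ℝ≥0∞ := volume (Metric.ball (0 : E) r) with hV
  have hV0 : V ≠ 0 := (Metric.measure_ball_pos volume _ hr).ne'
  have hVt : V ≠ ⊤ := measure_ball_lt_top.ne
  have hball : ∀ y : E, volume (Metric.ball y r) = V := fun y =>
    Measure.addHaar_ball_center _ y r
  have hpt : ∀ x ∈ s, ‖φ x - ⨍ y in Metric.ball (c x) r, φ y‖ₑ ^ p ≤
      V⁻¹ * ∫⁻ z in Metric.ball (0 : E) (2 * r), ‖φ (x + z) - φ x‖ₑ ^ p := by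
    intro x hx
    have hprob : IsProbabilityMeasure (V⁻¹ • volume.restrict (Metric.ball (c x) r)) :=
      ⟨by simp [hball, ENNReal.inv_mul_cancel hV0 hVt]⟩
    have hint : Integrable φ (V⁻¹ • volume.restrict (Metric.ball (c x) r)) := by
      refine Integrable.smul_measure ?_ (ENNReal.inv_ne_top.2 hV0)
      exact (hφ.continuous.continuousOn.integrableOn_compact (isCompact_closedBall (c x) r)).mono_set
        Metric.ball_subset_closedBall
    have h1 : φ x - ⨍ y in Metric.ball (c x) r, φ y =
        ∫ y, (φ x - φ y) ∂(V⁻¹ • volume.restrict (Metric.ball (c x) r)) := by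
      rw [integral_sub (integrable_const _) hint, integral_const, probReal_univ, one_smul,
        average, Measure.restrict_apply_univ, hball]
    rw [h1]
    refine (enorm_integral_rpow_le (continuous_const.sub hφ.continuous).aestronglyMeasurable
      hp).trans ?_
    rw [lintegral_smul_measure, smul_eq_mul]
    refine mul_le_mul_right ?_ _
    have h2 : ∫⁻ z in Metric.ball (0 : E) (2 * r), ‖φ (x + z) - φ x‖ₑ ^ p =
        ∫⁻ y in Metric.ball x (2 * r), ‖φ y - φ x‖ₑ ^ p := by
      rw [← lintegral_indicator Metric.isOpen_ball.measurableSet,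
        ← lintegral_indicator Metric.isOpen_ball.measurableSet,
        ← lintegral_add_left_eq_self ((Metric.ball x (2 * r)).indicator _) x]
      refine lintegral_congr fun z => ?_
      simp [indicator]
    rw [h2]
    have h4 : ∀ y, ‖φ x - φ y‖ₑ = ‖φ y - φ x‖ₑ := fun y => enorm_sub_rev _ _
    change ∫⁻ y in Metric.ball (c x) r, ‖φ x - φ y‖ₑ ^ p ≤ _
    simp only [h4]
    refine lintegral_mono_set fun y hy => ?_
    have h3 := hc x hx
    rw [Metric.mem_ball] at hy h3 ⊢
    linarith [dist_triangle_right y x (c x)]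
  have h2r : volume (Metric.ball (0 : E) (2 * r)) = 2 ^ Module.finrank ℝ E * V := by
    rw [Measure.addHaar_ball_mul_of_pos volume (0 : E) two_pos, ENNReal.ofReal_pow zero_le_two]
    simp [hV]
  calc ∫⁻ x in s, ‖φ x - ⨍ y in Metric.ball (c x) r, φ y‖ₑ ^ p
      ≤ ∫⁻ x in s, V⁻¹ * ∫⁻ z in Metric.ball (0 : E) (2 * r), ‖φ (x + z) - φ x‖ₑ ^ p :=
        setLIntegral_mono' hs hpt
    _ ≤ ∫⁻ x, V⁻¹ * ∫⁻ z in Metric.ball (0 : E) (2 * r), ‖φ (x + z) - φ x‖ₑ ^ p :=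
        setLIntegral_le_lintegral _ _
    _ = V⁻¹ * ∫⁻ z in Metric.ball (0 : E) (2 * r), ∫⁻ x, ‖φ (x + z) - φ x‖ₑ ^ p := by
        rw [lintegral_const_mul' _ _ (ENNReal.inv_ne_top.2 hV0), lintegral_lintegral_swap]
        have : Continuous fun q : E × E => φ (q.1 + q.2) - φ q.1 := by
          have := hφ.continuous
          fun_prop
        exact (this.measurable.enorm.pow_const p).aemeasurable
    _ ≤ V⁻¹ * ∫⁻ z in Metric.ball (0 : E) (2 * r),
          ENNReal.ofReal (2 * r) ^ p * ∫⁻ x, ‖gradient φ x‖ₑ ^ p := by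
        refine mul_le_mul_right (setLIntegral_mono' Metric.isOpen_ball.measurableSet
          fun z hz => (lintegral_translate_sub_rpow_le hφ hp z).trans ?_) _
        gcongr
        rw [← ofReal_norm]
        exact ENNReal.ofReal_le_ofReal (mem_ball_zero_iff.1 hz).le
    _ = _ := by
        rw [setLIntegral_const, h2r, mul_comm, mul_assoc, mul_assoc (2 ^ _),
          ENNReal.mul_inv_cancel hV0 hVt, mul_one, mul_comm]

end Anisotropic
end


/-! ### Compactness in `L^p` of sequences with bounded gradients. -/

noncomputable section

namespace Anisotropic

theorem eLpNorm_ofReal_eq {X F : Type*} [MeasurableSpace X] [NormedAddCommGroup F] (f : X → F)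
    (μ : Measure X) {p : ℝ} (hp : 0 < p) :
    eLpNorm f (ENNReal.ofReal p) μ = (∫⁻ x, ‖f x‖ₑ ^ p ∂μ) ^ (1 / p) := by
  rw [eLpNorm_eq_lintegral_rpow_enorm_toReal (by simpa using hp) ENNReal.ofReal_ne_top,
    ENNReal.toReal_ofReal hp.le]

section Compactness

variable {E : Type*} [NormedAddCommGroup E] [InnerProductSpace ℝ E] [FiniteDimensional ℝ E]
  [MeasurableSpace E] [BorelSpace E]

theorem exists_simpleFunc_near {K : Set E} (hK : Bornology.IsBounded K) {r : ℝ} (hr : 0 < r) :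
    ∃ c : SimpleFunc E E, ∀ x ∈ K, x ∈ Metric.ball (c x) r := by
  let e := TopologicalSpace.denseSeq E
  obtain ⟨t, ht⟩ := hK.isCompact_closure.elim_finite_subcover (fun k => Metric.ball (e k) r)
    (fun _ => Metric.isOpen_ball) fun x _ => by
      obtain ⟨k, hk⟩ := (TopologicalSpace.denseRange_denseSeq E).exists_dist_lt x hr
      exact mem_iUnion.2 ⟨k, hk⟩
  refine ⟨SimpleFunc.nearestPt e (t.sup id), fun x hx => ?_⟩
  obtain ⟨k, hk, hxk⟩ := mem_iUnion₂.1 (ht (subset_closure hx))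
  have h1 := SimpleFunc.edist_nearestPt_le e x (Finset.le_sup (f := id) hk)
  rw [Metric.mem_ball, ← edist_lt_ofReal] at hxk ⊢
  rw [edist_comm] at hxk ⊢
  exact h1.trans_lt hxk

theorem abs_average_ball_le {φ : E → ℝ} (hφ : Continuous φ) {p : ℝ} (hp : 1 ≤ p)
    {C : ℝ≥0∞} (hC : C ≠ ⊤) (hb : ∫⁻ x, ‖φ x‖ₑ ^ p ≤ C) {r : ℝ} (hr : 0 < r) (y : E) :
    |⨍ x in Metric.ball y r, φ x| ≤ (((volume (Metric.ball (0 : E) r))⁻¹ * C) ^ (1 / p)).toReal := by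
  have hp0 : 0 < p := by linarith
  set V : ℝ≥0∞ := volume (Metric.ball (0 : E) r) with hV
  have hV0 : V ≠ 0 := (Metric.measure_ball_pos volume _ hr).ne'
  have hVt : V ≠ ⊤ := measure_ball_lt_top.ne
  have hball : volume (Metric.ball y r) = V := Measure.addHaar_ball_center _ y r
  have : IsProbabilityMeasure (V⁻¹ • volume.restrict (Metric.ball y r)) :=
    ⟨by simp [hball, ENNReal.inv_mul_cancel hV0 hVt]⟩
  have h1 := enorm_integral_rpow_le (ν := V⁻¹ • volume.restrict (Metric.ball y r))
    hφ.aestronglyMeasurable hp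
  rw [lintegral_smul_measure, smul_eq_mul] at h1
  have h2 : ‖⨍ x in Metric.ball y r, φ x‖ₑ ^ p ≤ V⁻¹ * C := by
    rw [average, Measure.restrict_apply_univ, hball]
    exact h1.trans (mul_le_mul_right ((setLIntegral_le_lintegral _ _).trans hb) _)
  have h3 : ‖⨍ x in Metric.ball y r, φ x‖ₑ ≤ (V⁻¹ * C) ^ (1 / p) := by
    rw [one_div, ENNReal.le_rpow_inv_iff hp0]; exact h2
  have h4 : (V⁻¹ * C) ^ (1 / p) ≠ ⊤ :=
    ENNReal.rpow_ne_top_of_nonneg (by positivity) (ENNReal.mul_ne_top (ENNReal.inv_ne_top.2 hV0) hC)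
  have := ENNReal.toReal_mono h4 h3
  rwa [toReal_enorm] at this

/-- Up to `ε/4`, each `φ k` is the simple function of its averages over finitely many balls. The
vectors of averages stay in a bounded subset of a finite-dimensional space, where a finite net
exists. -/
theorem totallyBounded_range_toLp {Ω : Set E} (hΩb : Bornology.IsBounded Ω) (hΩm : MeasurableSet Ω)
    {p : ℝ} (hp : 1 ≤ p) [Fact (1 ≤ ENNReal.ofReal p)] {φ : ℕ → E → ℝ}
    (hφ : ∀ k, ContDiff ℝ 1 (φ k)) (hmem : ∀ k, MemLp (φ k) (ENNReal.ofReal p) (volume.restrict Ω))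
    {C : ℝ≥0∞} (hC : C ≠ ⊤) (hgrad : ∀ k, ∫⁻ x, ‖gradient (φ k) x‖ₑ ^ p ≤ C)
    (hnorm : ∀ k, ∫⁻ x, ‖φ k x‖ₑ ^ p ≤ C) :
    TotallyBounded (range fun k => (hmem k).toLp (φ k)) := by
  have hp0 : 0 < p := by linarith
  set μ := volume.restrict Ω
  have hμ : IsFiniteMeasure μ := ⟨by rw [Measure.restrict_apply_univ]; exact hΩb.measure_lt_top⟩
  refine Metric.totallyBounded_iff.2 fun ε hε => ?_
  obtain ⟨r, hrC, hr⟩ : ∃ r : ℝ, 2 ^ Module.finrank ℝ E * (ENNReal.ofReal (2 * r) ^ p * C) <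
      ENNReal.ofReal (ε / 4) ^ p ∧ 0 < r := by
    have h1 : Tendsto (fun r : ℝ => 2 ^ Module.finrank ℝ E * (ENNReal.ofReal (2 * r) ^ p * C))
        (𝓝[>] 0) (𝓝 (2 ^ Module.finrank ℝ E * (ENNReal.ofReal (2 * 0) ^ p * C))) := by
      refine ENNReal.Tendsto.const_mul ?_ (Or.inr (by simp))
      refine ENNReal.Tendsto.mul_const ?_ (Or.inr hC)
      have : Continuous fun r : ℝ => ENNReal.ofReal (2 * r) ^ p :=
        ENNReal.continuous_rpow_const.comp
          (ENNReal.continuous_ofReal.comp (continuous_const.mul continuous_id))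
      exact (this.tendsto 0).mono_left nhdsWithin_le_nhds
    rw [mul_zero, ENNReal.ofReal_zero, ENNReal.zero_rpow_of_pos hp0, zero_mul, mul_zero] at h1
    have h2 : 0 < ENNReal.ofReal (ε / 4) ^ p :=
      ENNReal.rpow_pos (by simpa using hε) ENNReal.ofReal_ne_top
    exact ((h1.eventually (gt_mem_nhds h2)).and self_mem_nhdsWithin).exists
  obtain ⟨c, hc⟩ := exists_simpleFunc_near hΩb hr
  let a : ℕ → E → ℝ := fun k y => ⨍ x in Metric.ball y r, φ k x
  have happrox : ∀ k, eLpNorm (fun x => φ k x - a k (c x)) (ENNReal.ofReal p) μ ≤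
      ENNReal.ofReal (ε / 4) := by
    intro k
    rw [eLpNorm_ofReal_eq _ _ hp0, one_div, ENNReal.rpow_inv_le_iff hp0]
    refine (lintegral_sub_average_rpow_le (hφ k) hp hr hc hΩm).trans (le_trans ?_ hrC.le)
    gcongr
    exact hgrad k
  let v : ℕ → (c.range → ℝ) := fun k y => a k y
  set B := (((volume (Metric.ball (0 : E) r))⁻¹ * C) ^ (1 / p)).toReal
  have hvB : TotallyBounded (range v) := by
    refine (isCompact_closedBall (0 : c.range → ℝ) B).totallyBounded.subset ?_
    rintro _ ⟨k, rfl⟩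
    rw [mem_closedBall_zero_iff, pi_norm_le_iff_of_nonneg ENNReal.toReal_nonneg]
    exact fun y => abs_average_ball_le (hφ k).continuous hp hC (hnorm k) hr y
  set L := (μ univ ^ (1 / p)).toReal
  have hL : μ univ ^ (1 / p) = ENNReal.ofReal L := (ENNReal.ofReal_toReal
    (ENNReal.rpow_ne_top_of_nonneg (by positivity) (measure_ne_top _ _))).symm
  have hL0 : 0 ≤ L := ENNReal.toReal_nonneg
  set η := ε / 4 / (L + 1)
  have hη : 0 < η := by positivity
  obtain ⟨t, htv, htfin, ht⟩ := totallyBounded_iff_subset.1 hvB _ (Metric.dist_mem_uniformity hη)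
  choose! l hl using fun y (hy : y ∈ t) => htv hy
  refine ⟨(fun y => (hmem (l y)).toLp (φ (l y))) '' t, htfin.image _, ?_⟩
  rintro _ ⟨k, rfl⟩
  obtain ⟨y, hy, hky⟩ := mem_iUnion₂.1 (ht (mem_range_self k))
  refine mem_iUnion₂.2 ⟨_, mem_image_of_mem _ hy, ?_⟩
  have hky' : dist (v k) (v (l y)) < η := by rw [hl y hy]; exact hky
  have hcm : ∀ k, AEStronglyMeasurable (fun x => a k (c x)) μ := fun k =>
    (c.map (a k)).aestronglyMeasurable
  have hdiff : eLpNorm (fun x => a k (c x) - a (l y) (c x)) (ENNReal.ofReal p) μ ≤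
      ENNReal.ofReal (ε / 4) := by
    refine (eLpNorm_le_of_ae_bound (C := η) (ae_of_all _ fun x => ?_)).trans ?_
    · have h1 := (dist_le_pi_dist (v k) (v (l y)) ⟨c x, c.mem_range_self x⟩).trans hky'.le
      rwa [Real.dist_eq] at h1
    · rw [ENNReal.toReal_ofReal hp0.le, ← one_div, hL, ← ENNReal.ofReal_mul hL0]
      refine ENNReal.ofReal_le_ofReal ?_
      rw [← mul_div_assoc, div_le_iff₀ (by positivity)]
      nlinarith
  have hdist : eLpNorm (φ k - φ (l y)) (ENNReal.ofReal p) μ ≤ ENNReal.ofReal (3 * ε / 4) := by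
    have h1 : φ k - φ (l y) = (fun x => φ k x - a k (c x)) +
        ((fun x => a k (c x) - a (l y) (c x)) - fun x => φ (l y) x - a (l y) (c x)) := by
      ext x; simp
    have hm : ∀ k, AEStronglyMeasurable (fun x => φ k x - a k (c x)) μ := fun k =>
      (hφ k).continuous.aestronglyMeasurable.sub (hcm k)
    have hp1 : 1 ≤ ENNReal.ofReal p := Fact.out
    rw [h1]
    refine (eLpNorm_add_le (hm k) (((hcm k).sub (hcm _)).sub (hm _)) hp1).trans ?_
    refine (add_le_add (happrox k)
      ((eLpNorm_sub_le ((hcm k).sub (hcm _)) (hm _) hp1).trans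
        (add_le_add hdiff (happrox _)))).trans (le_of_eq ?_)
    rw [← ENNReal.ofReal_add (by positivity) (by positivity),
      ← ENNReal.ofReal_add (by positivity) (by positivity)]
    congr 1
    ring
  rw [Metric.mem_ball, Lp.dist_def, eLpNorm_congr_ae ((hmem k).coeFn_toLp.sub (hmem _).coeFn_toLp)]
  refine (ENNReal.toReal_mono ENNReal.ofReal_ne_top hdist).trans_lt ?_
  rw [ENNReal.toReal_ofReal (by positivity)]
  linarith

end Compactness

variable {n : ℕ} {Ω : Set (EuclideanSpace ℝ (Fin n))}

theorem IsTestFunction.memLp {φ : EuclideanSpace ℝ (Fin n) → ℝ} (h : IsTestFunction Ω φ)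
    (q : ℝ≥0∞) (μ : Measure (EuclideanSpace ℝ (Fin n))) [IsFiniteMeasureOnCompacts μ] :
    MemLp φ q μ :=
  h.1.continuous.memLp_of_hasCompactSupport h.2.1

theorem IsTestFunction.contDiff_one {φ : EuclideanSpace ℝ (Fin n) → ℝ} (h : IsTestFunction Ω φ) :
    ContDiff ℝ 1 φ :=
  h.1.of_le (by exact_mod_cast le_top)

theorem IsTestFunction.hasCompactSupport_gradient {φ : EuclideanSpace ℝ (Fin n) → ℝ}
    (h : IsTestFunction Ω φ) : HasCompactSupport (gradient φ) :=
  (h.2.1.fderiv (𝕜 := ℝ)).comp_left (map_zero _)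

theorem IsTestFunction.memLp_gradient {φ : EuclideanSpace ℝ (Fin n) → ℝ} (h : IsTestFunction Ω φ)
    (q : ℝ≥0∞) (μ : Measure (EuclideanSpace ℝ (Fin n))) [IsFiniteMeasureOnCompacts μ] :
    MemLp (gradient φ) q μ :=
  (continuous_gradient h.contDiff_one).memLp_of_hasCompactSupport h.hasCompactSupport_gradient

theorem IsTestFunction.gradient_eq_zero {φ : EuclideanSpace ℝ (Fin n) → ℝ}
    (h : IsTestFunction Ω φ) {x : EuclideanSpace ℝ (Fin n)} (hx : x ∉ Ω) : gradient φ x = 0 := by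
  have h1 : x ∉ tsupport (fderiv ℝ φ) := fun hx' => hx (h.2.2 (tsupport_fderiv_subset ℝ hx'))
  rw [gradient, image_eq_zero_of_notMem_tsupport h1, map_zero]

theorem IsTestFunction.eq_zero {φ : EuclideanSpace ℝ (Fin n) → ℝ}
    (h : IsTestFunction Ω φ) {x : EuclideanSpace ℝ (Fin n)} (hx : x ∉ Ω) : φ x = 0 :=
  image_eq_zero_of_notMem_tsupport fun hx' => hx (h.2.2 hx')

theorem exists_subseq_tendsto_eLpNorm (hΩo : IsOpen Ω) (hΩb : Bornology.IsBounded Ω) {p : ℝ}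
    (hp : 1 ≤ p) {φ : ℕ → EuclideanSpace ℝ (Fin n) → ℝ} (hφ : ∀ k, IsTestFunction Ω (φ k))
    {C : ℝ≥0∞} (hC : C ≠ ⊤) (hgrad : ∀ k, ∫⁻ x in Ω, ‖gradient (φ k) x‖ₑ ^ p ≤ C)
    (hnorm : ∀ k, ∫⁻ x in Ω, ‖φ k x‖ₑ ^ p ≤ C) :
    ∃ u, MemLp u (ENNReal.ofReal p) (volume.restrict Ω) ∧ ∃ σ : ℕ → ℕ, StrictMono σ ∧
      Tendsto (fun k => eLpNorm (fun x => φ (σ k) x - u x) (ENNReal.ofReal p) (volume.restrict Ω))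
        atTop (𝓝 0) := by
  have hp0 : 0 < p := by linarith
  have : Fact (1 ≤ ENNReal.ofReal p) := ⟨by simpa using hp⟩
  have hmem := fun k => (hφ k).memLp (ENNReal.ofReal p) (volume.restrict Ω)
  have h1 : ∀ k, ∫⁻ x, ‖φ k x‖ₑ ^ p = ∫⁻ x in Ω, ‖φ k x‖ₑ ^ p := fun k => by
    refine (setLIntegral_eq_of_support_subset fun x hx => ?_).symm
    by_contra hxΩ
    exact hx (by simp [(hφ k).eq_zero hxΩ, hp0])
  have h2 : ∀ k, ∫⁻ x, ‖gradient (φ k) x‖ₑ ^ p = ∫⁻ x in Ω, ‖gradient (φ k) x‖ₑ ^ p := fun k => by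
    refine (setLIntegral_eq_of_support_subset fun x hx => ?_).symm
    by_contra hxΩ
    exact hx (by simp [(hφ k).gradient_eq_zero hxΩ, hp0])
  have htb := totallyBounded_range_toLp hΩb hΩo.measurableSet hp (fun k => (hφ k).contDiff_one) hmem
    hC (fun k => (h2 k).trans_le (hgrad k)) (fun k => (h1 k).trans_le (hnorm k))
  obtain ⟨u, -, σ, hσ, hlim⟩ := (htb.closure.isCompact_of_isClosed
    isClosed_closure).tendsto_subseq fun k => subset_closure (mem_range_self k)
  refine ⟨u, Lp.memLp u, σ, hσ, ?_⟩
  have h3 := (Lp.tendsto_Lp_iff_tendsto_eLpNorm' _ _).1 hlim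
  refine h3.congr fun k => eLpNorm_congr_ae ?_
  exact (hmem (σ k)).coeFn_toLp.sub (ae_eq_refl _)

end Anisotropic
end


/-! ### Uniform convexity of homogeneous integrands and limits of `L^p` functionals. -/

noncomputable section

namespace Anisotropic

section StrictlyConvexHomogeneous

variable {E : Type*} [NormedAddCommGroup E] [NormedSpace ℝ E]

theorem midpoint_lt {F : E → ℝ} (hF : StrictConvexOn ℝ univ F) {x y : E}
    (h : x ≠ y) : F ((2⁻¹ : ℝ) • (x + y)) < (F x + F y) / 2 := by
  have h1 := hF.2 (mem_univ x) (mem_univ y) h (by norm_num : (0 : ℝ) < 2⁻¹)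
    (by norm_num : (0 : ℝ) < 2⁻¹) (by norm_num)
  rw [smul_add]
  simp only [smul_eq_mul] at h1
  linarith

theorem midpoint_le {F : E → ℝ} (hF : StrictConvexOn ℝ univ F) (x y : E) :
    F ((2⁻¹ : ℝ) • (x + y)) ≤ (F x + F y) / 2 := by
  have h1 := hF.convexOn.2 (mem_univ x) (mem_univ y) (by norm_num : (0 : ℝ) ≤ 2⁻¹)
    (by norm_num : (0 : ℝ) ≤ 2⁻¹) (by norm_num)
  rw [smul_add]
  simp only [smul_eq_mul] at h1
  linarith

/-- A strictly convex positively homogeneous function is uniformly convex in the following sense. -/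
theorem exists_norm_sub_rpow_le [FiniteDimensional ℝ E] {F : E → ℝ}
    (hF : StrictConvexOn ℝ univ F) (hFc : Continuous F) {p : ℝ} (hp : 0 < p)
    (hhom : ∀ (r : ℝ) ξ, 0 ≤ r → F (r • ξ) = r ^ p * F ξ) {ε : ℝ} (hε : 0 < ε) :
    ∃ C, 0 ≤ C ∧ ∀ ξ η, ‖ξ - η‖ ^ p ≤ ε * (‖ξ‖ ^ p + ‖η‖ ^ p) +
      C * ((F ξ + F η) / 2 - F ((2⁻¹ : ℝ) • (ξ + η))) := by
  let D : E × E → ℝ := fun z => (F z.1 + F z.2) / 2 - F ((2⁻¹ : ℝ) • (z.1 + z.2))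
  have hD0 : ∀ z, 0 ≤ D z := fun z => sub_nonneg.2 (midpoint_le hF z.1 z.2)
  have hDc : Continuous D := by fun_prop
  -- On this compact set of normalized pairs that are not close, the midpoint gap `D` has a positive
  -- minimum `m`; as `‖z.1 - z.2‖ ≤ 2`, the constant `2^p/m` works. Homogeneity then removes the
  -- normalization.
  let K : Set (E × E) := Metric.sphere 0 1 ∩ {z | ε ≤ ‖z.1 - z.2‖ ^ p}
  have hKc : IsCompact K := (isCompact_sphere _ _).inter_right (isClosed_le continuous_const
    ((continuous_fst.sub continuous_snd).norm.rpow_const fun _ => Or.inr hp.le))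
  obtain ⟨m, hm, hmD⟩ : ∃ m, 0 < m ∧ ∀ z ∈ K, m ≤ D z := by
    refine (hKc.exists_forall_le' (a := 0) hDc.continuousOn fun z hz => sub_pos.2 ?_)
    refine midpoint_lt hF fun h => ?_
    have h2 : ε ≤ ‖z.1 - z.2‖ ^ p := hz.2
    rw [h, sub_self, norm_zero, Real.zero_rpow hp.ne'] at h2
    linarith
  have key : ∀ z : E × E, ‖z‖ = 1 → ‖z.1 - z.2‖ ^ p ≤ ε * (‖z.1‖ ^ p + ‖z.2‖ ^ p) +
      2 ^ p / m * D z := by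
    intro z hz
    have h1 : (1 : ℝ) ≤ ‖z.1‖ ^ p + ‖z.2‖ ^ p := by
      rw [Prod.norm_def] at hz
      rcases max_choice ‖z.1‖ ‖z.2‖ with h | h <;> rw [h] at hz <;> rw [hz, Real.one_rpow]
      · have := Real.rpow_nonneg (norm_nonneg z.2) p; linarith
      · have := Real.rpow_nonneg (norm_nonneg z.1) p; linarith
    have h2 : 0 ≤ 2 ^ p / m * D z := mul_nonneg (by positivity) (hD0 z)
    by_cases h : ε ≤ ‖z.1 - z.2‖ ^ p
    · have h3 := hmD z ⟨by simpa using hz, h⟩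
      have h4 : ‖z.1 - z.2‖ ^ p ≤ 2 ^ p := by
        refine Real.rpow_le_rpow (norm_nonneg _) ?_ hp.le
        have := norm_sub_le z.1 z.2
        have := norm_fst_le z
        have := norm_snd_le z
        linarith
      have h5 : (2 : ℝ) ^ p ≤ 2 ^ p / m * D z := by
        rw [div_mul_eq_mul_div, le_div_iff₀ hm]; gcongr
      have : 0 ≤ ε * (‖z.1‖ ^ p + ‖z.2‖ ^ p) := by positivity
      linarith
    · nlinarith
  refine ⟨2 ^ p / m, by positivity, fun ξ η => ?_⟩
  rcases eq_or_ne (ξ, η) 0 with h0 | h0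
  · obtain ⟨rfl, rfl⟩ := Prod.mk_eq_zero.1 h0
    have h1 : 0 ≤ 2 ^ p / m * ((F 0 + F 0) / 2 - F ((2⁻¹ : ℝ) • ((0 : E) + 0))) :=
      mul_nonneg (by positivity) (hD0 0)
    simpa only [sub_self, norm_zero, Real.zero_rpow hp.ne', add_zero, mul_zero,
      zero_add] using h1
  set r := ‖(ξ, η)‖
  have hr : 0 < r := norm_pos_iff.2 h0
  have h1 := key (r⁻¹ • (ξ, η)) (by rw [norm_smul, norm_inv, norm_norm, inv_mul_cancel₀ hr.ne'])
  have h2 : ∀ a : E, ‖r⁻¹ • a‖ ^ p = r⁻¹ ^ p * ‖a‖ ^ p := fun a => by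
    rw [norm_smul, Real.norm_of_nonneg (inv_nonneg.2 hr.le),
      Real.mul_rpow (inv_nonneg.2 hr.le) (norm_nonneg _)]
  have h3 : D (r⁻¹ • (ξ, η)) = r⁻¹ ^ p * D (ξ, η) := by
    simp only [D, Prod.smul_fst, Prod.smul_snd, ← smul_add]
    rw [smul_comm, hhom _ _ (inv_nonneg.2 hr.le), hhom _ _ (inv_nonneg.2 hr.le),
      hhom _ _ (inv_nonneg.2 hr.le)]
    ring
  rw [h3] at h1
  simp only [Prod.smul_fst, Prod.smul_snd, ← smul_sub, h2] at h1
  have h4 : 0 < r⁻¹ ^ p := by positivity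
  refine le_of_mul_le_mul_left (h1.trans (le_of_eq ?_)) h4
  simp only [D]
  ring

end StrictlyConvexHomogeneous

section LpLimits

variable {X F : Type*} [MeasurableSpace X] [NormedAddCommGroup F] {μ : Measure X} {p : ℝ}

theorem integral_norm_rpow_eq {f : X → F} (hp : 0 < p) (hf : MemLp f (ENNReal.ofReal p) μ) :
    ∫ x, ‖f x‖ ^ p ∂μ = (eLpNorm f (ENNReal.ofReal p) μ).toReal ^ p := by
  rw [hf.eLpNorm_eq_integral_rpow_norm (by simpa using hp) ENNReal.ofReal_ne_top,
    ENNReal.toReal_ofReal hp.le, ENNReal.toReal_ofReal (by positivity),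
    ← Real.rpow_mul (by positivity), inv_mul_cancel₀ hp.ne', Real.rpow_one]

theorem integrable_norm_rpow {f : X → F} (hp : 0 < p) (hf : MemLp f (ENNReal.ofReal p) μ) :
    Integrable (fun x => ‖f x‖ ^ p) μ := by
  have := hf.integrable_norm_rpow (by simpa using hp) ENNReal.ofReal_ne_top
  rwa [ENNReal.toReal_ofReal hp.le] at this

theorem tendsto_integral_norm_rpow {ι : Type*} {l : Filter ι} {f : ι → X → F} {g : X → F}
    (hp : 1 ≤ p) (hf : ∀ i, MemLp (f i) (ENNReal.ofReal p) μ) (hg : MemLp g (ENNReal.ofReal p) μ)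
    (h : Tendsto (fun i => eLpNorm (fun x => f i x - g x) (ENNReal.ofReal p) μ) l (𝓝 0)) :
    Tendsto (fun i => ∫ x, ‖f i x‖ ^ p ∂μ) l (𝓝 (∫ x, ‖g x‖ ^ p ∂μ)) := by
  have hp0 : 0 < p := by linarith
  have : Fact (1 ≤ ENNReal.ofReal p) := ⟨by simpa using hp⟩
  have h1 := ((Lp.tendsto_Lp_iff_tendsto_eLpNorm'' f hf g hg).2 h).norm.rpow_const
    (Or.inr hp0.le : _ ∨ 0 ≤ p)
  simp only [Lp.norm_toLp] at h1
  rw [integral_norm_rpow_eq hp0 hg]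
  exact h1.congr fun i => (integral_norm_rpow_eq hp0 (hf i)).symm

theorem memLp_comp_of_abs_sub_le {N : F → ℝ} {β : ℝ} (hN0 : N 0 = 0)
    (hN : ∀ a b, |N a - N b| ≤ β * ‖a - b‖) {g : X → F} {q : ℝ≥0∞} (hg : MemLp g q μ) :
    MemLp (fun x => N (g x)) q μ := by
  have : LipschitzWith β.toNNReal N := LipschitzWith.of_dist_le_mul fun a b => by
    rw [Real.dist_eq, dist_eq_norm]
    exact (hN a b).trans (by gcongr; exact Real.le_coe_toNNReal β)
  exact this.comp_memLp hN0 hg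

theorem tendsto_integral_comp_rpow {ι : Type*} {l : Filter ι} {f : ι → X → F} {g : X → F}
    (hp : 1 ≤ p) {N : F → ℝ} {β : ℝ} (hN0 : N 0 = 0) (hN : ∀ a b, |N a - N b| ≤ β * ‖a - b‖)
    (hpos : ∀ a, 0 ≤ N a)
    (hf : ∀ i, MemLp (f i) (ENNReal.ofReal p) μ) (hg : MemLp g (ENNReal.ofReal p) μ)
    (h : Tendsto (fun i => eLpNorm (fun x => f i x - g x) (ENNReal.ofReal p) μ) l (𝓝 0)) :
    Tendsto (fun i => ∫ x, N (f i x) ^ p ∂μ) l (𝓝 (∫ x, N (g x) ^ p ∂μ)) := by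
  have h1 : Tendsto (fun i => eLpNorm (fun x => N (f i x) - N (g x)) (ENNReal.ofReal p) μ) l
      (𝓝 0) := by
    have h2 : Tendsto (fun i => ENNReal.ofReal β *
        eLpNorm (fun x => f i x - g x) (ENNReal.ofReal p) μ) l (𝓝 0) := by
      simpa using ENNReal.Tendsto.const_mul h (Or.inr ENNReal.ofReal_ne_top)
    refine tendsto_of_tendsto_of_tendsto_of_le_of_le tendsto_const_nhds h2 (fun _ => zero_le) ?_
    exact fun i => eLpNorm_le_mul_eLpNorm_of_ae_le_mul (ae_of_all _ fun x => hN _ _) _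
  have h3 := tendsto_integral_norm_rpow hp (fun i => memLp_comp_of_abs_sub_le hN0 hN (hf i))
    (memLp_comp_of_abs_sub_le hN0 hN hg) h1
  simpa only [Real.norm_of_nonneg (hpos _)] using h3

end LpLimits

end Anisotropic
end


/-! ### Existence of a minimizer of the Rayleigh quotient. -/

noncomputable section

namespace Anisotropic

variable {n : ℕ} {Ω : Set (EuclideanSpace ℝ (Fin n))}

theorem gradient_add_const_smul {φ ψ : EuclideanSpace ℝ (Fin n) → ℝ} (hφ : Differentiable ℝ φ)
    (hψ : Differentiable ℝ ψ) (t : ℝ) (x : EuclideanSpace ℝ (Fin n)) :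
    gradient (fun x => φ x + t * ψ x) x = gradient φ x + t • gradient ψ x := by
  have h1 : fderiv ℝ (fun x => φ x + t * ψ x) x = fderiv ℝ φ x + t • fderiv ℝ ψ x := by
    have := ((hφ x).hasFDerivAt.add ((hψ x).hasFDerivAt.const_mul t)).fderiv
    exact this
  simp [gradient, h1]

theorem gradient_const_mul {φ : EuclideanSpace ℝ (Fin n) → ℝ} (hφ : Differentiable ℝ φ)
    (t : ℝ) (x : EuclideanSpace ℝ (Fin n)) :
    gradient (fun x => t * φ x) x = t • gradient φ x := by
  have h1 : fderiv ℝ (fun x => t * φ x) x = t • fderiv ℝ φ x :=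
    ((hφ x).hasFDerivAt.const_mul t).fderiv
  simp [gradient, h1]

namespace IsTestFunction

variable {φ ψ : EuclideanSpace ℝ (Fin n) → ℝ}

theorem differentiable (h : IsTestFunction Ω φ) : Differentiable ℝ φ :=
  h.1.differentiable (by simp)

theorem const_mul (h : IsTestFunction Ω φ) (t : ℝ) : IsTestFunction Ω fun x => t * φ x :=
  ⟨contDiff_const.mul h.1, h.2.1.mul_left, (tsupport_mul_subset_right (f := fun _ => t)).trans h.2.2⟩

theorem add (h : IsTestFunction Ω φ) (h' : IsTestFunction Ω ψ) :
    IsTestFunction Ω fun x => φ x + ψ x :=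
  ⟨h.1.add h'.1, h.2.1.add h'.2.1, (tsupport_add φ ψ).trans (union_subset h.2.2 h'.2.2)⟩

end IsTestFunction

theorem exists_isTestFunction (hΩo : IsOpen Ω) (hΩne : Ω.Nonempty) {p : ℝ} (hp : 0 < p) :
    ∃ φ, IsTestFunction Ω φ ∧ 0 < ∫ x in Ω, |φ x| ^ p := by
  obtain ⟨x₀, hx₀⟩ := hΩne
  obtain ⟨r, hr, hball⟩ := Metric.isOpen_iff.1 hΩo x₀ hx₀
  let f : ContDiffBump x₀ := ⟨r / 4, r / 2, by positivity, by linarith⟩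
  have hf : IsTestFunction Ω f := by
    refine ⟨f.contDiff, f.hasCompactSupport, ?_⟩
    rw [f.tsupport_eq]
    exact (Metric.closedBall_subset_ball (by change r / 2 < r; linarith)).trans hball
  refine ⟨f, hf, ?_⟩
  have hint : IntegrableOn (fun x => |f x| ^ p) Ω volume := by
    have := integrable_norm_rpow hp (hf.memLp (ENNReal.ofReal p) (volume.restrict Ω))
    simp only [Real.norm_eq_abs] at this
    exact this
  rw [setIntegral_pos_iff_support_of_nonneg_ae (ae_of_all _ fun x => by positivity) hint]
  refine (Metric.measure_ball_pos volume x₀ (by positivity : 0 < r / 4)).trans_le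
    (measure_mono fun x hx => ⟨?_, hball (Metric.ball_subset_ball (by linarith) hx)⟩)
  have : f x = 1 := f.one_of_mem_closedBall (Metric.ball_subset_closedBall hx)
  simp [this]

variable {H : EuclideanSpace ℝ (Fin n) → ℝ} {α β p : ℝ}

theorem IsSmoothNorm.rpow_smul (h : IsSmoothNorm H α β) (r : ℝ) (ξ : EuclideanSpace ℝ (Fin n))
    (hr : 0 ≤ r) : H (r • ξ) ^ p = r ^ p * H ξ ^ p := by
  rw [h.smul, abs_of_nonneg hr, Real.mul_rpow hr (h.nonneg ξ)]

theorem IsSmoothNorm.integrable_rpow (h : IsSmoothNorm H α β) (hp : 0 < p)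
    {X : Type*} [MeasurableSpace X] {μ : Measure X} {g : X → EuclideanSpace ℝ (Fin n)}
    (hg : MemLp g (ENNReal.ofReal p) μ) : Integrable (fun x => H (g x) ^ p) μ := by
  have := integrable_norm_rpow hp (memLp_comp_of_abs_sub_le h.apply_zero h.abs_sub_le hg)
  simpa only [Real.norm_of_nonneg (h.nonneg _)] using this

/-- The Rayleigh quotients of test functions have an infimum, approached by a normalized
sequence. -/
theorem exists_minimizing_sequence (hΩo : IsOpen Ω) (hΩne : Ω.Nonempty) (hH : IsSmoothNorm H α β)
    (hp : 1 < p) :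
    ∃ lam : ℝ, 0 ≤ lam ∧
      (∀ φ, IsTestFunction Ω φ → lam * ∫ x in Ω, |φ x| ^ p ≤ ∫ x in Ω, H (gradient φ x) ^ p) ∧
      ∃ φ : ℕ → EuclideanSpace ℝ (Fin n) → ℝ, (∀ k, IsTestFunction Ω (φ k)) ∧
        (∀ k, ∫ x in Ω, |φ k x| ^ p = 1) ∧
        Tendsto (fun k => ∫ x in Ω, H (gradient (φ k) x) ^ p) atTop (𝓝 lam) := by
  have hp0 : 0 < p := by linarith
  let S : Set ℝ := {s | ∃ φ, IsTestFunction Ω φ ∧ ∫ x in Ω, |φ x| ^ p = 1 ∧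
    ∫ x in Ω, H (gradient φ x) ^ p = s}
  have hA0 : ∀ φ : EuclideanSpace ℝ (Fin n) → ℝ, 0 ≤ ∫ x in Ω, H (gradient φ x) ^ p := fun φ =>
    integral_nonneg fun x => Real.rpow_nonneg (hH.nonneg _) _
  have hB0 : ∀ φ : EuclideanSpace ℝ (Fin n) → ℝ, 0 ≤ ∫ x in Ω, |φ x| ^ p := fun φ =>
    integral_nonneg fun x => by positivity
  have hbdd : BddBelow S := ⟨0, by rintro _ ⟨φ, -, -, rfl⟩; exact hA0 φ⟩
  have hnorm : ∀ φ, IsTestFunction Ω φ → 0 < ∫ x in Ω, |φ x| ^ p →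
      (∫ x in Ω, H (gradient φ x) ^ p) / ∫ x in Ω, |φ x| ^ p ∈ S := by
    intro φ hφ hpos
    set b := ∫ x in Ω, |φ x| ^ p
    have hc : 0 ≤ b⁻¹ ^ (1 / p) := by positivity
    have hcp : (b⁻¹ ^ (1 / p)) ^ p = b⁻¹ := by
      rw [← Real.rpow_mul (by positivity), one_div, inv_mul_cancel₀ hp0.ne', Real.rpow_one]
    refine ⟨_, hφ.const_mul (b⁻¹ ^ (1 / p)), ?_, ?_⟩
    · simp only [abs_mul, abs_of_nonneg hc, Real.mul_rpow hc (abs_nonneg _), hcp]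
      rw [integral_const_mul, inv_mul_cancel₀ hpos.ne']
    · simp only [gradient_const_mul hφ.differentiable, hH.rpow_smul _ _ hc, hcp]
      rw [integral_const_mul, div_eq_inv_mul]
  obtain ⟨φ₀, hφ₀, hφ₀pos⟩ := exists_isTestFunction hΩo hΩne hp0
  have hSne : S.Nonempty := ⟨_, hnorm φ₀ hφ₀ hφ₀pos⟩
  refine ⟨sInf S, le_csInf hSne (by rintro _ ⟨φ, -, -, rfl⟩; exact hA0 φ), fun φ hφ => ?_, ?_⟩
  · rcases (hB0 φ).eq_or_lt with h0 | h0
    · rw [← h0, mul_zero]; exact hA0 φ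
    · exact (le_div_iff₀ h0).1 (csInf_le hbdd (hnorm φ hφ h0))
  · obtain ⟨s, -, hs, hmem⟩ := exists_seq_tendsto_sInf hSne hbdd
    choose φ hφ h1 h2 using hmem
    exact ⟨φ, hφ, h1, by simpa only [h2] using hs⟩

theorem IsSmoothNorm.lintegral_enorm_rpow_le (h : IsSmoothNorm H α β) (hp : 0 < p)
    {X : Type*} [MeasurableSpace X] {μ : Measure X} {g : X → EuclideanSpace ℝ (Fin n)}
    (hg : MemLp g (ENNReal.ofReal p) μ) :
    ∫⁻ x, ‖g x‖ₑ ^ p ∂μ ≤ ENNReal.ofReal (α⁻¹ ^ p * ∫ x, H (g x) ^ p ∂μ) := by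
  have hα := h.pos
  rw [← integral_const_mul, ofReal_integral_eq_lintegral_ofReal
    ((h.integrable_rpow hp hg).const_mul _)
    (ae_of_all _ fun x => mul_nonneg (by positivity) (Real.rpow_nonneg (h.nonneg _) _))]
  refine lintegral_mono fun x => ?_
  rw [← ofReal_norm, ENNReal.ofReal_rpow_of_nonneg (norm_nonneg _) hp.le,
    ← Real.mul_rpow (by positivity) (h.nonneg _)]
  refine ENNReal.ofReal_le_ofReal (Real.rpow_le_rpow (norm_nonneg _) ?_ hp.le)
  rw [inv_mul_eq_div, le_div_iff₀ hα, mul_comm]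
  exact h.lower _

theorem integral_combination {X : Type*} [MeasurableSpace X] {μ : Measure X} {f₁ f₂ f₃ f₄ f₅ : X → ℝ}
    (h₁ : Integrable f₁ μ) (h₂ : Integrable f₂ μ) (h₃ : Integrable f₃ μ) (h₄ : Integrable f₄ μ)
    (h₅ : Integrable f₅ μ) (b c : ℝ) :
    ∫ x, (b * (f₁ x + f₂ x) + c * ((f₃ x + f₄ x) / 2 - f₅ x)) ∂μ =
      b * (∫ x, f₁ x ∂μ + ∫ x, f₂ x ∂μ) +
        c * ((∫ x, f₃ x ∂μ + ∫ x, f₄ x ∂μ) / 2 - ∫ x, f₅ x ∂μ) := by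
  have h : Integrable (fun x => (f₃ x + f₄ x) / 2) μ := (h₃.add h₄).div_const 2
  have h' : Integrable (fun x => (f₃ x + f₄ x) / 2 - f₅ x) μ := h.sub h₅
  have h'' : Integrable (fun x => f₁ x + f₂ x) μ := h₁.add h₂
  rw [integral_add (h''.const_mul b) (h'.const_mul c), integral_const_mul, integral_const_mul,
    integral_add h₁ h₂, integral_sub h h₅, integral_div, integral_add h₃ h₄]

/-- A minimizing sequence has a subsequence converging in `L^p`. The midpoints of its members
converge to the same limit, so their energies are asymptotically at least `lam`; the convexity gap
therefore tends to zero, and `exists_norm_sub_rpow_le` makes the gradients Cauchy in `L^p`. -/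
theorem exists_minimizer (hΩo : IsOpen Ω) (hΩb : Bornology.IsBounded Ω) (hΩne : Ω.Nonempty)
    (hH : IsSmoothNorm H α β) (hp : 1 < p) (hstrict : StrictConvexOn ℝ univ fun ξ => H ξ ^ p) :
    ∃ lam : ℝ,
      (∀ φ, IsTestFunction Ω φ → lam * ∫ x in Ω, |φ x| ^ p ≤ ∫ x in Ω, H (gradient φ x) ^ p) ∧
      ∃ (u : EuclideanSpace ℝ (Fin n) → ℝ)
        (G : EuclideanSpace ℝ (Fin n) → EuclideanSpace ℝ (Fin n)),
        MemLp u (ENNReal.ofReal p) (volume.restrict Ω) ∧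
        MemLp G (ENNReal.ofReal p) (volume.restrict Ω) ∧
        ∫ x in Ω, |u x| ^ p = 1 ∧ ∫ x in Ω, H (G x) ^ p = lam ∧
        ∃ φ : ℕ → EuclideanSpace ℝ (Fin n) → ℝ, (∀ k, IsTestFunction Ω (φ k)) ∧
          Tendsto (fun k => eLpNorm (fun x => φ k x - u x) (ENNReal.ofReal p)
            (volume.restrict Ω)) atTop (𝓝 0) ∧
          Tendsto (fun k => eLpNorm (fun x => gradient (φ k) x - G x) (ENNReal.ofReal p)
            (volume.restrict Ω)) atTop (𝓝 0) := by
  have hp0 : 0 < p := by linarith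
  have : Fact (1 ≤ ENNReal.ofReal p) := ⟨by simpa using hp.le⟩
  obtain ⟨lam, hlam0, hlam, ψ, hψ, hψ1, hψA⟩ := exists_minimizing_sequence hΩo hΩne hH hp
  set μ := volume.restrict Ω
  obtain ⟨M, hM⟩ := hψA.bddAbove_range
  have hM' : ∀ k, ∫ x in Ω, H (gradient (ψ k) x) ^ p ≤ M := fun k => hM (mem_range_self k)
  have hα := hH.pos
  have hgradψ : ∀ k, ∫⁻ x in Ω, ‖gradient (ψ k) x‖ₑ ^ p ≤ ENNReal.ofReal (α⁻¹ ^ p * M) + 1 :=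
    fun k => (hH.lintegral_enorm_rpow_le hp0 ((hψ k).memLp_gradient _ _)).trans
      ((ENNReal.ofReal_le_ofReal (by gcongr; exact hM' k)).trans le_self_add)
  have hnormψ : ∀ k, ∫⁻ x in Ω, ‖ψ k x‖ₑ ^ p ≤ ENNReal.ofReal (α⁻¹ ^ p * M) + 1 := by
    intro k
    have h1 : ∫⁻ x in Ω, ‖ψ k x‖ₑ ^ p = 1 := by
      have h2 := ofReal_integral_eq_lintegral_ofReal
        (integrable_norm_rpow hp0 ((hψ k).memLp (ENNReal.ofReal p) μ))
        (ae_of_all _ fun x => by positivity)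
      simp only [Real.norm_eq_abs] at h2
      rw [hψ1 k, ENNReal.ofReal_one] at h2
      rw [h2]
      refine lintegral_congr fun x => ?_
      rw [← Real.norm_eq_abs, ← ofReal_norm,
        ENNReal.ofReal_rpow_of_nonneg (norm_nonneg _) hp0.le]
    rw [h1]
    exact le_add_self
  obtain ⟨u, hu, σ, hσ, hσu⟩ := exists_subseq_tendsto_eLpNorm hΩo hΩb hp.le hψ (by finiteness)
    hgradψ hnormψ
  let φ := fun k => ψ (σ k)
  have hφ : ∀ k, IsTestFunction Ω (φ k) := fun k => hψ (σ k)
  have hφm : ∀ k, MemLp (φ k) (ENNReal.ofReal p) μ := fun k => (hφ k).memLp _ _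
  have hφg : ∀ k, MemLp (gradient (φ k)) (ENNReal.ofReal p) μ := fun k => (hφ k).memLp_gradient _ _
  have hφA : Tendsto (fun k => ∫ x in Ω, H (gradient (φ k) x) ^ p) atTop (𝓝 lam) :=
    hψA.comp hσ.tendsto_atTop
  have hu1 : ∫ x in Ω, |u x| ^ p = 1 := by
    have h1 := tendsto_integral_norm_rpow hp.le hφm hu hσu
    simp only [Real.norm_eq_abs, φ, hψ1] at h1
    exact (tendsto_nhds_unique h1 tendsto_const_nhds)
  have hφM : ∀ k, ∫ x in Ω, ‖gradient (φ k) x‖ ^ p ≤ α⁻¹ ^ p * M := fun k => by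
    refine le_trans ?_ (mul_le_mul_of_nonneg_left (hM' (σ k)) (by positivity))
    rw [← integral_const_mul]
    refine integral_mono (integrable_norm_rpow hp0 (hφg k))
      ((hH.integrable_rpow hp0 (hφg k)).const_mul _) fun x => ?_
    change _ ≤ α⁻¹ ^ p * H (gradient (φ k) x) ^ p
    rw [← Real.mul_rpow (by positivity) (hH.nonneg _)]
    refine Real.rpow_le_rpow (norm_nonneg _) ?_ hp0.le
    rw [inv_mul_eq_div, le_div_iff₀ hα, mul_comm]
    exact hH.lower _
  let mid : ℕ × ℕ → EuclideanSpace ℝ (Fin n) → ℝ := fun i x => 2⁻¹ * (φ i.1 x + φ i.2 x)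
  have hmid : ∀ i, IsTestFunction Ω (mid i) := fun i => ((hφ i.1).add (hφ i.2)).const_mul _
  have hmidg : ∀ i x, gradient (mid i) x =
      (2⁻¹ : ℝ) • (gradient (φ i.1) x + gradient (φ i.2) x) := fun i x => by
    have h1 := gradient_const_mul ((hφ i.1).add (hφ i.2)).differentiable 2⁻¹ x
    have h2 := gradient_add_const_smul (hφ i.1).differentiable (hφ i.2).differentiable 1 x
    simp only [one_mul, one_smul] at h2
    rw [← h2]
    exact h1
  have hmidB : Tendsto (fun i => ∫ x in Ω, |mid i x| ^ p) atTop (𝓝 1) := by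
    have h1 : Tendsto (fun i => eLpNorm (fun x => mid i x - u x) (ENNReal.ofReal p) μ) atTop
        (𝓝 0) := by
      have h2 : Tendsto (fun i : ℕ × ℕ => eLpNorm (fun x => φ i.1 x - u x) (ENNReal.ofReal p) μ +
          eLpNorm (fun x => φ i.2 x - u x) (ENNReal.ofReal p) μ) atTop (𝓝 0) := by
        rw [← prod_atTop_atTop_eq, ← add_zero (0 : ℝ≥0∞)]
        exact (hσu.comp tendsto_fst).add (hσu.comp tendsto_snd)
      refine tendsto_of_tendsto_of_tendsto_of_le_of_le tendsto_const_nhds h2 (fun _ => zero_le)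
        fun i => ?_
      have h3 : (fun x => mid i x - u x) =
          (2⁻¹ : ℝ) • ((fun x => φ i.1 x - u x) + fun x => φ i.2 x - u x) := by
        ext x
        simp only [mid, Pi.smul_apply, Pi.add_apply, smul_eq_mul]
        ring
      change eLpNorm (fun x => mid i x - u x) _ _ ≤ _
      rw [h3, eLpNorm_const_smul]
      refine le_trans (mul_le_of_le_one_left zero_le ?_) (eLpNorm_add_le
        ((hφm i.1).sub hu).1 ((hφm i.2).sub hu).1 Fact.out)
      rw [← ofReal_norm]
      exact ENNReal.ofReal_le_one.2 (by norm_num)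
    have h4 := tendsto_integral_norm_rpow hp.le (fun i => (hmid i).memLp _ _) hu h1
    simp only [Real.norm_eq_abs, hu1] at h4
    exact h4
  have hcauchy : CauchySeq fun k => (hφg k).toLp (gradient (φ k)) := by
    rw [cauchySeq_iff_tendsto_dist_atTop_0]
    have hdist : ∀ i : ℕ × ℕ, dist ((hφg i.1).toLp (gradient (φ i.1)))
        ((hφg i.2).toLp (gradient (φ i.2))) =
        (∫ x in Ω, ‖gradient (φ i.1) x - gradient (φ i.2) x‖ ^ p) ^ (1 / p) := by
      intro i
      have h1 := integral_norm_rpow_eq hp0 ((hφg i.1).sub (hφg i.2))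
      simp only [Pi.sub_apply] at h1
      rw [h1, ← Real.rpow_mul ENNReal.toReal_nonneg, mul_one_div_cancel hp0.ne', Real.rpow_one,
        dist_eq_norm, ← MemLp.toLp_sub, Lp.norm_toLp]
    simp only [hdist]
    have hlim : Tendsto (fun i : ℕ × ℕ =>
        ∫ x in Ω, ‖gradient (φ i.1) x - gradient (φ i.2) x‖ ^ p) atTop (𝓝 0) := by
      have hM0 : 0 ≤ M := (integral_nonneg fun x => Real.rpow_nonneg (hH.nonneg _) _).trans (hM' 0)
      refine tendsto_order.2 ⟨fun a ha => Eventually.of_forall fun i =>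
        ha.trans_le (integral_nonneg fun x => by positivity), fun a ha => ?_⟩
      set R := 2 * (α⁻¹ ^ p * M)
      have hR : 0 ≤ R := by positivity
      -- `R` bounds the sum of the two gradient energies, so this tolerance makes the first term of
      -- the estimate at most `a/2`; the gap term is eventually below `a/2`.
      obtain ⟨C, hC, hunif⟩ := exists_norm_sub_rpow_le hstrict
        (hH.continuous.rpow_const fun _ => Or.inr hp0.le) hp0 (fun r ξ hr => hH.rpow_smul r ξ hr)
        (ε := a / 2 / (R + 1)) (by positivity)
      have hD : Tendsto (fun i : ℕ × ℕ => C * (((∫ x in Ω, H (gradient (φ i.1) x) ^ p) +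
          ∫ x in Ω, H (gradient (φ i.2) x) ^ p) / 2 - lam * ∫ x in Ω, |mid i x| ^ p)) atTop
          (𝓝 0) := by
        have h1 : Tendsto (fun i : ℕ × ℕ => (∫ x in Ω, H (gradient (φ i.1) x) ^ p) +
          ∫ x in Ω, H (gradient (φ i.2) x) ^ p) atTop (𝓝 (lam + lam)) := by
          rw [← prod_atTop_atTop_eq]
          exact (hφA.comp tendsto_fst).add (hφA.comp tendsto_snd)
        have h2 := ((h1.div_const 2).sub (hmidB.const_mul lam)).const_mul C
        simpa using h2
      filter_upwards [hD.eventually_lt_const (half_pos ha)] with i hi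
      have h1 := integrable_norm_rpow hp0 ((hφg i.1).sub (hφg i.2))
      have h2 := integrable_norm_rpow hp0 (hφg i.1)
      have h3 := integrable_norm_rpow hp0 (hφg i.2)
      have h4 := hH.integrable_rpow hp0 (hφg i.1)
      have h5 := hH.integrable_rpow hp0 (hφg i.2)
      have h6 := hH.integrable_rpow hp0 ((hmid i).memLp_gradient (ENNReal.ofReal p) μ)
      have h7 : ∫ x in Ω, ‖gradient (φ i.1) x - gradient (φ i.2) x‖ ^ p ≤
          ∫ x in Ω, (a / 2 / (R + 1) * (‖gradient (φ i.1) x‖ ^ p + ‖gradient (φ i.2) x‖ ^ p) +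
            C * ((H (gradient (φ i.1) x) ^ p + H (gradient (φ i.2) x) ^ p) / 2 -
              H (gradient (mid i) x) ^ p)) := by
        refine integral_mono h1 (((h2.add h3).const_mul _).add
          ((((h4.add h5).div_const 2).sub h6).const_mul C)) fun x => ?_
        rw [hmidg]
        exact hunif _ _
      have h8 := integral_combination h2 h3 h4 h5 h6 (a / 2 / (R + 1)) C
      have h9 := mul_le_mul_of_nonneg_left (hlam _ (hmid i)) hC
      have h10 : a / 2 / (R + 1) * ((∫ x in Ω, ‖gradient (φ i.1) x‖ ^ p) +
            ∫ x in Ω, ‖gradient (φ i.2) x‖ ^ p) ≤ a / 2 := by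
        have h11 : (∫ x in Ω, ‖gradient (φ i.1) x‖ ^ p) +
            ∫ x in Ω, ‖gradient (φ i.2) x‖ ^ p ≤ R + 1 := by
          have := hφM i.1; have := hφM i.2; linarith
        calc _ ≤ a / 2 / (R + 1) * (R + 1) := by gcongr
          _ = a / 2 := by field_simp
      rw [h8] at h7
      linarith
    have := hlim.rpow_const (Or.inr (by positivity) : _ ∨ 0 ≤ 1 / p)
    rwa [Real.zero_rpow (by positivity)] at this
  obtain ⟨G, hG⟩ := cauchySeq_tendsto_of_complete hcauchy
  have hG' : Tendsto (fun k => eLpNorm (fun x => gradient (φ k) x - G x) (ENNReal.ofReal p) μ)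
      atTop (𝓝 0) :=
    ((Lp.tendsto_Lp_iff_tendsto_eLpNorm' _ _).1 hG).congr fun k => eLpNorm_congr_ae
      ((hφg k).coeFn_toLp.sub (ae_eq_refl _))
  refine ⟨lam, hlam, u, G, hu, Lp.memLp G, hu1, ?_, φ, hφ, hσu, hG'⟩
  exact tendsto_nhds_unique (tendsto_integral_comp_rpow hp.le hH.apply_zero hH.abs_sub_le hH.nonneg
    hφg (Lp.memLp G) hG') hφA

end Anisotropic
end


/-! ### The first variation and existence of an eigenfunction. -/

noncomputable section

namespace Anisotropic

section IntegralFunctionals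

variable {X F : Type*} [MeasurableSpace X] {μ : Measure X} [NormedAddCommGroup F]

theorem tendsto_integral_of_abs_sub_le [IsFiniteMeasure μ] {ι : Type*} {l : Filter ι}
    {f : ι → X → F} {g : X → F} {q : ℝ≥0∞} (hq : 1 ≤ q)
    (hf : ∀ i, AEStronglyMeasurable (f i) μ) (hg : AEStronglyMeasurable g μ)
    (h : Tendsto (fun i => eLpNorm (fun x => f i x - g x) q μ) l (𝓝 0))
    {a : ι → X → ℝ} {b : X → ℝ} (ha : ∀ i, Integrable (a i) μ) (hb : AEStronglyMeasurable b μ)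
    {c : ℝ} (hle : ∀ i x, |a i x - b x| ≤ c * ‖f i x - g x‖) :
    Tendsto (fun i => ∫ x, a i x ∂μ) l (𝓝 (∫ x, b x ∂μ)) := by
  refine tendsto_integral_of_L1' b hb (Eventually.of_forall ha) ?_
  set K := μ univ ^ (1 / (1 : ℝ≥0∞).toReal - 1 / q.toReal)
  have hK : K ≠ ⊤ := by
    refine ENNReal.rpow_ne_top_of_nonneg ?_ (measure_ne_top _ _)
    rcases eq_or_ne q ⊤ with rfl | hqt
    · simp
    · have h1 : (1 : ℝ) ≤ q.toReal := by
        simpa using ENNReal.toReal_mono hqt hq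
      have : 1 / q.toReal ≤ 1 := div_le_one_of_le₀ h1 (by linarith)
      simpa using this
  have h2 : Tendsto (fun i => ENNReal.ofReal c * (eLpNorm (fun x => f i x - g x) q μ * K)) l
      (𝓝 0) := by
    have h3 := ENNReal.Tendsto.const_mul (ENNReal.Tendsto.mul_const h (Or.inr hK))
      (Or.inr (ENNReal.ofReal_ne_top (r := c)))
    simpa using h3
  refine tendsto_of_tendsto_of_tendsto_of_le_of_le tendsto_const_nhds h2 (fun _ => zero_le)
    fun i => ?_
  refine (eLpNorm_le_mul_eLpNorm_of_ae_le_mul (ae_of_all _ fun x => hle i x) 1).trans ?_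
  gcongr
  exact eLpNorm_le_eLpNorm_mul_rpow_measure_univ hq ((hf i).sub hg)

variable [NormedSpace ℝ F] [FiniteDimensional ℝ F] [MeasurableSpace F] [BorelSpace F]

/-- Differentiation of an integral functional of `p`-growth along a line. -/
theorem hasDerivAt_integral_comp_add_smul {p : ℝ} (hp : 1 < p) {Φ : F → ℝ}
    {Φ' : F → F →L[ℝ] ℝ} {C : ℝ} (hΦ : ∀ ξ, HasFDerivAt Φ (Φ' ξ) ξ)
    (hΦ' : ∀ ξ, ‖Φ' ξ‖ ≤ C * ‖ξ‖ ^ (p - 1)) (hC : 0 ≤ C) {g w : X → F}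
    (hg : MemLp g (ENNReal.ofReal p) μ) (hw : MemLp w (ENNReal.ofReal p) μ)
    (hint : Integrable (fun x => Φ (g x)) μ) :
    HasDerivAt (fun t : ℝ => ∫ x, Φ (g x + t • w x) ∂μ) (∫ x, Φ' (g x) (w x) ∂μ) 0 := by
  have hp0 : 0 < p := by linarith
  have hΦc : Continuous Φ := continuous_iff_continuousAt.2 fun ξ => (hΦ ξ).continuousAt
  have hΦ'm : Measurable Φ' := by
    have : Φ' = fderiv ℝ Φ := funext fun ξ => (hΦ ξ).fderiv.symm
    rw [this]; exact measurable_fderiv ℝ Φ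
  -- For `|t| < 1` the growth of `Φ'` bounds the `t`-derivative by `C (‖g‖ + ‖w‖)^p`, which is
  -- integrable.
  have hsum := integrable_norm_rpow hp0 (hg.norm.add hw.norm)
  have key := (hasDerivAt_integral_of_dominated_loc_of_deriv_le (μ := μ) (𝕜 := ℝ) (x₀ := 0)
    (F := fun t x => Φ (g x + t • w x)) (F' := fun t x => Φ' (g x + t • w x) (w x))
    (bound := fun x => C * ‖(fun x => ‖g x‖ + ‖w x‖) x‖ ^ p) (s := Metric.ball 0 1)
    (Metric.ball_mem_nhds _ one_pos)
    (Eventually.of_forall fun t =>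
      hΦc.comp_aestronglyMeasurable (hg.1.add (hw.1.const_smul t)))
    (by simpa using hint) ?_ ?_ (hsum.const_mul C) ?_).2
  · simpa using key
  · have h1 : AEStronglyMeasurable (fun x => Φ' (g x)) μ :=
      (hΦ'm.comp_aemeasurable hg.1.aemeasurable).aestronglyMeasurable
    simpa using (isBoundedBilinearMap_apply (𝕜 := ℝ) (E := F) (F := ℝ)).continuous
      |>.comp_aestronglyMeasurable (h1.prodMk hw.1)
  · refine ae_of_all _ fun x t ht => ?_
    have ht' : |t| ≤ 1 := by simpa using (mem_ball_zero_iff.1 ht).le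
    have h1 : ‖g x + t • w x‖ ≤ ‖g x‖ + ‖w x‖ := by
      refine (norm_add_le _ _).trans ?_
      rw [norm_smul, Real.norm_eq_abs]
      gcongr
      exact mul_le_of_le_one_left (norm_nonneg _) ht'
    have h2 : 0 ≤ ‖g x‖ + ‖w x‖ := by positivity
    calc ‖Φ' (g x + t • w x) (w x)‖ ≤ ‖Φ' (g x + t • w x)‖ * ‖w x‖ := ContinuousLinearMap.le_opNorm _ _
      _ ≤ C * (‖g x‖ + ‖w x‖) ^ (p - 1) * (‖g x‖ + ‖w x‖) := by
          refine mul_le_mul ((hΦ' _).trans ?_) (le_add_of_nonneg_left (norm_nonneg _))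
            (norm_nonneg _) (by positivity)
          gcongr
      _ = C * ‖‖g x‖ + ‖w x‖‖ ^ p := by
          rw [Real.norm_of_nonneg h2, mul_assoc, ← Real.rpow_add_one' h2 (by linarith),
            sub_add_cancel]
  · refine ae_of_all _ fun x t _ => (hΦ _).comp_hasDerivAt t ?_
    simpa using ((hasDerivAt_id t).smul_const (w x)).const_add (g x)

end IntegralFunctionals

variable {n : ℕ} {Ω : Set (EuclideanSpace ℝ (Fin n))}

theorem IsTestFunction.integral_mul_inner_gradient {φ ψ : EuclideanSpace ℝ (Fin n) → ℝ}
    (hφ : IsTestFunction Ω φ) (hψ : IsTestFunction Ω ψ) (v : EuclideanSpace ℝ (Fin n)) :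
    ∫ x in Ω, φ x * inner ℝ (gradient ψ x) v = -∫ x in Ω, inner ℝ (gradient φ x) v * ψ x := by
  rw [setIntegral_eq_integral_of_forall_compl_eq_zero fun x hx => by rw [hφ.eq_zero hx, zero_mul],
    setIntegral_eq_integral_of_forall_compl_eq_zero fun x hx => by rw [hψ.eq_zero hx, mul_zero]]
  simp only [inner_gradient_left]
  have hφ' : Continuous fun x => fderiv ℝ φ x v :=
    (hφ.contDiff_one.continuous_fderiv one_ne_zero).clm_apply continuous_const
  have hψ' : Continuous fun x => fderiv ℝ ψ x v :=
    (hψ.contDiff_one.continuous_fderiv one_ne_zero).clm_apply continuous_const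
  exact integral_mul_fderiv_eq_neg_fderiv_mul_of_integrable
    ((hφ'.mul hψ.1.continuous).integrable_of_hasCompactSupport hψ.2.1.mul_left)
    ((hφ.1.continuous.mul hψ').integrable_of_hasCompactSupport hφ.2.1.mul_right)
    ((hφ.1.continuous.mul hψ.1.continuous).integrable_of_hasCompactSupport hφ.2.1.mul_right)
    (fun x _ => hφ.differentiable x) (fun x _ => hψ.differentiable x)

/-- Integration by parts holds for the approximating test functions, and both sides are continuous
under `L^q` convergence because `ψ` and its gradient are bounded. -/
theorem isWeakGradient_of_tendsto [IsFiniteMeasure (volume.restrict Ω)] {q : ℝ≥0∞} (hq : 1 ≤ q)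
    {u : EuclideanSpace ℝ (Fin n) → ℝ} {G : EuclideanSpace ℝ (Fin n) → EuclideanSpace ℝ (Fin n)}
    (hu : MemLp u q (volume.restrict Ω)) (hG : MemLp G q (volume.restrict Ω))
    {φ : ℕ → EuclideanSpace ℝ (Fin n) → ℝ} (hφ : ∀ k, IsTestFunction Ω (φ k))
    (hφu : Tendsto (fun k => eLpNorm (fun x => φ k x - u x) q (volume.restrict Ω)) atTop (𝓝 0))
    (hφG : Tendsto (fun k => eLpNorm (fun x => gradient (φ k) x - G x) q (volume.restrict Ω))
      atTop (𝓝 0)) : IsWeakGradient Ω u G := by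
  intro ψ hψ v
  have hψg := continuous_gradient hψ.contDiff_one
  obtain ⟨B, hB⟩ := hψ.2.1.exists_bound_of_continuous hψ.1.continuous
  obtain ⟨B', hB'⟩ := hψ.hasCompactSupport_gradient.exists_bound_of_continuous hψg
  have hcont : Continuous fun x => inner ℝ (gradient ψ x) v := hψg.inner continuous_const
  have hcont' : ∀ k, Continuous fun x => inner ℝ (gradient (φ k) x) v := fun k =>
    (continuous_gradient (hφ k).contDiff_one).inner continuous_const
  have h1 : Tendsto (fun k => ∫ x in Ω, φ k x * inner ℝ (gradient ψ x) v) atTop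
      (𝓝 (∫ x in Ω, u x * inner ℝ (gradient ψ x) v)) := by
    refine tendsto_integral_of_abs_sub_le hq (fun k => ((hφ k).memLp q _).1) hu.1 hφu
      (fun k => ?_) (hu.1.mul hcont.aestronglyMeasurable) (c := B' * ‖v‖) fun k x => ?_
    · exact (((hφ k).1.continuous.mul hcont).integrable_of_hasCompactSupport
        (hφ k).2.1.mul_right).restrict
    · rw [← sub_mul, abs_mul, mul_comm, Real.norm_eq_abs]
      gcongr
      exact (abs_real_inner_le_norm _ _).trans (by gcongr; exact hB' x)
  have h2 : Tendsto (fun k => ∫ x in Ω, inner ℝ (gradient (φ k) x) v * ψ x) atTop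
      (𝓝 (∫ x in Ω, inner ℝ (G x) v * ψ x)) := by
    refine tendsto_integral_of_abs_sub_le hq (fun k => ((hφ k).memLp_gradient q _).1) hG.1 hφG
      (fun k => ?_) ((hG.1.inner aestronglyMeasurable_const).mul
        hψ.1.continuous.aestronglyMeasurable) (c := ‖v‖ * B) fun k x => ?_
    · exact (((hcont' k).mul hψ.1.continuous).integrable_of_hasCompactSupport
        hψ.2.1.mul_left).restrict
    · rw [← sub_mul, abs_mul, ← inner_sub_left]
      calc _ ≤ ‖gradient (φ k) x - G x‖ * ‖v‖ * B := by
            gcongr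
            · exact abs_real_inner_le_norm _ _
            · exact hB x
        _ = _ := by ring
  have h3 := h2.neg
  simp only [← (hφ _).integral_mul_inner_gradient hψ] at h3
  exact tendsto_nhds_unique h1 h3

variable {H : EuclideanSpace ℝ (Fin n) → ℝ} {α β p : ℝ}

/-- Only the origin needs care: there `H^p = O(‖ξ‖^p) = o(‖ξ‖)` because `p > 1`, and the stated
derivative is zero since `H 0 = 0`. -/
theorem IsSmoothNorm.hasFDerivAt_rpow (h : IsSmoothNorm H α β) (hp : 1 < p)
    (ξ : EuclideanSpace ℝ (Fin n)) : HasFDerivAt (fun ξ => H ξ ^ p)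
      ((p * H ξ ^ (p - 1)) • InnerProductSpace.toDual ℝ _ (gradient H ξ)) ξ := by
  rcases eq_or_ne ξ 0 with rfl | hξ
  · rw [h.apply_zero, Real.zero_rpow (by linarith), mul_zero, zero_smul]
    refine HasFDerivAt.of_isLittleO ?_
    have h1 : (fun ξ => H ξ ^ p) =O[𝓝 0] fun ξ => ‖ξ‖ ^ p :=
      Asymptotics.IsBigO.of_bound (β ^ p) (Eventually.of_forall fun ξ => by
        have hβ : 0 ≤ β := h.pos.le.trans h.le
        rw [Real.norm_of_nonneg (Real.rpow_nonneg (h.nonneg ξ) _),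
          Real.norm_of_nonneg (by positivity), ← Real.mul_rpow hβ (norm_nonneg _)]
        exact Real.rpow_le_rpow (h.nonneg _) (h.upper ξ) (by linarith))
    have h2 : (fun ξ : EuclideanSpace ℝ (Fin n) => ‖ξ‖ ^ p) =o[𝓝 0] fun ξ => ξ := by
      refine Asymptotics.isLittleO_iff.2 fun c hc => ?_
      have h3 : Tendsto (fun ξ : EuclideanSpace ℝ (Fin n) => ‖ξ‖ ^ (p - 1)) (𝓝 0) (𝓝 0) := by
        have h4 : Continuous fun ξ : EuclideanSpace ℝ (Fin n) => ‖ξ‖ ^ (p - 1) :=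
          continuous_norm.rpow_const fun _ => Or.inr (by linarith)
        have h5 := h4.tendsto 0
        rwa [norm_zero, Real.zero_rpow (by linarith)] at h5
      filter_upwards [h3.eventually_lt_const hc] with ξ hξ
      rw [Real.norm_of_nonneg (by positivity), ← sub_add_cancel p 1,
        Real.rpow_add_one' (norm_nonneg _) (by linarith)]
      gcongr
    have h6 := h1.trans_isLittleO h2
    simpa [h.apply_zero, Real.zero_rpow (by linarith : p ≠ 0)] using h6
  · exact (h.differentiableAt hξ).hasGradientAt.hasFDerivAt.rpow_const (Or.inr hp.le)

theorem IsSmoothNorm.norm_fderiv_rpow_le (h : IsSmoothNorm H α β) (hp : 1 < p)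
    (ξ : EuclideanSpace ℝ (Fin n)) :
    ‖(p * H ξ ^ (p - 1)) • InnerProductSpace.toDual ℝ _ (gradient H ξ)‖ ≤
      p * β ^ (p - 1) * β * ‖ξ‖ ^ (p - 1) := by
  have hβ : 0 ≤ β := h.pos.le.trans h.le
  have h0 := Real.rpow_nonneg (h.nonneg ξ) (p - 1)
  rw [norm_smul, LinearIsometryEquiv.norm_map, Real.norm_of_nonneg (mul_nonneg (by linarith) h0)]
  have h1 : H ξ ^ (p - 1) ≤ β ^ (p - 1) * ‖ξ‖ ^ (p - 1) := by
    rw [← Real.mul_rpow hβ (norm_nonneg _)]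
    exact Real.rpow_le_rpow (h.nonneg _) (h.upper ξ) (by linarith)
  calc _ ≤ p * (β ^ (p - 1) * ‖ξ‖ ^ (p - 1)) * β := by
        gcongr
        exact h.norm_gradient_le ξ
    _ = _ := by ring

/-- The Rayleigh inequality extends by density from test functions to `u + t ψ`, with equality at `t
= 0`. Vanishing of the `t`-derivative there is the weak equation, after division by `p`. -/
theorem exists_isDirichletEigenvalue (hΩo : IsOpen Ω) (hΩb : Bornology.IsBounded Ω)
    (hΩne : Ω.Nonempty) (hH : IsSmoothNorm H α β) (hp : 1 < p)
    (hstrict : StrictConvexOn ℝ univ fun ξ => H ξ ^ p) :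
    ∃ lam : ℝ, IsDirichletEigenvalue H p Ω lam ∧
      ∀ φ, IsTestFunction Ω φ → lam * ∫ x in Ω, |φ x| ^ p ≤ ∫ x in Ω, H (gradient φ x) ^ p := by
  have hp0 : 0 < p := by linarith
  have hq : 1 ≤ ENNReal.ofReal p := by simpa using hp.le
  have hβ : 0 ≤ β := hH.pos.le.trans hH.le
  have : IsFiniteMeasure (volume.restrict Ω) :=
    ⟨by rw [Measure.restrict_apply_univ]; exact hΩb.measure_lt_top⟩
  obtain ⟨lam, hlam, u, G, hu, hG, hu1, hGlam, φ, hφ, hφu, hφG⟩ :=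
    exists_minimizer hΩo hΩb hΩne hH hp hstrict
  refine ⟨lam, ⟨u, ⟨G, ⟨⟨hu, hG, isWeakGradient_of_tendsto hq hu hG hφ hφu hφG⟩, φ, hφ, hφu, hφG⟩,
    fun ψ hψ => ?_⟩, fun h0 => ?_⟩, hlam⟩
  · have hψm := hψ.memLp (ENNReal.ofReal p) (volume.restrict Ω)
    have hψg := hψ.memLp_gradient (ENNReal.ofReal p) (volume.restrict Ω)
    have hineq : ∀ t : ℝ, lam * ∫ x in Ω, |u x + t • ψ x| ^ p ≤
        ∫ x in Ω, H (G x + t • gradient ψ x) ^ p := by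
      intro t
      have htest : ∀ k, IsTestFunction Ω fun x => φ k x + t * ψ x := fun k =>
        (hφ k).add (hψ.const_mul t)
      have h1 := tendsto_integral_norm_rpow hp.le
        (fun k => (htest k).memLp (ENNReal.ofReal p) (volume.restrict Ω))
        (hu.add (hψm.const_smul t)) (by simpa using hφu)
      have hgr : ∀ k, gradient (fun x => φ k x + t * ψ x) =
          fun x => gradient (φ k) x + t • gradient ψ x := fun k =>
        funext (gradient_add_const_smul (hφ k).differentiable hψ.differentiable t)
      have h2 := tendsto_integral_comp_rpow hp.le hH.apply_zero hH.abs_sub_le hH.nonneg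
        (fun k => (htest k).memLp_gradient (ENNReal.ofReal p) (volume.restrict Ω))
        (hG.add (hψg.const_smul t)) (by simpa [hgr] using hφG)
      exact le_of_tendsto_of_tendsto' (h1.const_mul lam) h2 fun k => by
        simpa only [Real.norm_eq_abs] using hlam _ (htest k)
    have hA := hasDerivAt_integral_comp_add_smul hp (hH.hasFDerivAt_rpow hp)
      (hH.norm_fderiv_rpow_le hp) (by positivity) hG hψg (hH.integrable_rpow hp0 hG)
    have hB := hasDerivAt_integral_comp_add_smul (μ := volume.restrict Ω) hp
      (Φ := fun s : ℝ => |s| ^ p)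
      (fun s => (hasDerivAt_abs_rpow s hp).hasFDerivAt) (C := p) (fun s => by
        rw [ContinuousLinearMap.norm_toSpanSingleton, norm_mul, norm_mul,
          Real.norm_of_nonneg hp0.le, Real.norm_of_nonneg (by positivity : 0 ≤ |s| ^ (p - 2)),
          mul_assoc]
        rcases eq_or_ne s 0 with rfl | hs
        · simp only [norm_zero, mul_zero]; positivity
        · rw [Real.norm_eq_abs, ← Real.rpow_add_one (abs_pos.2 hs).ne']
          ring_nf; rfl) hp0.le hu hψm
      (by simpa only [Real.norm_eq_abs] using integrable_norm_rpow hp0 hu)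
    -- Working with the difference instead of the quotient avoids differentiating a quotient; its
    -- minimum value is `0`, attained at `t = 0`.
    have hmin : IsLocalMin (fun t : ℝ => (∫ x in Ω, H (G x + t • gradient ψ x) ^ p) -
        lam * ∫ x in Ω, |u x + t • ψ x| ^ p) 0 := Eventually.of_forall fun t => by
      simp only [zero_smul, add_zero, hu1, hGlam, mul_one, sub_self]
      exact sub_nonneg.2 (hineq t)
    have h0 := hmin.hasDerivAt_eq_zero (hA.sub (hB.const_mul lam))
    have h1 : ∫ x in Ω, ((p * H (G x) ^ (p - 1)) •
        InnerProductSpace.toDual ℝ _ (gradient H (G x))) (gradient ψ x) =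
        p * ∫ x in Ω, H (G x) ^ (p - 1) * inner ℝ (gradient H (G x)) (gradient ψ x) := by
      rw [← integral_const_mul]
      refine integral_congr_ae (ae_of_all _ fun x => ?_)
      simp only [_root_.smul_apply, InnerProductSpace.toDual_apply_apply, smul_eq_mul, mul_assoc]
    have h2 : ∫ x in Ω, (ContinuousLinearMap.toSpanSingleton ℝ (p * |u x| ^ (p - 2) * u x)) (ψ x) =
        p * ∫ x in Ω, |u x| ^ (p - 2) * u x * ψ x := by
      rw [← integral_const_mul]
      refine integral_congr_ae (ae_of_all _ fun x => ?_)
      simp only [ContinuousLinearMap.toSpanSingleton_apply, smul_eq_mul]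
      ring
    rw [h1, h2] at h0
    refine mul_left_cancel₀ hp0.ne' ?_
    linarith
  · have : ∫ x in Ω, |u x| ^ p = 0 := by
      rw [integral_eq_zero_of_ae]
      filter_upwards [h0] with x hx
      simp [hx, hp0.ne']
    linarith

end Anisotropic
end


/-! ### The eigenvalue estimate. -/

theorem theorem4p1 (n : ℕ) (hn : 2 ≤ n) (p : ℝ) (hp : 1 < p)
    (H : EuclideanSpace ℝ (Fin n) → ℝ)
    (hconv : ConvexOn ℝ Set.univ H)
    (hC1 : ContDiffOn ℝ 1 H {0}ᶜ)
    (hhom : ∀ (t : ℝ) (ξ : EuclideanSpace ℝ (Fin n)), H (t • ξ) = |t| * H ξ)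
    (hlin : ∃ α β : ℝ, 0 < α ∧ α ≤ β ∧ ∀ ξ, α * ‖ξ‖ ≤ H ξ ∧ H ξ ≤ β * ‖ξ‖)
    (hstrict : StrictConvexOn ℝ Set.univ (fun ξ => H ξ ^ p))
    (Ω : Set (EuclideanSpace ℝ (Fin n)))
    (hΩo : IsOpen Ω) (hΩc : Convex ℝ Ω) (hΩb : Bornology.IsBounded Ω) (hΩne : Ω.Nonempty) :
    Anisotropic.firstEigenvalue H p Ω ≤
      ENNReal.ofReal (Anisotropic.piP p / 2) ^ p *
        (Anisotropic.anisotropicPerimeter H Ω / volume Ω) ^ p := by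
  obtain ⟨α, β, hα, hαβ, hbd⟩ := hlin
  have hH : Anisotropic.IsSmoothNorm H α β :=
    ⟨hconv, hC1, hhom, hα, hαβ, fun ξ => (hbd ξ).1, fun ξ => (hbd ξ).2⟩
  have hp0 : 0 < p := by linarith
  have hπ := Anisotropic.piP_pos hp
  have hVt : volume Ω ≠ ⊤ := hΩb.measure_lt_top.ne
  have hV : 0 < volume.real Ω := ENNReal.toReal_pos (hΩo.measure_pos volume hΩne).ne' hVt
  obtain ⟨lam, hlam, hray⟩ :=
    Anisotropic.exists_isDirichletEigenvalue hΩo hΩb hΩne hH hp hstrict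
  have hfirst : Anisotropic.firstEigenvalue H p Ω ≤ ENNReal.ofReal lam :=
    sInf_le (mem_image_of_mem _ hlam)
  refine hfirst.trans ?_
  -- If the perimeter were infinite, the right side would be infinite, because `π_p > 0` and `|Ω| <
  -- ∞`.
  rcases eq_or_ne (Anisotropic.anisotropicPerimeter H Ω) ⊤ with hP | hP
  · rw [hP, ENNReal.top_div_of_ne_top hVt, ENNReal.top_rpow_of_pos hp0, ENNReal.mul_top]
    · exact le_top
    · exact (ENNReal.rpow_pos (by simpa using hπ) ENNReal.ofReal_ne_top).ne'
  set P := (Anisotropic.anisotropicPerimeter H Ω).toReal with hPdef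
  have hP0 : 0 ≤ P := ENNReal.toReal_nonneg
  have hle : lam ≤ (P * (Anisotropic.piP p / 2) / volume.real Ω) ^ p := by
    have hcont : Continuous fun s : ℝ => (s * (Anisotropic.piP p / 2) / volume.real Ω) ^ p :=
      ((continuous_id.mul continuous_const).div_const _).rpow_const fun _ => Or.inr hp0.le
    -- The bound is taken at every `s > P` and then `s → P`; this supplies the positivity needed by
    -- `rayleigh_le_perimeter` without proving `P > 0`.
    refine ge_of_tendsto ((hcont.tendsto P).mono_left (nhdsWithin_le_nhds (s := Ioi P))) ?_
    filter_upwards [self_mem_nhdsWithin] with s hs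
    have hs' : P < s := hs
    refine Anisotropic.rayleigh_le_perimeter (by omega) hΩo hΩc hΩb hΩne hH hp hray
      (hP0.trans_lt hs') ?_
    exact (ENNReal.ofReal_toReal hP).symm.trans_le (ENNReal.ofReal_le_ofReal hs'.le)
  refine (ENNReal.ofReal_le_ofReal hle).trans (le_of_eq ?_)
  rw [← ENNReal.mul_rpow_of_nonneg _ _ hp0.le, ← ENNReal.ofReal_rpow_of_nonneg (by positivity) hp0.le,
    mul_comm P, mul_div_assoc, ENNReal.ofReal_mul (by positivity), ENNReal.ofReal_div_of_pos hV,
    hPdef, ENNReal.ofReal_toReal hP, Measure.real, ENNReal.ofReal_toReal hVt]
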